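/- Let $H$ be a separable real Hilbert space, let $A$ generate a strongly continuous semigroup $(S(t))_{t\ge 0}$ on $H$, and let $Q$ be a bounded selfadjoint nonnegative operator on $H$. Put $Q_t x=\int_0^t S(s)QS^*(s)x\,ds$ for $0\le t\le\infty$, and assume that $\int_0^\infty \mathrm{tr}\,(S(s)QS^*(s))\,ds<\infty$ and that $Q_\infty$ is injective. Let $\mu=N(0,Q_\infty)$ be the centered Gaussian measure on $H$ with covariance operator $Q_\infty$, and let $$R_t\phi(x)=E\,\phi(Z(t,x))=\int_H \phi(S(t)x+y)\,N(0,Q_t)(dy)$$ be the transition semigroup, on bounded Borel functions $\phi$, of the Ornstein-Uhlenbeck process $dZ=AZ\,dt+\sqrt Q\,dW$, $Z(0)=x$. Denote its extension to a strongly continuous semigroup of contractions on $L^2(H,\mu)$ by $(R_t)$ too, and let $L$ be the generator of this extension. Assume that $(R_t)$ is symmetric: $\int_H\psi\,R_t\phi\,d\mu=\int_H\phi\,R_t\psi\,d\mu$ for all bounded Borel $\phi,\psi$ and all $t\ge 0$. In this case $Q$ is injective and the operators $S_Q(t)=Q^{-1/2}S(t)Q^{1/2}$ form a strongly continuous semigroup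 of symmetric contractions on $H$; let $A_Q$ be its generator. Then, for every $\beta\in\mathbb R$ and every $t\ge 0$, one has $$|S_Q(t)h|\le e^{-\beta t}|h|\quad\text{for all } h\in H$$ if and only if $$\Big\|R_t\phi-\int_H\phi\,d\mu\Big\|_{L^2(\mu)}\le e^{-\beta t}\|\phi\|_{L^2(\mu)}\quad\text{for all }\phi\in L^2(H,\mu).$$ Moreover, the spectral gap of $L$ in $L^2(H,\mu)$ equals the spectral gap of $A_Q$ in $H$, where the spectral gap of a nonpositive selfadjoint operator $T$ is $\inf\big(\sigma(-T)\setminus\{0\}\big)\in[0,\infty]$ (with $\inf\emptyset=\infty$). -/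

import Mathlib

open MeasureTheory ProbabilityTheory Set Filter Topology
open scoped ENNReal RealInnerProductSpace InnerProduct

noncomputable section

/-! ### Semigroups, generators, spectra -/

section Semigroups

variable {E : Type*} [NormedAddCommGroup E] [NormedSpace ℝ E]

/-- `T` restricted to `t ≥ 0` is a strongly continuous (`C₀`) semigroup of bounded operators.
The values at negative times play no role. -/
structure IsC0Semigroup (T : ℝ → E →L[ℝ] E) : Prop where
  map_zero : T 0 = ContinuousLinearMap.id ℝ E
  map_add : ∀ s t : ℝ, 0 ≤ s → 0 ≤ t → T (s + t) = T s ∘L T t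
  tendsto_zero : ∀ x : E, Tendsto (fun t => T t x) (𝓝[>] 0) (𝓝 x)

/-- The domain of the infinitesimal generator of `T`: the vectors `x` for which
`t⁻¹ (T t x - x)` converges in norm as `t ↓ 0`. -/
def generatorDomain (T : ℝ → E →L[ℝ] E) : Submodule ℝ E where
  carrier := {x | ∃ y, Tendsto (fun t : ℝ => t⁻¹ • (T t x - x)) (𝓝[>] 0) (𝓝 y)}
  zero_mem' := ⟨0, by simp⟩
  add_mem' := by
    rintro x x' ⟨y, hy⟩ ⟨y', hy'⟩
    refine ⟨y + y', (hy.add hy').congr fun t => ?_⟩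
    rw [map_add, ← smul_add]
    congr 1
    abel
  smul_mem' := by
    rintro c x ⟨y, hy⟩
    refine ⟨c • y, (hy.const_smul c).congr fun t => ?_⟩
    rw [map_smul, ← smul_sub, smul_comm]

/-- The infinitesimal generator of `T`, an unbounded operator:
`x ↦ lim_{t ↓ 0} t⁻¹ (T t x - x)` on its natural domain. -/
def generator (T : ℝ → E →L[ℝ] E) : E →ₗ.[ℝ] E where
  domain := generatorDomain T
  toFun :=
    { toFun := fun x => x.2.choose
      map_add' := by
        intro x x'
        refine tendsto_nhds_unique (x + x').2.choose_spec
          ((x.2.choose_spec.add x'.2.choose_spec).congr fun t => ?_)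
        rw [Submodule.coe_add, map_add, ← smul_add]
        congr 1
        abel
      map_smul' := by
        intro c x
        refine tendsto_nhds_unique (c • x).2.choose_spec
          ((x.2.choose_spec.const_smul c).congr fun t => ?_)
        rw [Submodule.coe_smul, map_smul, ← smul_sub, smul_comm] }

/-- The defining property of the generator. -/
theorem generator_tendsto (T : ℝ → E →L[ℝ] E) (x : (generator T).domain) :
    Tendsto (fun t : ℝ => t⁻¹ • (T t x - x)) (𝓝[>] 0) (𝓝 (generator T x)) :=
  x.2.choose_spec

/-- The resolvent set of an unbounded operator `T`: the `r` for which `r - T : dom T → E`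
has a bounded everywhere defined two-sided inverse `R`. -/
def unboundedResolventSet (T : E →ₗ.[ℝ] E) : Set ℝ :=
  {r | ∃ R : E →L[ℝ] E,
    (∀ x : E, ∃ h : R x ∈ T.domain, r • R x - T ⟨R x, h⟩ = x) ∧
    ∀ z : T.domain, R (r • (z : E) - T z) = z}

/-- The spectrum of an unbounded operator. -/
def unboundedSpectrum (T : E →ₗ.[ℝ] E) : Set ℝ := (unboundedResolventSet T)ᶜ

/-- The spectral gap of a nonpositive selfadjoint operator `T`: the infimum of `σ(-T) \ {0}`,
with value in `[-∞, ∞]` and `inf ∅ = ∞`. -/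
def spectralGap (T : E →ₗ.[ℝ] E) : EReal :=
  sInf ((fun r : ℝ => ((-r : ℝ) : EReal)) '' (unboundedSpectrum T \ {0}))

end Semigroups

variable {H : Type*} [NormedAddCommGroup H] [InnerProductSpace ℝ H] [CompleteSpace H]

/-! ### Bounded nonnegative operators -/

/-- The trace `∑ ⟪T e, e⟫ ∈ [0, ∞]` of a nonnegative operator, over an orthonormal basis of `H`
(the sum does not depend on the basis for nonnegative `T`). -/
def posTrace (T : H →L[ℝ] H) : ℝ≥0∞ :=
  ∑' e : (exists_hilbertBasis ℝ H).choose, ENNReal.ofReal ⟪T (e : H), (e : H)⟫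

open Classical in
/-- The square root of a bounded selfadjoint nonnegative operator `Q`: the unique bounded
selfadjoint nonnegative `R` with `R ∘ R = Q`. -/
def posSqrt (Q : H →L[ℝ] H) : H →L[ℝ] H :=
  if h : ∃ R : H →L[ℝ] H, R.IsPositive ∧ R ∘L R = Q then h.choose else 0

/-! ### Gaussian measures -/

section Gaussian

variable [MeasurableSpace H] [BorelSpace H]

/-- `μ = N(0, C)`: `μ` is Gaussian, centered, with covariance operator `C`. -/
structure IsCenteredGaussian (μ : Measure H) (C : H → H) : Prop where
  isGaussian : IsGaussian μ
  mean : ∫ x, x ∂μ = 0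
  cov : ∀ x y : H, covarianceBilin μ x y = ⟪C x, y⟫

open Classical in
/-- The Gaussian measure `N(0, C)` on `H`. It exists, and is unique, when `C` is a nonnegative
selfadjoint trace class operator; the value otherwise is irrelevant. -/
def gaussianN (C : H → H) : Measure H :=
  if h : ∃ μ : Measure H, IsCenteredGaussian μ C then h.choose else Measure.dirac 0

instance (C : H → H) : IsProbabilityMeasure (gaussianN C) := by
  unfold gaussianN
  split_ifs with h
  · have := h.choose_spec.isGaussian
    infer_instance
  · infer_instance

end Gaussian

/-! ### The Ornstein-Uhlenbeck semigroup of `dZ = A Z dt + √Q dW`, `A` the generator of `S` -/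

/-- `S(s) Q S*(s)`. -/
def covIntegrand (S : ℝ → H →L[ℝ] H) (Q : H →L[ℝ] H) (s : ℝ) : H →L[ℝ] H :=
  S s ∘L Q ∘L ContinuousLinearMap.adjoint (S s)

/-- `Q_t x = ∫_0^t S(s) Q S*(s) x ds`. -/
def covOp (S : ℝ → H →L[ℝ] H) (Q : H →L[ℝ] H) (t : ℝ) (x : H) : H :=
  ∫ s in Ioc 0 t, covIntegrand S Q s x

/-- `Q_∞ x = ∫_0^∞ S(s) Q S*(s) x ds`. -/
def covOpInf (S : ℝ → H →L[ℝ] H) (Q : H →L[ℝ] H) (x : H) : H :=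
  ∫ s in Ioi 0, covIntegrand S Q s x

open Classical in
/-- `S_Q(t) = Q^{-1/2} S(t) Q^{1/2}`: for injective `Q`, the unique bounded operator `T` with
`Q^{1/2} T = S(t) Q^{1/2}`. Such a bounded `T` exists if and only if `S(t)` maps the range of
`Q^{1/2}` into itself. -/
def semigroupQ (S : ℝ → H →L[ℝ] H) (Q : H →L[ℝ] H) (t : ℝ) : H →L[ℝ] H :=
  if h : ∃ T : H →L[ℝ] H, posSqrt Q ∘L T = S t ∘L posSqrt Q then h.choose else 0

section OU

variable [MeasurableSpace H] [BorelSpace H]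

/-- The invariant measure `μ = N(0, Q_∞)`. -/
def invMeasure (S : ℝ → H →L[ℝ] H) (Q : H →L[ℝ] H) : Measure H :=
  gaussianN (covOpInf S Q)

instance (S : ℝ → H →L[ℝ] H) (Q : H →L[ℝ] H) : IsProbabilityMeasure (invMeasure S Q) := by
  unfold invMeasure
  infer_instance

/-- The transition semigroup `R_t φ (x) = E φ(Z(t, x))` on functions. The law of
`Z(t, x) = S(t) x + ∫_0^t S(t - s) √Q dW(s)` is `N(S(t) x, Q_t)`, the image of `N(0, Q_t)`
under `y ↦ S(t) x + y`. -/
def ouSemigroup (S : ℝ → H →L[ℝ] H) (Q : H →L[ℝ] H) (t : ℝ) (φ : H → ℝ) (x : H) : ℝ :=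
  ∫ y, φ (S t x + y) ∂(gaussianN (covOp S Q t))

/-- `μ` is symmetrizing for `(R_t)`: `∫ ψ R_t φ dμ = ∫ φ R_t ψ dμ` for all bounded Borel
functions `φ`, `ψ` and all `t ≥ 0`. -/
def IsSymmetricOU (S : ℝ → H →L[ℝ] H) (Q : H →L[ℝ] H) : Prop :=
  ∀ t : ℝ, 0 ≤ t → ∀ φ ψ : H → ℝ, Measurable φ → Measurable ψ →
    (∃ c : ℝ, ∀ x, |φ x| ≤ c) → (∃ c : ℝ, ∀ x, |ψ x| ≤ c) →
    ∫ x, ψ x * ouSemigroup S Q t φ x ∂(invMeasure S Q) =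
      ∫ x, φ x * ouSemigroup S Q t ψ x ∂(invMeasure S Q)

open Classical in
/-- The extension of `R_t` from bounded Borel functions to a bounded operator on `L²(H, μ)`.
It is unique, as the bounded Borel functions are dense. -/
def ouL2 (S : ℝ → H →L[ℝ] H) (Q : H →L[ℝ] H) (t : ℝ) :
    Lp ℝ 2 (invMeasure S Q) →L[ℝ] Lp ℝ 2 (invMeasure S Q) :=
  if h : ∃ T : Lp ℝ 2 (invMeasure S Q) →L[ℝ] Lp ℝ 2 (invMeasure S Q),
      ∀ φ : H → ℝ, Measurable φ → (∃ c : ℝ, ∀ x, |φ x| ≤ c) →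
        ∀ f : Lp ℝ 2 (invMeasure S Q), f =ᵐ[invMeasure S Q] φ →
          T f =ᵐ[invMeasure S Q] ouSemigroup S Q t φ
    then h.choose else 0

end OU

end

/-! Write C for `covOpInf S Q` and c for exp(-βt). Both estimates in the equivalence amount to one
inequality between quadratic forms, ⟪C S*(t)x, S*(t)x⟫ ≤ c² ⟪Cx, x⟫ for all x. This is shown in
`norm_semigroupQ_le_iff` and `norm_ouL2_sub_le_iff`.

The link to `semigroupQ`: testing the symmetry of R_t on sines gives C S*(t) = S(t) C
(`covOpInf_adjoint_comm`), and differentiating the covariances Q_s at s = 0 gives Q S*(t) = S(t) Q.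
Hence Q^{1/2} x ↦ Q^{1/2} S*(t) x extends to S_Q(t), and its norm is at most c exactly when the form
inequality holds with Q in place of C. Integration along the semigroup leads from Q to C. For the
way back, S*(t) is symmetric for the form of Q_s ≤ C, so the values of that form along an orbit of
S*(t) are log-convex. A log-convex sequence dominated by a geometric one contracts at that rate from
its first step (`le_mul_of_sq_le_of_le_geometric`). Dividing by s and letting s → 0 gives the
inequality for Q.

The link to L²(μ): the functions cos(⟪a, x⟫ + θ) are total, R_t maps each of them to a multiple of
another, and their distance to the mean is explicit. The squared distance is at most ⟪C S*(t)a,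
S*(t)a⟫, so under the form inequality the powers of the symmetric operator R_t - mean decay like cⁿ
on a total set, and the same log-convexity bounds its norm by c. Conversely, testing on sines of
small frequency and letting the frequency tend to 0 returns the form inequality. No chaos
decomposition is involved.

The spectral gaps: for a symmetric contraction semigroup T_t with strong limit P, and β ≥ 0, the gap
of the generator is at least β if and only if ‖T_t x - P x‖ ≤ exp(-βt)‖x‖ for all t ≥ 0 and all x
(`le_spectralGap_iff_decay`). Decay gives resolvents by Laplace transform. The converse replaces the
spectral theorem by operator inequalities for the resolvent at 1. The limit P is the mean for R_t
and 0 for S_Q(t), so the equivalence of the two decay estimates makes the gaps equal. -/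

/-! ### Bounded symmetric operators on a real Hilbert space -/

section SymmetricOperators

variable {K : Type*} [NormedAddCommGroup K] [InnerProductSpace ℝ K]

/-- Cauchy–Schwarz inequality for the form of a nonnegative operator. -/
theorem ContinuousLinearMap.IsPositive.inner_sq_le {B : K →L[ℝ] K} (hB : B.IsPositive) (x y : K) :
    ⟪B x, y⟫ ^ 2 ≤ ⟪B x, x⟫ * ⟪B y, y⟫ := by
  have key : ∀ t : ℝ, 0 ≤ ⟪B x, x⟫ * (t * t) + (2 * ⟪B x, y⟫) * t + ⟪B y, y⟫ := by
    intro t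
    have h := hB.inner_nonneg_left (t • x + y)
    have hs : ⟪B y, x⟫ = ⟪B x, y⟫ := by
      rw [hB.inner_left_eq_inner_right, real_inner_comm]
    simp only [map_add, map_smul, inner_add_left, inner_add_right, real_inner_smul_left,
      real_inner_smul_right, hs] at h
    linarith
  have h := discrim_le_zero key
  rw [discrim] at h
  linarith

/-- Cauchy–Schwarz for the form of B with y = B x, followed by cancelling ‖B x‖². -/
theorem ContinuousLinearMap.IsPositive.norm_sq_le_of_form_le {B : K →L[ℝ] K} (hB : B.IsPositive)
    {a : ℝ} (h : ∀ x, ⟪B x, x⟫ ≤ a * ‖x‖ ^ 2) (x : K) : ‖B x‖ ^ 2 ≤ a * ⟪B x, x⟫ := by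
  have h1 := hB.inner_sq_le x (B x)
  rw [real_inner_self_eq_norm_sq] at h1
  have h2 := mul_le_mul_of_nonneg_left (h (B x)) (hB.inner_nonneg_left x)
  rcases (norm_nonneg (B x)).eq_or_lt with h0 | h0
  · have : B x = 0 := norm_eq_zero.1 h0.symm
    simp [this]
  · have h3 : 0 < ‖B x‖ ^ 2 := by positivity
    refine le_of_mul_le_mul_right ?_ h3
    nlinarith

/-- A log-convex sequence which is dominated by a geometric one decreases at the geometric rate
from the first step on. -/
theorem le_mul_of_sq_le_of_le_geometric {u : ℕ → ℝ} {c C : ℝ} (h0 : ∀ n, 0 ≤ u n)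
    (hlc : ∀ n, u (n + 1) ^ 2 ≤ u n * u (n + 2)) (hc : 0 < c) (hb : ∀ n, u n ≤ C * c ^ n) :
    u 1 ≤ c * u 0 := by
  by_contra! hcon
  have hu1 : 0 < u 1 := (mul_nonneg hc.le (h0 0)).trans_lt hcon
  have hu0 : 0 < u 0 := by
    refine (h0 0).lt_of_ne fun h => ?_
    have := hlc 0
    rw [← h, zero_mul] at this
    have h2 : 0 < u (0 + 1) ^ 2 := by positivity
    linarith
  -- Log-convexity makes the ratios u (n+1) / u n nondecreasing, so they all stay at least ρ. If ρ >
  -- c, then u grows at least like ρⁿ, which eventually exceeds C cⁿ.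
  set ρ := u 1 / u 0 with hρ
  have hcρ : c < ρ := by rwa [hρ, lt_div_iff₀ hu0]
  have hρ0 : 0 < ρ := hc.trans hcρ
  have step : ∀ n, 0 < u n ∧ ρ * u n ≤ u (n + 1) := by
    intro n
    induction n with
    | zero => exact ⟨hu0, by rw [hρ, div_mul_cancel₀ _ hu0.ne']⟩
    | succ n ih =>
      obtain ⟨hn, hn'⟩ := ih
      have hn1 : 0 < u (n + 1) := (mul_pos hρ0 hn).trans_le hn'
      refine ⟨hn1, le_of_mul_le_mul_left ?_ hn⟩
      have := hlc n
      nlinarith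
  have geo : ∀ n, ρ ^ n * u 0 ≤ u n := by
    intro n
    induction n with
    | zero => simp
    | succ n ih =>
      calc ρ ^ (n + 1) * u 0 = ρ * (ρ ^ n * u 0) := by ring
        _ ≤ ρ * u n := by gcongr
        _ ≤ u (n + 1) := (step n).2
  have hr : 1 < ρ / c := by rwa [one_lt_div hc]
  obtain ⟨n, hn⟩ := ((tendsto_pow_atTop_atTop_of_one_lt hr).eventually_gt_atTop (C / u 0)).exists
  have h1 := (geo n).trans (hb n)
  rw [div_pow, div_lt_div_iff₀ hu0 (by positivity)] at hn
  linarith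

/-- If the orbit of `g` under a symmetric operator decays geometrically at rate `c`, then already
the first step decreases the norm by the factor `c`. -/
theorem norm_apply_le_of_orbit_le_geometric {T : K →L[ℝ] K} (hT : ∀ x y, ⟪T x, y⟫ = ⟪x, T y⟫)
    {c C : ℝ} (hc : 0 < c) {g : K} (hC : ∀ n : ℕ, ‖(T ^ n) g‖ ≤ C * c ^ n) :
    ‖T g‖ ≤ c * ‖g‖ := by
  refine le_mul_of_sq_le_of_le_geometric (u := fun n => ‖(T ^ n) g‖) (fun n => norm_nonneg _)
    (fun n => ?_) hc hC |>.trans_eq' ?_ |>.trans_eq ?_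
  · have e1 : (T ^ (n + 1)) g = T ((T ^ n) g) := by rw [pow_succ']; rfl
    have e2 : (T ^ (n + 2)) g = T ((T ^ (n + 1)) g) := by rw [pow_succ']; rfl
    calc ‖(T ^ (n + 1)) g‖ ^ 2 = ⟪(T ^ n) g, (T ^ (n + 2)) g⟫ := by
          rw [e2, ← hT, ← e1, real_inner_self_eq_norm_sq]
      _ ≤ _ := real_inner_le_norm _ _
  · simp
  · simp

/-- A symmetric operator whose powers decay geometrically at rate `c` on a total set has
norm at most `c`. -/
theorem norm_apply_le_of_pow_le_geometric {T : K →L[ℝ] K} (hT : ∀ x y, ⟪T x, y⟫ = ⟪x, T y⟫)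
    {D : Set K} (hD : Dense (Submodule.span ℝ D : Set K)) {c : ℝ} (hc : 0 < c)
    (h : ∀ f ∈ D, ∃ C : ℝ, ∀ n : ℕ, ‖(T ^ n) f‖ ≤ C * c ^ n) (f : K) : ‖T f‖ ≤ c * ‖f‖ := by
  have hspan : ∀ f ∈ Submodule.span ℝ D, ∃ C : ℝ, ∀ n : ℕ, ‖(T ^ n) f‖ ≤ C * c ^ n := by
    intro f hf
    induction hf using Submodule.span_induction with
    | mem x hx => exact h x hx
    | zero => exact ⟨0, by simp⟩
    | add x y _ _ hx hy =>
      obtain ⟨C, hC⟩ := hx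
      obtain ⟨C', hC'⟩ := hy
      refine ⟨C + C', fun n => ?_⟩
      rw [map_add, add_mul]
      exact (norm_add_le _ _).trans (add_le_add (hC n) (hC' n))
    | smul a x _ hx =>
      obtain ⟨C, hC⟩ := hx
      refine ⟨|a| * C, fun n => ?_⟩
      rw [map_smul, norm_smul, Real.norm_eq_abs, mul_assoc]
      exact mul_le_mul_of_nonneg_left (hC n) (abs_nonneg a)
  have hcl : IsClosed {f : K | ‖T f‖ ≤ c * ‖f‖} :=
    isClosed_le (by fun_prop) (by fun_prop)
  refine hcl.closure_subset_iff.2 ?_ (hD f)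
  intro g hg
  obtain ⟨C, hC⟩ := hspan g hg
  exact norm_apply_le_of_orbit_le_geometric hT hc hC

/-- A symmetric operator `B` such that `B - m` has a bounded left inverse for every `m < 0` is
nonnegative. -/
theorem inner_nonneg_of_forall_neg_leftInverse {B : K →L[ℝ] K} (hB : ∀ x y, ⟪B x, y⟫ = ⟪x, B y⟫)
    (h : ∀ m : ℝ, m < 0 → ∃ J : K →L[ℝ] K, ∀ x, J (B x - m • x) = x) (x : K) : 0 ≤ ⟪B x, x⟫ := by
  by_contra! hx
  have hx0 : 0 < ‖x‖ ^ 2 := by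
    have : x ≠ 0 := by rintro rfl; simp at hx
    positivity
  set s : Set ℝ := {m | ∀ y, m * ‖y‖ ^ 2 ≤ ⟪B y, y⟫} with hs
  have hne : s.Nonempty := by
    refine ⟨-‖B‖, fun y => ?_⟩
    have h1 := abs_real_inner_le_norm (B y) y
    have h2 := B.le_opNorm y
    have h3 := neg_abs_le ⟪B y, y⟫
    nlinarith [norm_nonneg y]
  have hbd : BddAbove s := by
    refine ⟨0, fun m hm => ?_⟩
    by_contra! hm0
    have := hm x
    nlinarith
  -- m is the bottom of the numerical range of B. If m < 0, the left inverse of B - m bounds B - m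
  -- from below, and then m could still be raised.
  set m := sSup s with hm
  have hms : m ∈ s := by
    intro y
    rcases (norm_nonneg y).eq_or_lt with h0 | h0
    · have : y = 0 := norm_eq_zero.1 h0.symm
      simp [this]
    · have h0' : 0 < ‖y‖ ^ 2 := by positivity
      rw [← le_div_iff₀ h0']
      refine csSup_le hne fun k hk => ?_
      rw [le_div_iff₀ h0']
      exact hk y
  have hm0 : m < 0 := by
    by_contra! hm0
    have := hms x
    nlinarith
  obtain ⟨J, hJ⟩ := h m hm0
  set C : K →L[ℝ] K := B - m • ContinuousLinearMap.id ℝ K with hC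
  have hCa : ∀ y, C y = B y - m • y := fun y => by simp [hC]
  have hCp : C.IsPositive := by
    rw [ContinuousLinearMap.isPositive_iff]
    refine ⟨fun y z => ?_, fun y => ?_⟩
    · simp only [ContinuousLinearMap.coe_coe, hCa, inner_sub_left, inner_sub_right, hB,
        real_inner_smul_left, real_inner_smul_right]
    · rw [hCa, inner_sub_left, real_inner_smul_left, real_inner_self_eq_norm_sq]
      linarith [hms y]
  have hCn : ∀ y, ‖C y‖ ^ 2 ≤ ‖C‖ * ⟪C y, y⟫ := by
    refine hCp.norm_sq_le_of_form_le fun y => ?_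
    have h1 := real_inner_le_norm (C y) y
    have h2 := C.le_opNorm y
    nlinarith [norm_nonneg y]
  -- The summand 1 only keeps M positive.
  set M := ‖J‖ ^ 2 * ‖C‖ + 1 with hM
  have hM0 : 0 < M := by positivity
  have hlow : ∀ y, ‖y‖ ^ 2 ≤ M * ⟪C y, y⟫ := by
    intro y
    have h1 : ‖y‖ ≤ ‖J‖ * ‖C y‖ := by
      conv_lhs => rw [← hJ y, ← hCa]
      exact J.le_opNorm _
    have h2 : ‖y‖ ^ 2 ≤ ‖J‖ ^ 2 * ‖C y‖ ^ 2 := by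
      rw [← mul_pow]
      gcongr
    have h3 := mul_le_mul_of_nonneg_left (hCn y) (sq_nonneg ‖J‖)
    have h4 := hCp.inner_nonneg_left y
    rw [hM]
    nlinarith
  have : m + M⁻¹ ∈ s := by
    intro y
    have h1 := hlow y
    rw [hCa, inner_sub_left, real_inner_smul_left, real_inner_self_eq_norm_sq] at h1
    have h2 : M⁻¹ * ‖y‖ ^ 2 ≤ ⟪B y, y⟫ - m * ‖y‖ ^ 2 := by
      rw [inv_mul_le_iff₀ hM0]
      exact h1
    linarith
  have h1 := le_csSup hbd this
  have h2 : 0 < M⁻¹ := by positivity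
  linarith

end SymmetricOperators

/-! ### Square roots of bounded nonnegative operators by monotone iteration -/

section SquareRoot

open Polynomial

/-- The polynomials of the iteration `y ↦ (X + y²) / 2`, which tends to `1 - √(1 - X)`. -/
noncomputable def sqrtPoly : ℕ → ℝ[X]
  | 0 => 0
  | n + 1 => C (1 / 2) * (X + sqrtPoly n ^ 2)

theorem Polynomial.coeff_mul_nonneg' {p q : ℝ[X]} (hp : ∀ i, 0 ≤ p.coeff i)
    (hq : ∀ i, 0 ≤ q.coeff i) (i : ℕ) : 0 ≤ (p * q).coeff i := by
  rw [coeff_mul]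
  exact Finset.sum_nonneg fun x _ => mul_nonneg (hp _) (hq _)

theorem sqrtPoly_coeff_nonneg (n i : ℕ) : 0 ≤ (sqrtPoly n).coeff i := by
  induction n generalizing i with
  | zero => simp [sqrtPoly]
  | succ n ih =>
    rw [sqrtPoly, coeff_C_mul, coeff_add, pow_two, coeff_X]
    have := coeff_mul_nonneg' ih ih i
    split_ifs <;> linarith

/-- The increment factors as half of (previous increment) times (sum of consecutive iterates), and
products of polynomials with nonnegative coefficients have nonnegative coefficients. -/
theorem sqrtPoly_sub_coeff_nonneg (n i : ℕ) : 0 ≤ (sqrtPoly (n + 1) - sqrtPoly n).coeff i := by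
  induction n generalizing i with
  | zero => simpa [sqrtPoly] using sqrtPoly_coeff_nonneg 1 i
  | succ n ih =>
    have e : sqrtPoly (n + 1 + 1) - sqrtPoly (n + 1)
        = C (1 / 2) * ((sqrtPoly (n + 1) - sqrtPoly n) * (sqrtPoly (n + 1) + sqrtPoly n)) := by
      rw [sqrtPoly]
      conv_lhs => rw [show sqrtPoly (n + 1) = C (1 / 2) * (X + sqrtPoly n ^ 2) from rfl]
      conv_rhs => rw [show sqrtPoly (n + 1) = C (1 / 2) * (X + sqrtPoly n ^ 2) from rfl]
      ring
    rw [e, coeff_C_mul]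
    refine mul_nonneg (by norm_num) (coeff_mul_nonneg' ih (fun j => ?_) i)
    rw [coeff_add]
    exact add_nonneg (sqrtPoly_coeff_nonneg _ _) (sqrtPoly_coeff_nonneg _ _)

theorem sqrtPoly_sub_coeff_nonneg_of_le {m n : ℕ} (h : m ≤ n) (i : ℕ) :
    0 ≤ (sqrtPoly n - sqrtPoly m).coeff i := by
  induction n, h using Nat.le_induction with
  | base => simp
  | succ n _ ih =>
    have := sqrtPoly_sub_coeff_nonneg n i
    rw [coeff_sub] at *
    linarith

theorem sqrtPoly_eval_one_le (n : ℕ) : (sqrtPoly n).eval 1 ≤ 1 := by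
  have h0 : 0 ≤ (sqrtPoly n).eval 1 := by
    rw [eval_eq_sum_range]
    exact Finset.sum_nonneg fun i _ => by simpa using sqrtPoly_coeff_nonneg n i
  induction n with
  | zero => simp [sqrtPoly]
  | succ n ih =>
    have h1 : 0 ≤ (sqrtPoly n).eval 1 := by
      rw [eval_eq_sum_range]
      exact Finset.sum_nonneg fun i _ => by simpa using sqrtPoly_coeff_nonneg n i
    have := ih h1
    simp only [sqrtPoly, eval_mul, eval_C, eval_add, eval_X, eval_pow]
    nlinarith

variable {K : Type*} [NormedAddCommGroup K] [InnerProductSpace ℝ K]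

/-- Nonnegative coefficients let the scalar value at 1 majorize the operator, so convergence of the
operator iteration reduces to a bounded monotone real sequence. -/
theorem norm_aeval_le_eval_one {P : K →L[ℝ] K} (hP : ‖P‖ ≤ 1) {q : ℝ[X]}
    (hq : ∀ i, 0 ≤ q.coeff i) : ‖aeval P q‖ ≤ q.eval 1 := by
  rw [aeval_eq_sum_range, eval_eq_sum_range]
  refine norm_sum_le_of_le _ fun i _ => ?_
  have hpow : ∀ i : ℕ, ‖P ^ i‖ ≤ 1 := by
    intro i
    induction i with
    | zero => exact ContinuousLinearMap.norm_id_le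
    | succ i ih =>
      rw [pow_succ]
      exact (norm_mul_le _ _).trans (mul_le_one₀ ih (norm_nonneg _) hP)
  rw [norm_smul, Real.norm_eq_abs, abs_of_nonneg (hq i), one_pow]
  exact mul_le_mul_of_nonneg_left (hpow i) (hq i)

theorem isSelfAdjoint_aeval [CompleteSpace K] {P : K →L[ℝ] K} (hP : IsSelfAdjoint P) (q : ℝ[X]) :
    IsSelfAdjoint (aeval P q) := by
  rw [aeval_eq_sum_range]
  exact isSelfAdjoint_sum _ fun i _ => (IsSelfAdjoint.all (q.coeff i)).smul (hP.pow i)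

/-- A self-adjoint operator `P` of norm at most `1` is of the form `1 - R²`, `R` nonnegative. -/
theorem exists_isPositive_comp_self_eq_one_sub [CompleteSpace K] {P : K →L[ℝ] K}
    (hP : IsSelfAdjoint P) (hP1 : ‖P‖ ≤ 1) :
    ∃ R : K →L[ℝ] K, R.IsPositive ∧ R * R = 1 - P := by
  set y : ℕ → ℝ := fun n => (sqrtPoly n).eval 1 with hy
  have hdiff : ∀ {m n : ℕ}, m ≤ n →
      ‖aeval P (sqrtPoly n) - aeval P (sqrtPoly m)‖ ≤ y n - y m := by
    intro m n h
    rw [← map_sub]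
    refine (norm_aeval_le_eval_one hP1 (sqrtPoly_sub_coeff_nonneg_of_le h)).trans_eq ?_
    simp [hy]
  have hmono : Monotone y := fun m n h => by
    have := (norm_nonneg _).trans (hdiff h)
    linarith
  have hbdd : BddAbove (range y) := ⟨1, by rintro _ ⟨n, rfl⟩; exact sqrtPoly_eval_one_le n⟩
  have hyc : CauchySeq y := (tendsto_atTop_ciSup hmono hbdd).cauchySeq
  have hc : CauchySeq fun n => aeval P (sqrtPoly n) := by
    rw [Metric.cauchySeq_iff'] at hyc ⊢
    intro ε hε
    obtain ⟨N, hN⟩ := hyc ε hε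
    refine ⟨N, fun n hn => ?_⟩
    rw [dist_eq_norm]
    have h1 := hN n hn
    rw [Real.dist_eq] at h1
    exact ((hdiff hn).trans (le_abs_self _)).trans_lt h1
  obtain ⟨Y, hY⟩ := cauchySeq_tendsto_of_complete hc
  -- The limit is a fixed point of y ↦ (P + y²)/2, which is the same as (1 - Y)² = 1 - P.
  have hY2 : Y = (1 / 2 : ℝ) • (P + Y * Y) := by
    refine tendsto_nhds_unique (hY.comp (tendsto_add_atTop_nat 1)) ?_
    refine ((hY.mul hY).const_add P |>.const_smul (1 / 2 : ℝ)).congr fun n => ?_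
    simp only [Function.comp, sqrtPoly, map_mul, map_add, aeval_X, aeval_C, pow_two,
      Algebra.algebraMap_eq_smul_one, smul_mul_assoc, one_mul]
  have hYsa : IsSelfAdjoint Y :=
    isSelfAdjoint_iff.2 (tendsto_nhds_unique (hY.star.congr fun n =>
      (isSelfAdjoint_aeval hP (sqrtPoly n)).star_eq) hY)
  have hYn : ‖Y‖ ≤ 1 := le_of_tendsto hY.norm <| Eventually.of_forall fun n =>
    (norm_aeval_le_eval_one hP1 (sqrtPoly_coeff_nonneg n)).trans (sqrtPoly_eval_one_le n)
  refine ⟨1 - Y, ?_, ?_⟩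
  · rw [ContinuousLinearMap.isPositive_iff']
    refine ⟨(IsSelfAdjoint.one _).sub hYsa, fun x => ?_⟩
    have h1 : ⟪Y x, x⟫ ≤ ‖x‖ * ‖x‖ := by
      refine (real_inner_le_norm _ _).trans (mul_le_mul_of_nonneg_right ?_ (norm_nonneg x))
      exact (Y.le_opNorm x).trans (mul_le_of_le_one_left (norm_nonneg x) hYn)
    simp only [sub_apply, one_apply_eq_self, inner_sub_left,
      real_inner_self_eq_norm_mul_norm]
    linarith
  · have h2 : Y * Y = (2 : ℝ) • Y - P := by
      conv_rhs => rw [hY2]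
      rw [smul_smul]
      norm_num
    have : (1 - Y) * (1 - Y) = 1 - (2 : ℝ) • Y + Y * Y := by
      rw [two_smul]; noncomm_ring
    rw [this, h2]
    abel

/-- A bounded nonnegative operator on a real Hilbert space has a nonnegative square root. -/
theorem ContinuousLinearMap.IsPositive.exists_sqrt [CompleteSpace K] {Q : K →L[ℝ] K}
    (hQ : Q.IsPositive) : ∃ R : K →L[ℝ] K, R.IsPositive ∧ R ∘L R = Q := by
  rcases eq_or_ne Q 0 with rfl | h0
  · exact ⟨0, ContinuousLinearMap.isPositive_zero, by simp⟩
  have hn : 0 < ‖Q‖ := norm_pos_iff.2 h0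
  -- Rescaling to Q/‖Q‖ = 1 - P with 0 ≤ P ≤ 1. The factor √‖Q‖ is restored at the end.
  set P : K →L[ℝ] K := 1 - ‖Q‖⁻¹ • Q with hP
  have hPa : ∀ x, ⟪P x, x⟫ = ‖x‖ ^ 2 - ‖Q‖⁻¹ * ⟪Q x, x⟫ := fun x => by
    simp [hP, inner_sub_left, real_inner_smul_left]
  have hQle : ∀ x, ⟪Q x, x⟫ ≤ ‖Q‖ * ‖x‖ ^ 2 := fun x => by
    have h1 := real_inner_le_norm (Q x) x
    have h2 := Q.le_opNorm x
    nlinarith [norm_nonneg x]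
  have hPsa : IsSelfAdjoint P :=
    (IsSelfAdjoint.one _).sub ((IsSelfAdjoint.all ‖Q‖⁻¹).smul hQ.isSelfAdjoint)
  have hPp : P.IsPositive := by
    rw [ContinuousLinearMap.isPositive_iff']
    refine ⟨hPsa, fun x => ?_⟩
    rw [hPa, sub_nonneg, inv_mul_le_iff₀ hn]
    exact hQle x
  have hP1 : ‖P‖ ≤ 1 := by
    refine ContinuousLinearMap.opNorm_le_bound _ zero_le_one fun x => ?_
    have hle : ∀ x, ⟪P x, x⟫ ≤ 1 * ‖x‖ ^ 2 := fun x => by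
      rw [hPa]
      have := mul_nonneg (inv_nonneg.2 hn.le) (hQ.inner_nonneg_left x)
      linarith
    have h1 := (hPp.norm_sq_le_of_form_le hle x).trans
      (mul_le_mul_of_nonneg_left (hle x) zero_le_one)
    rw [one_mul, one_mul] at h1
    rw [one_mul]
    exact le_of_sq_le_sq h1 (norm_nonneg x)
  obtain ⟨R, hR, hRR⟩ := exists_isPositive_comp_self_eq_one_sub hPsa hP1
  refine ⟨√‖Q‖ • R, hR.smul_of_nonneg (Real.sqrt_nonneg _), ?_⟩
  have : (√‖Q‖ • R) ∘L (√‖Q‖ • R) = ‖Q‖ • (R * R) := by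
    ext x
    simp [smul_smul, Real.mul_self_sqrt hn.le]
  rw [this, hRR, hP, sub_sub_cancel, smul_smul, mul_inv_cancel₀ hn.ne', one_smul]

end SquareRoot


/-! ### Strongly continuous semigroups -/

/-- Strong convergence of a bounded family of operators may be checked on a total set. -/
theorem tendsto_apply_of_dense_span {E ι : Type*} [NormedAddCommGroup E] [NormedSpace ℝ E]
    {l : Filter ι} {T : ι → E →L[ℝ] E} {L : E →L[ℝ] E} {M : ℝ} (hM : ∀ᶠ i in l, ‖T i‖ ≤ M)
    {D : Set E} (hD : Dense (Submodule.span ℝ D : Set E))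
    (h : ∀ x ∈ D, Tendsto (fun i => T i x) l (𝓝 (L x))) (x : E) :
    Tendsto (fun i => T i x) l (𝓝 (L x)) := by
  have hspan : ∀ x ∈ Submodule.span ℝ D, Tendsto (fun i => T i x) l (𝓝 (L x)) := by
    intro x hx
    induction hx using Submodule.span_induction with
    | mem x hx => exact h x hx
    | zero => simpa using tendsto_const_nhds
    | add x y _ _ hx hy => simpa using hx.add hy
    | smul a x _ hx => simpa using hx.const_smul a
  rw [Metric.tendsto_nhds]
  intro ε hε
  set c : ℝ := max M 0 + ‖L‖ + 1 with hc
  have hc0 : 0 < c := by positivity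
  obtain ⟨y, hy, hxy⟩ := Metric.dense_iff.1 hD x (ε / (2 * c)) (by positivity)
  rw [Metric.mem_ball, dist_comm, dist_eq_norm] at hy
  filter_upwards [hM, Metric.tendsto_nhds.1 (hspan y hxy) (ε / 2) (by positivity)] with i hi hi2
  rw [dist_eq_norm] at *
  have e : T i x - L x = T i (x - y) + (T i y - L y) - L (x - y) := by
    rw [map_sub, map_sub]; abel
  have h1 : ‖T i (x - y)‖ ≤ max M 0 * ‖x - y‖ :=
    (T i).le_of_opNorm_le (hi.trans (le_max_left _ _)) _
  have h2 : ‖L (x - y)‖ ≤ ‖L‖ * ‖x - y‖ := L.le_opNorm _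
  have h3 : c * ‖x - y‖ < ε / 2 := by
    rw [lt_div_iff₀ (by positivity)] at hy
    linarith
  calc ‖T i x - L x‖ ≤ ‖T i (x - y)‖ + ‖T i y - L y‖ + ‖L (x - y)‖ := by
        rw [e]
        exact (norm_sub_le _ _).trans (add_le_add_left (norm_add_le _ _) _)
    _ < ε := by
        have := norm_nonneg (x - y)
        rw [hc] at h3
        nlinarith

theorem tendsto_average_of_continuousOn {E : Type*} [NormedAddCommGroup E] [NormedSpace ℝ E]
    [CompleteSpace E] {g : ℝ → E} (hg : ContinuousOn g (Ici 0)) :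
    Tendsto (fun b : ℝ => b⁻¹ • ∫ r in (0 : ℝ)..b, g r) (𝓝[>] 0) (𝓝 (g 0)) := by
  have hd : HasDerivWithinAt (fun b => ∫ r in (0 : ℝ)..b, g r) (g 0) (Ioi 0) 0 := by
    refine (intervalIntegral.integral_hasDerivWithinAt_right
      (by simp) (s := Ici 0) (t := Ioi 0) ?_
      ((hg 0 self_mem_Ici).mono Ioi_subset_Ici_self)).mono Ioi_subset_Ici_self
    exact ⟨Ioi 0, self_mem_nhdsWithin, (hg.mono
      Ioi_subset_Ici_self).aestronglyMeasurable measurableSet_Ioi⟩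
  rw [hasDerivWithinAt_iff_tendsto_slope' (by simp)] at hd
  refine hd.congr fun b => ?_
  simp [slope_def_module]

namespace IsC0Semigroup

section Banach

variable {E : Type*} [NormedAddCommGroup E] [NormedSpace ℝ E] {T : ℝ → E →L[ℝ] E}

theorem map_zero_apply (hT : IsC0Semigroup T) (x : E) : T 0 x = x := by
  rw [hT.map_zero]; rfl

theorem map_add_apply (hT : IsC0Semigroup T) {s t : ℝ} (hs : 0 ≤ s) (ht : 0 ≤ t) (x : E) :
    T (s + t) x = T s (T t x) := by
  rw [hT.map_add s t hs ht]; rfl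

theorem comm_apply (hT : IsC0Semigroup T) {s t : ℝ} (hs : 0 ≤ s) (ht : 0 ≤ t) (x : E) :
    T s (T t x) = T t (T s x) := by
  rw [← hT.map_add_apply hs ht, ← hT.map_add_apply ht hs, add_comm]

theorem pow_eq (hT : IsC0Semigroup T) {t : ℝ} (ht : 0 ≤ t) (n : ℕ) : (T t) ^ n = T (n * t) := by
  induction n with
  | zero => simp [hT.map_zero]; rfl
  | succ n ih =>
    rw [pow_succ, ih, Nat.cast_succ, add_mul, one_mul, hT.map_add _ _ (by positivity) ht]
    rfl

variable [CompleteSpace E]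

/-- Otherwise some t n → 0 has ‖T (t n)‖ unbounded, although T (t n) x converges for each x, against
the uniform boundedness principle. -/
theorem exists_bound_near_zero (hT : IsC0Semigroup T) :
    ∃ δ > 0, ∃ M ≥ 1, ∀ t ∈ Icc 0 δ, ‖T t‖ ≤ M := by
  by_contra! hcon
  have h1 : ∀ n : ℕ, ∃ t ∈ Icc (0 : ℝ) (1 / (n + 1)), (n + 1 : ℝ) < ‖T t‖ := fun n =>
    hcon _ (by positivity) (n + 1) (by linarith [(Nat.cast_nonneg n : (0 : ℝ) ≤ n)])
  choose t ht htM using h1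
  have ht0 : Tendsto t atTop (𝓝 0) :=
    squeeze_zero (fun n => (ht n).1) (fun n => (ht n).2) tendsto_one_div_add_atTop_nhds_zero_nat
  have hb : ∀ x, ∃ C, ∀ n, ‖T (t n) x‖ ≤ C := by
    intro x
    have hx : Tendsto (fun s => T s x) (𝓝[≥] 0) (𝓝 x) := by
      have : 𝓝[≥] (0 : ℝ) = 𝓝[>] 0 ⊔ pure 0 := by
        rw [← Ioi_insert, nhdsWithin_insert, sup_comm]
      rw [this]
      refine (hT.tendsto_zero x).sup ?_
      rw [tendsto_pure_left]
      intro s hs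
      rw [hT.map_zero_apply]
      exact mem_of_mem_nhds hs
    have h2 : Tendsto t atTop (𝓝[≥] 0) :=
      tendsto_nhdsWithin_iff.2 ⟨ht0, Eventually.of_forall fun n => (ht n).1⟩
    obtain ⟨C, hC⟩ := (hx.comp h2).norm.bddAbove_range
    exact ⟨C, fun n => hC ⟨n, rfl⟩⟩
  obtain ⟨C, hC⟩ := banach_steinhaus hb
  obtain ⟨n, hn⟩ := exists_nat_gt C
  have := htM n
  have := hC n
  linarith

theorem exists_bound (hT : IsC0Semigroup T) (b : ℝ) :
    ∃ M ≥ 1, ∀ t ∈ Icc 0 b, ‖T t‖ ≤ M := by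
  obtain ⟨δ, hδ, M, hM1, hM⟩ := hT.exists_bound_near_zero
  obtain ⟨n, hn⟩ := exists_nat_gt (b / δ)
  refine ⟨M ^ (n + 1), one_le_pow₀ hM1, fun t ht => ?_⟩
  have hn1 : (0 : ℝ) < ((n + 1 : ℕ) : ℝ) := by positivity
  have e : T t = T (t / (n + 1 : ℕ)) ^ (n + 1) := by
    rw [hT.pow_eq (div_nonneg ht.1 hn1.le), mul_div_cancel₀ _ hn1.ne']
  rw [e]
  refine (norm_pow_le' _ n.succ_pos).trans (pow_le_pow_left₀ (norm_nonneg _) (hM _ ?_) _)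
  refine ⟨div_nonneg ht.1 hn1.le, ?_⟩
  rw [div_le_iff₀ hn1]
  rw [div_lt_iff₀ hδ] at hn
  push_cast
  nlinarith [ht.2]

theorem continuousOn (hT : IsC0Semigroup T) (x : E) : ContinuousOn (fun t => T t x) (Ici 0) := by
  intro t ht
  obtain ⟨M, hM1, hM⟩ := hT.exists_bound (t + 1)
  have hM0 : 0 < M := by linarith
  have key : ∀ s ∈ Ici (0 : ℝ), s ≤ t + 1 → ‖T s x - T t x‖ ≤ M * ‖T |s - t| x - x‖ := by
    have aux : ∀ u v : ℝ, 0 ≤ u → u ≤ v → u ≤ t + 1 →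
        ‖T v x - T u x‖ ≤ M * ‖T (v - u) x - x‖ := by
      intro u v hu huv hut
      have : T v x = T u (T (v - u) x) := by
        rw [← hT.map_add_apply hu (sub_nonneg.2 huv), add_sub_cancel]
      rw [this, ← map_sub]
      exact (T u).le_of_opNorm_le (hM u ⟨hu, hut⟩) _
    intro s hs hst
    rcases le_total s t with h | h
    · rw [norm_sub_rev, abs_sub_comm, abs_of_nonneg (sub_nonneg.2 h)]
      exact aux s t hs h hst
    · rw [abs_of_nonneg (sub_nonneg.2 h)]
      exact aux t s ht h (by linarith)
  have h0 := Metric.tendsto_nhdsWithin_nhds.1 (hT.tendsto_zero x)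
  rw [Metric.continuousWithinAt_iff]
  intro ε hε
  obtain ⟨δ, hδ, hδ'⟩ := h0 (ε / M) (by positivity)
  refine ⟨min δ 1, by positivity, fun s hs hst => ?_⟩
  rw [Real.dist_eq] at hst
  have hs1 : s ≤ t + 1 := by
    have := (le_abs_self _).trans (hst.le.trans (min_le_right _ _))
    linarith
  rw [dist_eq_norm]
  refine (key s hs hs1).trans_lt ?_
  rcases (abs_nonneg (s - t)).eq_or_lt with h | h
  · rw [← h, hT.map_zero_apply, sub_self, norm_zero, mul_zero]
    exact hε
  · have := hδ' (x := |s - t|) h (by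
      rw [Real.dist_eq, sub_zero, abs_abs]
      exact hst.trans_le (min_le_left _ _))
    rwa [dist_eq_norm, lt_div_iff₀ hM0, mul_comm] at this

theorem intervalIntegrable (hT : IsC0Semigroup T) (x : E) {a b : ℝ} (ha : 0 ≤ a) (hb : 0 ≤ b) :
    IntervalIntegrable (fun t => T t x) volume a b :=
  ((hT.continuousOn x).mono fun _ ht => (le_min ha hb).trans ht.1).intervalIntegrable

/-- `x ↦ ∫_0^b T(r) x dr` as a bounded operator. -/
theorem exists_integral (hT : IsC0Semigroup T) {b : ℝ} (hb : 0 ≤ b) :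
    ∃ J : E →L[ℝ] E, ∀ x, J x = ∫ r in (0 : ℝ)..b, T r x := by
  obtain ⟨M, hM1, hM⟩ := hT.exists_bound b
  refine ⟨LinearMap.mkContinuous
    { toFun := fun x => ∫ r in (0 : ℝ)..b, T r x
      map_add' := fun x y => by
        simp only [_root_.map_add]
        exact intervalIntegral.integral_add (hT.intervalIntegrable x le_rfl hb)
          (hT.intervalIntegrable y le_rfl hb)
      map_smul' := fun c x => by
        simp only [map_smul, RingHom.id_apply]
        exact intervalIntegral.integral_smul _ _ } (M * b) fun x => ?_, fun x => rfl⟩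
  refine (intervalIntegral.norm_integral_le_of_norm_le_const (C := M * ‖x‖) fun t ht => ?_).trans ?_
  · rw [uIoc_of_le hb] at ht
    exact (T t).le_of_opNorm_le (hM t ⟨ht.1.le, ht.2⟩) _
  · rw [sub_zero, abs_of_nonneg hb]
    exact le_of_eq (by ring)

theorem tendsto_average (hT : IsC0Semigroup T) (x : E) :
    Tendsto (fun b : ℝ => b⁻¹ • ∫ r in (0 : ℝ)..b, T r x) (𝓝[>] 0) (𝓝 x) := by
  simpa [hT.map_zero_apply] using tendsto_average_of_continuousOn (hT.continuousOn x)

end Banach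

/-! ### The adjoint semigroup -/

section Hilbert

variable {H : Type*} [NormedAddCommGroup H] [InnerProductSpace ℝ H] [CompleteSpace H]
  {S : ℝ → H →L[ℝ] H}

open ContinuousLinearMap in
/-- The adjoint semigroup is strongly continuous. -/
theorem adjoint (hS : IsC0Semigroup S) :
    IsC0Semigroup fun t => ContinuousLinearMap.adjoint (S t) where
  map_zero := by
    rw [hS.map_zero, ContinuousLinearMap.adjoint_id]
  map_add s t hs ht := by
    rw [add_comm, hS.map_add t s ht hs, adjoint_comp]
  tendsto_zero := by
    obtain ⟨M, hM1, hM⟩ := hS.exists_bound 1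
    have hM0 : 0 ≤ M := by linarith
    -- D contains every J* w with J = ∫_0^b S(r) dr, since S(h)* J* - J* is small in operator norm.
    -- A vector v orthogonal to all of these has J v = 0 for every small b, and the averages J v / b
    -- tend to v, so v = 0.
    set D : Set H := {x | Tendsto (fun t => ContinuousLinearMap.adjoint (S t) x) (𝓝[>] 0) (𝓝 x)}
    have hsmall : Ioc (0 : ℝ) 1 ∈ 𝓝[>] (0 : ℝ) := Ioc_mem_nhdsGT one_pos
    have hD : Dense (Submodule.span ℝ D : Set H) := by
      rw [Submodule.dense_iff_topologicalClosure_eq_top, Submodule.topologicalClosure_eq_top_iff,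
        Submodule.eq_bot_iff]
      intro v hv
      have hzero : ∀ b ∈ Ioc (0 : ℝ) 1, ∫ r in (0 : ℝ)..b, S r v = 0 := by
        intro b hb
        obtain ⟨J, hJ⟩ := hS.exists_integral hb.1.le
        rw [← hJ]
        refine ext_inner_right ℝ fun w => ?_
        rw [inner_zero_left, ← adjoint_inner_right]
        rw [real_inner_comm]
        refine Submodule.mem_orthogonal _ _ |>.1 hv _ (Submodule.subset_span ?_)
        change Tendsto _ _ _
        -- J S(h) - J is the integral over (b, b+h] minus the one over (0, h], two pieces of length
        -- h. Being an operator norm bound, it passes to the adjoint.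
        have hbd : ∀ h ∈ Ioc (0 : ℝ) 1, ‖J ∘L S h - J‖ ≤ (2 * M ^ 2) * h := by
          intro h hh
          refine opNorm_le_bound _ (mul_nonneg (by positivity) hh.1.le) fun x => ?_
          have e1 : J (S h x) = ∫ r in h..(b + h), S r x := by
            rw [hJ]
            have : ∫ r in (0 : ℝ)..b, S r (S h x) = ∫ r in (0 : ℝ)..b, S (r + h) x := by
              refine intervalIntegral.integral_congr fun r hr => ?_
              rw [uIcc_of_le hb.1.le] at hr
              exact (hS.map_add_apply hr.1 hh.1.le x).symm
            rw [this, intervalIntegral.integral_comp_add_right (fun r => S r x), zero_add]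
          have hi := fun {a c : ℝ} (ha : 0 ≤ a) (hc : 0 ≤ c) => hS.intervalIntegrable x ha hc
          have hb0 := hb.1.le
          have hh0 := hh.1.le
          have e2 : J (S h x) - J x
              = (∫ r in b..(b + h), S r x) - ∫ r in (0 : ℝ)..h, S r x := by
            rw [e1, hJ, ← intervalIntegral.integral_add_adjacent_intervals (hi hh0 hb0)
                (hi hb0 (add_nonneg hb0 hh0)),
              ← intervalIntegral.integral_add_adjacent_intervals (hi le_rfl hh0) (hi hh0 hb0)]
            abel
          have e3 : ∫ r in b..(b + h), S r x = S b (∫ r in (0 : ℝ)..h, S r x) := by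
            rw [← ContinuousLinearMap.intervalIntegral_comp_comm _ (hi le_rfl hh0)]
            have : ∫ r in (0 : ℝ)..h, S b (S r x) = ∫ r in (0 : ℝ)..h, S (b + r) x := by
              refine intervalIntegral.integral_congr fun r hr => ?_
              rw [uIcc_of_le hh0] at hr
              exact (hS.map_add_apply hb0 hr.1 x).symm
            rw [this, intervalIntegral.integral_comp_add_left (fun r => S r x), add_zero]
          have h4 : ‖∫ r in (0 : ℝ)..h, S r x‖ ≤ M * ‖x‖ * h := by
            refine (intervalIntegral.norm_integral_le_of_norm_le_const (C := M * ‖x‖)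
              fun t ht => ?_).trans ?_
            · rw [uIoc_of_le hh0] at ht
              exact (S t).le_of_opNorm_le (hM t ⟨ht.1.le, ht.2.trans hh.2⟩) _
            · rw [sub_zero, abs_of_nonneg hh0]
          have h5 := (S b).le_of_opNorm_le (hM b ⟨hb0, hb.2⟩) (∫ r in (0 : ℝ)..h, S r x)
          have h6 : (J ∘L S h - J) x = J (S h x) - J x := rfl
          rw [h6, e2, e3]
          refine (norm_sub_le _ _).trans ?_
          have h7 : 0 ≤ M * ‖x‖ * h := by positivity
          nlinarith [norm_nonneg (∫ r in (0 : ℝ)..h, S r x)]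
        rw [tendsto_iff_norm_sub_tendsto_zero]
        have hlim : Tendsto (fun h : ℝ => (2 * M ^ 2) * h * ‖w‖) (𝓝[>] 0) (𝓝 0) := by
          have : Tendsto (fun h : ℝ => (2 * M ^ 2) * h * ‖w‖) (𝓝 0) (𝓝 ((2 * M ^ 2) * 0 * ‖w‖)) :=
            Continuous.tendsto (by fun_prop) 0
          simpa using this.mono_left nhdsWithin_le_nhds
        refine squeeze_zero' (Eventually.of_forall fun _ => norm_nonneg _) ?_ hlim
        filter_upwards [hsmall] with h hh
        have e : (ContinuousLinearMap.adjoint (S h)) ((ContinuousLinearMap.adjoint J) w)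
            - (ContinuousLinearMap.adjoint J) w
            = (ContinuousLinearMap.adjoint (J ∘L S h - J)) w := by
          rw [map_sub, adjoint_comp]; rfl
        rw [e]
        refine le_of_opNorm_le _ ?_ _
        rw [LinearIsometryEquiv.norm_map]
        exact hbd h hh
      refine tendsto_nhds_unique (hS.tendsto_average v) (tendsto_const_nhds.congr' ?_)
      filter_upwards [hsmall] with b hb
      rw [hzero b hb, smul_zero]
    intro x
    refine tendsto_apply_of_dense_span (L := ContinuousLinearMap.id ℝ H) (M := M) ?_ hD
      (fun x hx => hx) x
    filter_upwards [hsmall] with t ht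
    rw [LinearIsometryEquiv.norm_map]
    exact hM t ⟨ht.1.le, ht.2⟩

end Hilbert

end IsC0Semigroup


/-! ### Generators and resolvents -/

theorem setIntegral_Ioi_comp_add_right {E : Type*} [NormedAddCommGroup E] [NormedSpace ℝ E]
    (f : ℝ → E) (a h : ℝ) : ∫ s in Ioi a, f (s + h) = ∫ s in Ioi (a + h), f s := by
  have := (measurePreserving_add_right volume h).setIntegral_preimage_emb
    (measurableEmbedding_addRight h) f (Ioi (a + h))
  simpa using this

section Generator

variable {E : Type*} [NormedAddCommGroup E] [NormedSpace ℝ E]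

/-- `z` lies in the domain of the generator of `T`, which maps it to `w`. -/
def HasGenerator (T : ℝ → E →L[ℝ] E) (z w : E) : Prop :=
  Tendsto (fun t : ℝ => t⁻¹ • (T t z - z)) (𝓝[>] 0) (𝓝 w)

theorem HasGenerator.exists_generator_eq {T : ℝ → E →L[ℝ] E} {z w : E} (h : HasGenerator T z w) :
    ∃ hz : z ∈ (generator T).domain, generator T ⟨z, hz⟩ = w :=
  ⟨⟨w, h⟩, tendsto_nhds_unique (generator_tendsto T ⟨z, ⟨w, h⟩⟩) h⟩

/-- Replaces the partially defined operator and its chosen values by the relation `HasGenerator`, so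
that limits can be handled directly. -/
theorem mem_unboundedResolventSet_generator_iff {T : ℝ → E →L[ℝ] E} {r : ℝ} :
    r ∈ unboundedResolventSet (generator T) ↔ ∃ R : E →L[ℝ] E,
      (∀ x, HasGenerator T (R x) (r • R x - x)) ∧
      ∀ z w, HasGenerator T z w → R (r • z - w) = z := by
  constructor
  · rintro ⟨R, h1, h2⟩
    refine ⟨R, fun x => ?_, fun z w h => ?_⟩
    · obtain ⟨hx, he⟩ := h1 x
      have := generator_tendsto T ⟨R x, hx⟩
      have he' : generator T ⟨R x, hx⟩ = r • R x - x := 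
        eq_sub_of_add_eq (by rw [add_comm]; exact (sub_eq_iff_eq_add.1 he).symm)
      rw [he'] at this
      exact this
    · obtain ⟨hz, he⟩ := h.exists_generator_eq
      have := h2 ⟨z, hz⟩
      rwa [he] at this
  · rintro ⟨R, h1, h2⟩
    refine ⟨R, fun x => ?_, fun z => h2 z _ (generator_tendsto T z)⟩
    obtain ⟨hz, he⟩ := (h1 x).exists_generator_eq
    exact ⟨hz, by rw [he]; abel⟩

theorem le_spectralGap_iff {A : E →ₗ.[ℝ] E} {β : ℝ} :
    (β : EReal) ≤ spectralGap A ↔ ∀ r : ℝ, r ≠ 0 → -β < r → r ∈ unboundedResolventSet A := by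
  rw [spectralGap, le_sInf_iff, forall_mem_image]
  constructor
  · intro h r hr hβ
    by_contra hn
    have h1 := h (x := r) ⟨hn, hr⟩
    rw [EReal.coe_le_coe_iff] at h1
    linarith
  · rintro h r ⟨hr, hr0⟩
    rw [EReal.coe_le_coe_iff]
    by_contra! hlt
    exact hr (h r hr0 (by linarith))

variable {T : ℝ → E →L[ℝ] E}

theorem IsC0Semigroup.hasGenerator_apply (hT : IsC0Semigroup T) {z w : E}
    (h : HasGenerator T z w) {t : ℝ} (ht : 0 ≤ t) : HasGenerator T (T t z) (T t w) := by
  refine (((T t).continuous.tendsto w).comp h).congr' ?_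
  filter_upwards [self_mem_nhdsWithin] with s hs
  simp only [Function.comp, map_smul, map_sub]
  rw [hT.comm_apply ht (le_of_lt hs)]

theorem IsC0Semigroup.hasDerivWithinAt (hT : IsC0Semigroup T) {z w : E}
    (h : HasGenerator T z w) {t : ℝ} (ht : 0 ≤ t) :
    HasDerivWithinAt (fun s => T s z) (T t w) (Ici t) t := by
  rw [← hasDerivWithinAt_Ioi_iff_Ici, hasDerivWithinAt_iff_tendsto_slope' (by simp)]
  have h1 : Tendsto (fun s : ℝ => s - t) (𝓝[>] t) (𝓝[>] 0) := by
    refine tendsto_nhdsWithin_iff.2 ⟨?_, ?_⟩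
    · have : Tendsto (fun s : ℝ => s - t) (𝓝 t) (𝓝 (t - t)) := Continuous.tendsto (by fun_prop) t
      rw [sub_self] at this
      exact this.mono_left nhdsWithin_le_nhds
    · filter_upwards [self_mem_nhdsWithin] with s hs
      exact sub_pos.2 (mem_Ioi.1 hs)
  refine (((T t).continuous.tendsto w).comp (h.comp h1)).congr' ?_
  filter_upwards [self_mem_nhdsWithin] with s hs
  have hst : 0 ≤ s - t := sub_nonneg.2 (le_of_lt hs)
  simp only [Function.comp, map_smul, map_sub, slope_def_module]
  rw [← hT.map_add_apply ht hst, add_sub_cancel]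

/-- T t preserves the domain and commutes with the generator, and the resolvent is a left inverse.
-/
theorem IsC0Semigroup.resolvent_comm (hT : IsC0Semigroup T) {r : ℝ} {R : E →L[ℝ] E}
    (h1 : ∀ x, HasGenerator T (R x) (r • R x - x))
    (h2 : ∀ z w, HasGenerator T z w → R (r • z - w) = z) {t : ℝ} (ht : 0 ≤ t) (x : E) :
    R (T t x) = T t (R x) := by
  have := h2 _ _ (hT.hasGenerator_apply (h1 x) ht)
  rw [← this, ← map_smul, ← map_sub]
  congr 2
  abel

variable [CompleteSpace E]

theorem IsC0Semigroup.apply_eq_of_hasGenerator_zero (hT : IsC0Semigroup T) {v : E}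
    (h : HasGenerator T v 0) {t : ℝ} (ht : 0 ≤ t) : T t v = v := by
  have := constant_of_has_deriv_right_zero (f := fun s => T s v) (a := 0) (b := t)
    ((hT.continuousOn v).mono Icc_subset_Ici_self)
    (fun s hs => by simpa using hT.hasDerivWithinAt h hs.1) t ⟨ht, le_rfl⟩
  rwa [hT.map_zero_apply] at this

/-- The Laplace transform of an orbit lies in the domain of the generator. -/
theorem IsC0Semigroup.hasGenerator_laplace (hT : IsC0Semigroup T) {r : ℝ} {x : E}
    (hint : IntegrableOn (fun s => Real.exp (-r * s) • T s x) (Ioi 0)) :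
    HasGenerator T (∫ s in Ioi (0 : ℝ), Real.exp (-r * s) • T s x)
      (r • (∫ s in Ioi (0 : ℝ), Real.exp (-r * s) • T s x) - x) := by
  set f : ℝ → E := fun s => Real.exp (-r * s) • T s x with hf
  set y := ∫ s in Ioi (0 : ℝ), f s with hy
  have hfc : ContinuousOn f (Ici 0) :=
    (Continuous.continuousOn (by fun_prop)).smul (hT.continuousOn x)
  -- Translating the Laplace integral by h multiplies it by exp(rh) and removes the piece over (0,
  -- h]. The difference quotient at h = 0 is then a combination of two elementary limits.
  have hshift : ∀ h > 0, T h y = Real.exp (r * h) • (y - ∫ s in (0 : ℝ)..h, f s) := by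
    intro h hh
    have e1 : T h y = ∫ s in Ioi (0 : ℝ), T h (f s) := (ContinuousLinearMap.integral_comp_comm _ hint).symm
    have e2 : ∫ s in Ioi (0 : ℝ), T h (f s)
        = ∫ s in Ioi (0 : ℝ), Real.exp (r * h) • f (s + h) := by
      refine setIntegral_congr_fun measurableSet_Ioi fun s hs => ?_
      have hs0 : (0 : ℝ) ≤ s := le_of_lt hs
      simp only [hf, map_smul]
      rw [← hT.map_add_apply hh.le hs0, smul_smul, ← Real.exp_add, add_comm h s]
      congr 2
      ring
    have e3 : ∫ s in Ioi (0 : ℝ), f (s + h) = ∫ s in Ioi h, f s := by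
      simpa using setIntegral_Ioi_comp_add_right f 0 h
    have e4 : y = (∫ s in (0 : ℝ)..h, f s) + ∫ s in Ioi h, f s :=
      (intervalIntegral.integral_interval_add_Ioi hint
        (hint.mono_set (Ioi_subset_Ioi hh.le))).symm
    rw [e1, e2, integral_smul, e3, e4, add_sub_cancel_left]
  have hd1 : Tendsto (fun h : ℝ => h⁻¹ * (Real.exp (r * h) - 1)) (𝓝[>] 0) (𝓝 r) := by
    have h1 : HasDerivAt (fun h : ℝ => Real.exp (r * h)) r 0 := by
      have := ((hasDerivAt_id (0 : ℝ)).const_mul r).exp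
      simpa using this
    have h2 := h1.hasDerivWithinAt (s := Ioi 0)
    rw [hasDerivWithinAt_iff_tendsto_slope' (by simp)] at h2
    refine h2.congr fun h => ?_
    simp [slope_def_field, div_eq_inv_mul]
  have hd2 : Tendsto (fun h : ℝ => h⁻¹ • ∫ s in (0 : ℝ)..h, f s) (𝓝[>] 0) (𝓝 x) := by
    simpa [hf, hT.map_zero_apply] using tendsto_average_of_continuousOn hfc
  have hd3 : Tendsto (fun h : ℝ => Real.exp (r * h)) (𝓝[>] 0) (𝓝 1) := by
    have : Tendsto (fun h : ℝ => Real.exp (r * h)) (𝓝 0) (𝓝 (Real.exp (r * 0))) :=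
      Continuous.tendsto (by fun_prop) 0
    rw [mul_zero, Real.exp_zero] at this
    exact this.mono_left nhdsWithin_le_nhds
  have := (hd1.smul_const y).sub (hd3.smul hd2)
  rw [one_smul] at this
  refine this.congr' ?_
  filter_upwards [self_mem_nhdsWithin] with h hh
  rw [hshift h hh]
  module

end Generator

/-! ### The spectral gap of a symmetric contraction semigroup -/

section SpectralGap

variable {K : Type*} [NormedAddCommGroup K] [InnerProductSpace ℝ K]

/-- A strongly continuous semigroup of symmetric contractions, with the limit `P` at infinity. -/
structure IsSymmetricContractionSemigroup (T : ℝ → K →L[ℝ] K) (P : K →L[ℝ] K) : Prop where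
  isC0 : IsC0Semigroup T
  symm : ∀ t, 0 ≤ t → ∀ x y, ⟪T t x, y⟫ = ⟪x, T t y⟫
  norm_le : ∀ t, 0 ≤ t → ∀ x, ‖T t x‖ ≤ ‖x‖
  tendsto : ∀ x, Tendsto (fun t => T t x) atTop (𝓝 (P x))

namespace IsSymmetricContractionSemigroup

variable {T : ℝ → K →L[ℝ] K} {P : K →L[ℝ] K}

theorem apply_proj (h : IsSymmetricContractionSemigroup T P) {t : ℝ} (ht : 0 ≤ t) (x : K) :
    T t (P x) = P x := by
  refine tendsto_nhds_unique (((T t).continuous.tendsto _).comp (h.tendsto x))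
    (((h.tendsto x).comp (tendsto_atTop_add_const_left _ t tendsto_id)).congr' ?_)
  filter_upwards [eventually_ge_atTop 0] with s hs
  exact h.isC0.map_add_apply ht hs x

theorem proj_apply (h : IsSymmetricContractionSemigroup T P) {t : ℝ} (ht : 0 ≤ t) (x : K) :
    P (T t x) = P x := by
  refine tendsto_nhds_unique (h.tendsto _)
    (((h.tendsto x).comp (tendsto_atTop_add_const_right _ t tendsto_id)).congr' ?_)
  filter_upwards [eventually_ge_atTop 0] with s hs
  exact h.isC0.map_add_apply hs ht x

theorem proj_proj (h : IsSymmetricContractionSemigroup T P) (x : K) : P (P x) = P x := by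
  refine tendsto_nhds_unique (h.tendsto _) (tendsto_const_nhds.congr' ?_)
  filter_upwards [eventually_ge_atTop 0] with s hs
  exact (h.apply_proj hs x).symm

theorem proj_symm (h : IsSymmetricContractionSemigroup T P) (x y : K) : ⟪P x, y⟫ = ⟪x, P y⟫ := by
  refine tendsto_nhds_unique ((h.tendsto x).inner tendsto_const_nhds)
    ((tendsto_const_nhds.inner (h.tendsto y)).congr' ?_)
  filter_upwards [eventually_ge_atTop 0] with s hs
  exact (h.symm s hs x y).symm

theorem norm_sub_proj_le (h : IsSymmetricContractionSemigroup T P) (x : K) :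
    ‖x - P x‖ ≤ ‖x‖ := by
  have h1 : ⟪x, P x⟫ = ⟪P x, P x⟫ := by rw [h.proj_symm, h.proj_proj]
  have h2 := norm_sub_sq_real x (P x)
  rw [h1, real_inner_self_eq_norm_sq] at h2
  refine le_of_sq_le_sq ?_ (norm_nonneg x)
  nlinarith [sq_nonneg ‖P x‖]

theorem apply_sub_proj (h : IsSymmetricContractionSemigroup T P) {t : ℝ} (ht : 0 ≤ t) (x : K) :
    T t (x - P x) = T t x - P x := by
  rw [map_sub, h.apply_proj ht]

theorem norm_apply_sub_proj_le (h : IsSymmetricContractionSemigroup T P) {t : ℝ} (ht : 0 ≤ t)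
    (x : K) : ‖T t x - P x‖ ≤ ‖x‖ := by
  rw [← h.apply_sub_proj ht]
  exact (h.norm_le t ht _).trans (h.norm_sub_proj_le x)

theorem hasGenerator_inner_nonpos (h : IsSymmetricContractionSemigroup T P) {z w : K}
    (hzw : HasGenerator T z w) : ⟪w, z⟫ ≤ 0 := by
  refine le_of_tendsto (hzw.inner tendsto_const_nhds) ?_
  filter_upwards [self_mem_nhdsWithin] with t ht
  rw [real_inner_smul_left, inner_sub_left, real_inner_self_eq_norm_mul_norm]
  have h1 := (real_inner_le_norm (T t z) z).trans
    (mul_le_mul_of_nonneg_right (h.norm_le t (le_of_lt ht) z) (norm_nonneg z))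
  exact mul_nonpos_of_nonneg_of_nonpos (inv_nonneg.2 (le_of_lt ht)) (by linarith)

theorem hasGenerator_symm (h : IsSymmetricContractionSemigroup T P) {z w z' w' : K}
    (hzw : HasGenerator T z w) (hzw' : HasGenerator T z' w') : ⟪w, z'⟫ = ⟪z, w'⟫ := by
  refine tendsto_nhds_unique (hzw.inner tendsto_const_nhds)
    ((tendsto_const_nhds.inner hzw').congr' ?_)
  filter_upwards [self_mem_nhdsWithin] with t ht
  rw [real_inner_smul_left, inner_sub_left, real_inner_smul_right, inner_sub_right,
    h.symm t (le_of_lt ht)]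

variable [CompleteSpace K]

/-- The resolvent is P/r on the range of P and the Laplace transform of T on its complement. The
decay makes that transform converge for every r > -β, negative values included, and only r = 0 is
lost to the range of P. -/
theorem mem_resolventSet_of_decay (h : IsSymmetricContractionSemigroup T P) {β : ℝ}
    (hdec : ∀ t, 0 ≤ t → ∀ x, ‖T t x - P x‖ ≤ Real.exp (-β * t) * ‖x‖) {r : ℝ} (hr0 : r ≠ 0)
    (hr : -β < r) : r ∈ unboundedResolventSet (generator T) := by
  have hrβ : 0 < r + β := by linarith
  have hbound : ∀ x, ∀ s ∈ Ioi (0 : ℝ), ‖Real.exp (-r * s) • T s (x - P x)‖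
      ≤ Real.exp (-(r + β) * s) * ‖x‖ := by
    intro x s hs
    rw [h.apply_sub_proj (le_of_lt hs), norm_smul, Real.norm_eq_abs, abs_of_pos (Real.exp_pos _)]
    calc _ ≤ Real.exp (-r * s) * (Real.exp (-β * s) * ‖x‖) :=
          mul_le_mul_of_nonneg_left (hdec s (le_of_lt hs) x) (Real.exp_pos _).le
      _ = _ := by rw [← mul_assoc, ← Real.exp_add]; ring_nf
  have hexp : IntegrableOn (fun s => Real.exp (-(r + β) * s)) (Ioi 0) :=
    integrableOn_exp_mul_Ioi (by linarith) 0
  have hint : ∀ x, IntegrableOn (fun s => Real.exp (-r * s) • T s (x - P x)) (Ioi 0) := by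
    intro x
    refine Integrable.mono' (hexp.mul_const ‖x‖) ?_ ?_
    · exact (((Continuous.continuousOn (by fun_prop)).smul (h.isC0.continuousOn _)).mono
        Ioi_subset_Ici_self).aestronglyMeasurable measurableSet_Ioi
    · exact (ae_restrict_mem measurableSet_Ioi).mono fun s hs => hbound x s hs
  obtain ⟨J, hJ⟩ : ∃ J : K →L[ℝ] K, ∀ x, J x
      = ∫ s in Ioi (0 : ℝ), Real.exp (-r * s) • T s (x - P x) := by
    refine ⟨LinearMap.mkContinuous
      { toFun := fun x => ∫ s in Ioi (0 : ℝ), Real.exp (-r * s) • T s (x - P x)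
        map_add' := fun x y => by
          rw [← integral_add (hint x) (hint y)]
          refine integral_congr_ae (Eventually.of_forall fun s => ?_)
          simp only [map_add, map_sub]
          module
        map_smul' := fun c x => by
          rw [RingHom.id_apply, ← integral_smul]
          refine integral_congr_ae (Eventually.of_forall fun s => ?_)
          simp only [map_smul, map_sub]
          module } (∫ s in Ioi (0 : ℝ), Real.exp (-(r + β) * s)) fun x => ?_, fun x => rfl⟩
    rw [← integral_mul_const]
    exact norm_integral_le_of_norm_le (hexp.mul_const ‖x‖)
      ((ae_restrict_mem measurableSet_Ioi).mono fun s hs => hbound x s hs)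
  set R : K →L[ℝ] K := r⁻¹ • P + J with hR
  have hRx : ∀ x, R x = r⁻¹ • P x + J x := fun x => rfl
  have hgen : ∀ x, HasGenerator T (R x) (r • R x - x) := by
    intro x
    have h1 := h.isC0.hasGenerator_laplace (hint x)
    rw [← hJ] at h1
    have e : r • R x - x = r • J x - (x - P x) := by
      rw [hRx, smul_add, smul_smul, mul_inv_cancel₀ hr0]
      module
    rw [e]
    refine h1.congr' ?_
    filter_upwards [self_mem_nhdsWithin] with t ht
    rw [hRx, map_add, map_smul, h.apply_proj (le_of_lt ht)]
    congr 1
    abel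
  have hcomm : ∀ t, 0 ≤ t → ∀ x, R (T t x) = T t (R x) := by
    intro t ht x
    rw [hRx, hRx, map_add, map_smul, h.proj_apply ht, h.apply_proj ht, hJ, hJ,
      ← ContinuousLinearMap.integral_comp_comm _ (hint x)]
    congr 1
    refine setIntegral_congr_fun measurableSet_Ioi fun s hs => ?_
    have hs0 : (0 : ℝ) ≤ s := le_of_lt hs
    have e : T t x - P x = T t (x - P x) := by rw [map_sub, h.apply_proj ht]
    simp only [map_smul]
    rw [h.proj_apply ht, e, h.isC0.comm_apply ht hs0]
  rw [mem_unboundedResolventSet_generator_iff]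
  refine ⟨R, hgen, fun z w hzw => ?_⟩
  -- R commutes with the semigroup, hence with difference quotients. This turns the right inverse
  -- into a left inverse.
  have h1 : R w = r • R z - z := by
    refine tendsto_nhds_unique ((R.continuous.tendsto w).comp hzw) ((hgen z).congr' ?_)
    filter_upwards [self_mem_nhdsWithin] with t ht
    simp only [Function.comp, map_smul, map_sub]
    rw [hcomm t (le_of_lt ht)]
  rw [map_sub, map_smul, h1]
  abel

/-- With A the generator, G = (1 - A)⁻¹ satisfies 0 ≤ G ≤ 1, and the gap of A becomes a gap of G
between a = 1/(1+β) and 1. This yields G ≤ a, in the sense of forms, on the range of 1 - G, that is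
-A ≥ β away from the fixed vectors. A differential inequality for ‖T s z‖² then gives the decay. -/
theorem decay_of_mem_resolventSet (h : IsSymmetricContractionSemigroup T P) {β : ℝ} (hβ : 0 < β)
    (hres : ∀ r, -β < r → r < 0 → r ∈ unboundedResolventSet (generator T)) {t : ℝ} (ht : 0 ≤ t)
    (x : K) : ‖T t x - P x‖ ≤ Real.exp (-β * t) * ‖x‖ := by
  obtain ⟨G, hG, hG'⟩ := mem_unboundedResolventSet_generator_iff.1
    (h.mem_resolventSet_of_decay (β := 0) (r := 1)
      (fun t ht x => by simpa using h.norm_apply_sub_proj_le ht x) one_ne_zero (by norm_num))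
  simp only [one_smul] at hG hG'
  have hGle : ∀ x, ‖G x‖ ^ 2 ≤ ⟪G x, x⟫ := by
    intro x
    have h1 := h.hasGenerator_inner_nonpos (hG x)
    rw [inner_sub_left, real_inner_self_eq_norm_sq, real_inner_comm] at h1
    linarith
  have hGs : ∀ x y, ⟪G x, y⟫ = ⟪x, G y⟫ := by
    intro x y
    have h1 := h.hasGenerator_symm (hG x) (hG y)
    rw [inner_sub_left, inner_sub_right] at h1
    linarith
  have hG1 : ∀ x, ‖G x‖ ≤ ‖x‖ := by
    intro x
    rcases (norm_nonneg (G x)).eq_or_lt with h0 | h0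
    · rw [← h0]; exact norm_nonneg x
    · refine le_of_mul_le_mul_left ?_ h0
      have := (hGle x).trans (real_inner_le_norm _ _)
      nlinarith
  have hGpos : G.IsPositive := by
    rw [ContinuousLinearMap.isPositive_iff]
    exact ⟨hGs, fun x => (sq_nonneg _).trans (hGle x)⟩
  have hGx : ∀ x, ⟪G x, x⟫ ≤ ‖x‖ ^ 2 := fun x => by
    have := (real_inner_le_norm (G x) x).trans
      (mul_le_mul_of_nonneg_right (hG1 x) (norm_nonneg x))
    rwa [← sq] at this
  have hGinj : ∀ x, G x = 0 → x = 0 := by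
    intro x hx
    have h1 := hG x
    rw [hx, zero_sub] at h1
    have h2 : HasGenerator T (0 : K) 0 := by simp [HasGenerator]
    exact neg_eq_zero.1 (tendsto_nhds_unique h1 h2)
  have hGT : ∀ {s : ℝ}, 0 ≤ s → ∀ x, G (T s x) = T s (G x) := fun hs x =>
    h.isC0.resolvent_comm (r := 1) (by simpa using hG) (by simpa using hG') hs x
  set a : ℝ := (1 + β)⁻¹ with ha
  have ha0 : 0 < a := by positivity
  have ha1 : a < 1 := inv_lt_one_of_one_lt₀ (by linarith)
  -- `G - k` is invertible for `k` between `a` and `1`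
  have hinv : ∀ k, a < k → k < 1 → ∃ J : K →L[ℝ] K, ∀ x, J (G x - k • x) = x := by
    intro k hk hk1
    have hk0 : 0 < k := ha0.trans hk
    have hk2 : 1 < k⁻¹ := (one_lt_inv₀ hk0).2 hk1
    have hk3 : k⁻¹ < 1 + β := by
      rw [ha] at hk
      exact inv_lt_of_inv_lt₀ (by positivity) hk
    obtain ⟨R, -, hR⟩ := mem_unboundedResolventSet_generator_iff.1
      (hres (1 - k⁻¹) (by linarith) (by linarith))
    refine ⟨(-k⁻¹) • (ContinuousLinearMap.id ℝ K + k⁻¹ • R), fun x => ?_⟩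
    have h1 := hR _ _ (hG x)
    have e : (1 - k⁻¹) • G x - (G x - x) = (-k⁻¹) • (G x - k • x) := by
      rw [smul_sub, smul_smul, neg_mul, inv_mul_cancel₀ hk0.ne']
      module
    rw [e, map_smul] at h1
    have e2 : k⁻¹ • R (G x - k • x) = - G x := by
      rwa [neg_smul, neg_eq_iff_eq_neg] at h1
    simp only [smul_apply, add_apply, ContinuousLinearMap.id_apply, e2]
    rw [show G x - k • x + -G x = (-k) • x by module, smul_smul, neg_mul_neg,
      inv_mul_cancel₀ hk0.ne', one_smul]
  -- This is (1 - G)(a - G) ≥ 0. For m < 0 the operator B - m is (G - c)² - d: it is coercive if d <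
  -- 0, and otherwise it factors with both roots c ± √d strictly between a and 1, where G - k has a
  -- left inverse.
  have hq : ∀ y, ⟪G y, y⟫ - ‖G y‖ ^ 2 ≤ a * (‖y‖ ^ 2 - ⟪G y, y⟫) := by
    set c : ℝ := (1 + a) / 2 with hc
    set B : K →L[ℝ] K := G ∘L G - (1 + a) • G + a • ContinuousLinearMap.id ℝ K with hB
    have hBx : ∀ x, B x = G (G x) - (1 + a) • G x + a • x := fun x => rfl
    have hBs : ∀ x y, ⟪B x, y⟫ = ⟪x, B y⟫ := by
      intro x y
      simp only [hBx, inner_add_left, inner_sub_left, inner_add_right, inner_sub_right,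
        real_inner_smul_left, real_inner_smul_right, hGs]
    have hBinv : ∀ m : ℝ, m < 0 → ∃ J : K →L[ℝ] K, ∀ x, J (B x - m • x) = x := by
      intro m hm
      set d : ℝ := ((1 - a) / 2) ^ 2 + m with hd
      rcases lt_or_ge d 0 with hd0 | hd0
      · set F : K →L[ℝ] K := B - m • ContinuousLinearMap.id ℝ K with hF
        have hu : IsUnit F := by
          refine ContinuousLinearMap.isUnit_of_forall_le_norm_inner_map F (c := ⟨-d, by linarith⟩)
            (by exact_mod_cast neg_pos.2 hd0) fun x => ?_
          refine le_trans ?_ (le_abs_self _)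
          have e : ⟪F x, x⟫ = ‖G x - c • x‖ ^ 2 - d * ‖x‖ ^ 2 := by
            rw [norm_sub_sq_real, norm_smul, mul_pow, Real.norm_eq_abs, sq_abs,
              real_inner_smul_right]
            simp only [hF, hB, sub_apply, add_apply, smul_apply, ContinuousLinearMap.comp_apply,
              ContinuousLinearMap.id_apply, inner_sub_left, inner_add_left, real_inner_smul_left,
              hGs (G x), real_inner_self_eq_norm_sq, hc, hd]
            ring
          rw [e]
          change ‖x‖ ^ 2 * (-d) ≤ _
          nlinarith [sq_nonneg ‖G x - c • x‖]
        obtain ⟨u, hu⟩ := hu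
        refine ⟨↑u⁻¹, fun x => ?_⟩
        have e : B x - m • x = (u : K →L[ℝ] K) x := by rw [hu]; rfl
        rw [e]
        have := congrArg (fun L : K →L[ℝ] K => L x) u.inv_mul
        exact this
      · have hs : √d < (1 - a) / 2 := by
          rw [Real.sqrt_lt' (by linarith), hd]
          linarith
        have hs0 := Real.sqrt_nonneg d
        obtain ⟨J1, hJ1⟩ := hinv (c - √d) (by linarith) (by linarith)
        obtain ⟨J2, hJ2⟩ := hinv (c + √d) (by linarith) (by linarith)
        refine ⟨J2 ∘L J1, fun x => ?_⟩
        have e : B x - m • x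
            = G (G x - (c + √d) • x) - (c - √d) • (G x - (c + √d) • x) := by
          have hsq : (c - √d) * (c + √d) = a - m := by
            have := Real.mul_self_sqrt hd0
            nlinarith
          rw [hBx, map_sub, map_smul, smul_sub, smul_smul, hsq, hc]
          module
        rw [ContinuousLinearMap.comp_apply, e, hJ1, hJ2]
    intro y
    have h1 := inner_nonneg_of_forall_neg_leftInverse hBs hBinv y
    rw [hBx, inner_add_left, inner_sub_left, real_inner_smul_left, real_inner_smul_left,
      hGs (G y), real_inner_self_eq_norm_sq, real_inner_self_eq_norm_sq] at h1
    linarith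
  set D : K →L[ℝ] K := ContinuousLinearMap.id ℝ K - G with hD
  have hDx : ∀ x, D x = x - G x := fun x => rfl
  have hDG : ∀ x, D (G x) = G (D x) := fun x => by rw [hDx, hDx, map_sub]
  have hDpos : D.IsPositive := by
    rw [ContinuousLinearMap.isPositive_iff]
    refine ⟨fun y z => ?_, fun y => ?_⟩
    · simp only [ContinuousLinearMap.coe_coe, hDx, inner_sub_left, inner_sub_right, hGs]
    · rw [hDx, inner_sub_left, real_inner_self_eq_norm_sq]
      linarith [hGx y]
  have hDs := hDpos.inner_left_eq_inner_right
  have hDle : ∀ y, ⟪D y, y⟫ ≤ 1 * ‖y‖ ^ 2 := fun y => by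
    rw [hDx, inner_sub_left, real_inner_self_eq_norm_sq]
    linarith [hGpos.inner_nonneg_left y]
  have hEx : ∀ y, ⟪D (G y), y⟫ = ⟪G y, y⟫ - ‖G y‖ ^ 2 := fun y => by
    rw [hDx, inner_sub_left, hGs (G y), real_inner_self_eq_norm_sq]
  have hEpos : (D ∘L G).IsPositive := by
    rw [ContinuousLinearMap.isPositive_iff]
    refine ⟨fun y z => ?_, fun y => ?_⟩
    · change ⟪D (G y), z⟫ = ⟪y, D (G z)⟫
      rw [hDs, hGs, hDG]
    · rw [ContinuousLinearMap.comp_apply, hEx]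
      linarith [hGle y]
  have hEle : ∀ y, ⟪D (G y), y⟫ ≤ a * ⟪D y, y⟫ := fun y => by
    rw [hEx, hDx, inner_sub_left, real_inner_self_eq_norm_sq]
    exact hq y
  -- Cauchy–Schwarz for the form of D G, with D G ≤ a D applied at y and at G y. It makes the D-form
  -- contract by a² at each application of G.
  have hN : ∀ y, ⟪D (G y), G y⟫ ≤ a ^ 2 * ⟪D y, y⟫ := by
    intro y
    have h1 := hEpos.inner_sq_le y (G y)
    simp only [ContinuousLinearMap.comp_apply] at h1
    have h2 := mul_le_mul (hEle y) (hEle (G y)) (hEpos.inner_nonneg_left (G y))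
      (mul_nonneg ha0.le (hDpos.inner_nonneg_left y))
    rcases (hDpos.inner_nonneg_left (G y)).eq_or_lt with h0 | h0
    · rw [← h0]
      exact mul_nonneg (sq_nonneg a) (hDpos.inner_nonneg_left y)
    · refine le_of_mul_le_mul_right ?_ h0
      rw [← sq]
      nlinarith
  have hNn : ∀ (n : ℕ) y, ⟪D ((G ^ n) y), (G ^ n) y⟫ ≤ a ^ (2 * n) * ⟪D y, y⟫ := by
    intro n y
    induction n with
    | zero => simp
    | succ n ih =>
      have e : (G ^ (n + 1)) y = G ((G ^ n) y) := by rw [pow_succ']; rfl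
      rw [e]
      calc _ ≤ a ^ 2 * ⟪D ((G ^ n) y), (G ^ n) y⟫ := hN _
        _ ≤ a ^ 2 * (a ^ (2 * n) * ⟪D y, y⟫) := by gcongr
        _ = _ := by ring
  have hDGn : ∀ (n : ℕ) y, (G ^ n) (D y) = D ((G ^ n) y) := by
    intro n y
    induction n with
    | zero => simp
    | succ n ih =>
      have e : ∀ y, (G ^ (n + 1)) y = G ((G ^ n) y) := fun y => by rw [pow_succ']; rfl
      rw [e, e, ih, hDG]
  -- ‖Gⁿ D y‖² = ‖D Gⁿ y‖² is at most the D-form at Gⁿ y because D ≤ 1, so the orbit decays like aⁿ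
  -- and already its first step contracts by a.
  have hGD : ∀ y, ‖G (D y)‖ ≤ a * ‖D y‖ := by
    intro y
    refine norm_apply_le_of_orbit_le_geometric hGs (C := √⟪D y, y⟫) ha0 fun n => ?_
    rw [hDGn]
    refine le_of_sq_le_sq ?_ (by positivity)
    have h1 := (hDpos.norm_sq_le_of_form_le hDle ((G ^ n) y)).trans
      ((one_mul _).trans_le (hNn n y))
    rw [mul_pow, Real.sq_sqrt (hDpos.inner_nonneg_left y), ← pow_mul, mul_comm n 2]
    linarith
  have hGD2 : ∀ y, ‖G (D y)‖ ^ 2 ≤ a * ⟪G (D y), D y⟫ := by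
    intro y
    have h1 := hGpos.inner_sq_le (D y) (G (D y))
    have h2 : ⟪G (G (D y)), G (D y)⟫ ≤ a * ‖G (D y)‖ ^ 2 := by
      have h3 := real_inner_le_norm (G (G (D y))) (G (D y))
      have h4 := hGD (G y)
      rw [hDG] at h4
      nlinarith [norm_nonneg (G (D y))]
    rw [real_inner_self_eq_norm_sq] at h1
    have h5 := mul_le_mul_of_nonneg_left h2 (hGpos.inner_nonneg_left (D y))
    rcases (norm_nonneg (G (D y))).eq_or_lt with h0 | h0
    · rw [← h0]
      have := mul_nonneg ha0.le (hGpos.inner_nonneg_left (D y))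
      linarith
    · refine le_of_mul_le_mul_right ?_ (show 0 < ‖G (D y)‖ ^ 2 by positivity)
      nlinarith
  -- z = G (D y) is in the domain and the generator maps it to z - D y. By `hGD2` and a = 1/(1+β),
  -- the derivative of ‖T s z‖² is at most -2β ‖T s z‖².
  have hdecay : ∀ y, ‖T t (G (D y))‖ ≤ Real.exp (-β * t) * ‖G (D y)‖ := by
    intro y
    set z := G (D y) with hz
    have hTz : ∀ s, 0 ≤ s → T s z = G (D (T s y)) := by
      intro s hs
      rw [hz, ← hGT hs, hDx, hDx, map_sub, hGT hs]
    have hcont : ContinuousOn (fun s => T s z) (Icc 0 t) :=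
      (h.isC0.continuousOn z).mono Icc_subset_Ici_self
    have hder : ∀ s ∈ Ico 0 t, HasDerivWithinAt
        (fun s => Real.exp (2 * β * s) * ‖T s z‖ ^ 2)
        (Real.exp (2 * β * s) * (2 * β) * ‖T s z‖ ^ 2
          + Real.exp (2 * β * s) * (2 * ⟪T s z, T s (z - D y)⟫)) (Ici s) s := by
      intro s hs
      have h1 : HasDerivAt (fun s : ℝ => Real.exp (2 * β * s)) (Real.exp (2 * β * s) * (2 * β)) s := by
        have := ((hasDerivAt_id s).const_mul (2 * β)).exp
        simpa using this
      have h2 := (h.isC0.hasDerivWithinAt (hG (D y)) hs.1).norm_sq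
      exact h1.hasDerivWithinAt.mul h2
    have hbd := image_le_of_deriv_right_le_deriv_boundary
      (f := fun s => Real.exp (2 * β * s) * ‖T s z‖ ^ 2) (B := fun _ => ‖z‖ ^ 2) (B' := fun _ => 0)
      (a := 0) (b := t)
      ((Continuous.continuousOn (by fun_prop)).mul (hcont.norm.pow 2)) hder
      (by simp [h.isC0.map_zero_apply]) continuousOn_const
      (fun s _ => hasDerivWithinAt_const _ _ _) (fun s hs => by
        have h1 := hGD2 (T s y)
        rw [← hTz s hs.1] at h1
        have e : T s (z - D y) = T s z - D (T s y) := by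
          rw [map_sub, hDx, hDx, map_sub, hGT hs.1]
        rw [e, inner_sub_right, real_inner_self_eq_norm_sq]
        have h2 : (1 + β) * ‖T s z‖ ^ 2 ≤ ⟪T s z, D (T s y)⟫ := by
          rw [ha] at h1
          rwa [le_inv_mul_iff₀ (by positivity)] at h1
        have h3 := Real.exp_pos (2 * β * s)
        nlinarith) ⟨ht, le_rfl⟩
    refine le_of_sq_le_sq ?_ (by positivity)
    have e : Real.exp (-β * t) ^ 2 = (Real.exp (2 * β * t))⁻¹ := by
      rw [← Real.exp_neg, ← Real.exp_nat_mul]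
      congr 1
      push_cast
      ring
    rw [mul_pow, e, le_inv_mul_iff₀ (Real.exp_pos _)]
    exact hbd
  have hcl : IsClosed {v : K | ‖T t v‖ ≤ Real.exp (-β * t) * ‖v‖} :=
    isClosed_le (by fun_prop) (by fun_prop)
  -- A vector v orthogonal to the range of G D satisfies G D v = 0, so G v = v, the generator kills
  -- v, and P v = v. Such v are orthogonal to x - P x.
  have hmem : x - P x ∈ ((G ∘L D).range).topologicalClosure := by
    rw [← Submodule.orthogonal_orthogonal_eq_closure, Submodule.mem_orthogonal]
    intro v hv
    rw [Submodule.mem_orthogonal] at hv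
    have h1 : D v = 0 := by
      refine hGinj _ (ext_inner_left ℝ fun w => ?_)
      rw [inner_zero_right, ← hGs, ← hDs, hDG]
      exact hv _ ⟨w, rfl⟩
    have h2 : G v = v := (sub_eq_zero.1 h1).symm
    have h3 : HasGenerator T v 0 := by
      have := hG v
      rwa [h2, sub_self] at this
    have h4 : P v = v := by
      refine tendsto_nhds_unique (h.tendsto v) (tendsto_const_nhds.congr' ?_)
      filter_upwards [eventually_ge_atTop 0] with s hs
      exact (h.isC0.apply_eq_of_hasGenerator_zero h3 hs).symm
    rw [inner_sub_right, ← h.proj_symm, h4, sub_self]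
  have hx : ‖T t (x - P x)‖ ≤ Real.exp (-β * t) * ‖x - P x‖ := by
    refine hcl.closure_subset_iff.2 ?_ hmem
    rintro _ ⟨y, rfl⟩
    exact hdecay y
  rw [← h.apply_sub_proj ht]
  exact hx.trans (mul_le_mul_of_nonneg_left (h.norm_sub_proj_le x) (Real.exp_pos _).le)

/-- For a symmetric contraction semigroup the spectral gap of the generator is the optimal
exponential rate of convergence. -/
theorem le_spectralGap_iff_decay (h : IsSymmetricContractionSemigroup T P) {β : ℝ} (hβ : 0 ≤ β) :
    (β : EReal) ≤ spectralGap (generator T) ↔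
      ∀ t, 0 ≤ t → ∀ x, ‖T t x - P x‖ ≤ Real.exp (-β * t) * ‖x‖ := by
  rw [le_spectralGap_iff]
  constructor
  · intro hres t ht x
    rcases hβ.eq_or_lt with rfl | hβ
    · simpa using h.norm_apply_sub_proj_le ht x
    · exact h.decay_of_mem_resolventSet hβ (fun r hr hr0 => hres r hr0.ne hr) ht x
  · exact fun hdec r hr0 hr => h.mem_resolventSet_of_decay hdec hr0 hr

theorem spectralGap_nonneg (h : IsSymmetricContractionSemigroup T P) :
    0 ≤ spectralGap (generator T) := by
  have := (h.le_spectralGap_iff_decay le_rfl).2 fun t ht x => by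
    simpa using h.norm_apply_sub_proj_le ht x
  simpa using this

end IsSymmetricContractionSemigroup

end SpectralGap


/-! ### Gaussian measures on Hilbert spaces -/

section GaussianExistence

variable {H : Type*} [NormedAddCommGroup H] [InnerProductSpace ℝ H]

/-- Characteristic functions pass to limits in L²: |e^{iu} - e^{iv}| ≤ |u - v|, and the L¹ norm is
at most the L² norm on a probability space. -/
theorem norm_integral_exp_inner_sub_le {Ω : Type*} [MeasurableSpace Ω] {P : Measure Ω}
    [IsProbabilityMeasure P] (Y Z : Lp H 2 P) (t : H) :
    ‖∫ ω, Complex.exp (⟪Y ω, t⟫ * Complex.I) ∂P - ∫ ω, Complex.exp (⟪Z ω, t⟫ * Complex.I) ∂P‖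
      ≤ ‖t‖ * ‖Y - Z‖ := by
  have hint : ∀ Y : Lp H 2 P, Integrable (fun ω => Complex.exp (⟪Y ω, t⟫ * Complex.I)) P := by
    intro Y
    refine Integrable.of_bound (C := 1) ?_ (Eventually.of_forall fun ω => ?_)
    · have := (Lp.aestronglyMeasurable Y).inner (𝕜 := ℝ) (aestronglyMeasurable_const (b := t) (μ := P))
      exact Complex.continuous_exp.comp_aestronglyMeasurable
        ((Complex.continuous_ofReal.comp_aestronglyMeasurable this).mul_const Complex.I)
    · rw [Complex.norm_exp_ofReal_mul_I]
  rw [← integral_sub (hint Y) (hint Z)]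
  have h2 : MemLp (fun ω => ‖(Y - Z) ω‖) 2 P := (Lp.memLp (Y - Z)).norm
  have hpt : ∀ᵐ ω ∂P, ‖Complex.exp (⟪Y ω, t⟫ * Complex.I) - Complex.exp (⟪Z ω, t⟫ * Complex.I)‖
      ≤ ‖t‖ * ‖(Y - Z) ω‖ := by
    filter_upwards [Lp.coeFn_sub Y Z] with ω hω
    rw [hω, Pi.sub_apply]
    have e : Complex.exp (⟪Y ω, t⟫ * Complex.I) - Complex.exp (⟪Z ω, t⟫ * Complex.I)
        = Complex.exp (⟪Z ω, t⟫ * Complex.I)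
          * (Complex.exp (Complex.I * (⟪Y ω - Z ω, t⟫ : ℝ)) - 1) := by
      rw [mul_sub, ← Complex.exp_add, mul_one, inner_sub_left]
      congr 2
      push_cast
      ring
    rw [e, norm_mul, Complex.norm_exp_ofReal_mul_I, one_mul]
    refine Real.norm_exp_I_mul_ofReal_sub_one_le.trans ?_
    rw [mul_comm]
    exact norm_inner_le_norm _ _
  refine (norm_integral_le_of_norm_le ((h2.integrable one_le_two).const_mul ‖t‖) hpt).trans ?_
  rw [integral_const_mul]
  refine mul_le_mul_of_nonneg_left ?_ (norm_nonneg t)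
  rw [integral_norm_eq_lintegral_enorm (Lp.aestronglyMeasurable _), ← eLpNorm_one_eq_lintegral_enorm,
    Lp.norm_def]
  exact ENNReal.toReal_mono (Lp.eLpNorm_ne_top _)
    (eLpNorm_le_eLpNorm_of_exponent_le one_le_two (Lp.aestronglyMeasurable _))

variable [MeasurableSpace H] [BorelSpace H] [SecondCountableTopology H]

/-- A random variable `∑ ξ i • v i` with independent standard normal `ξ i`. -/
theorem exists_gaussian_series [CompleteSpace H] {ι : Type*} [Countable ι] (v : ι → H)
    (hv : Summable fun i => ‖v i‖ ^ 2) :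
    ∃ μ : Measure H, IsProbabilityMeasure μ ∧
      ∀ t : H, ∀ q : ℝ, HasSum (fun i => ⟪v i, t⟫ ^ 2) q →
        charFun μ t = Complex.exp (-(q / 2 : ℝ)) := by
  classical
  set P : Measure (ι → ℝ) := Measure.infinitePi fun _ => gaussianReal 0 1 with hP
  have hm : ∀ i, Measurable fun ω : ι → ℝ => ω i := fun i => measurable_pi_apply i
  have hmap : ∀ i, P.map (fun ω => ω i) = gaussianReal 0 1 := fun i =>
    Measure.infinitePi_map_eval _ i
  have hind : iIndepFun (fun (i : ι) (ω : ι → ℝ) => ω i) P :=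
    iIndepFun_infinitePi (X := fun _ x => x) fun _ => measurable_id
  have hL2 : ∀ i, MemLp (fun ω : ι → ℝ => ω i) 2 P := by
    intro i
    have h1 := memLp_id_gaussianReal' (μ := 0) (v := 1) 2 (by simp)
    rw [← hmap i, memLp_map_measure_iff (by fun_prop) (hm i).aemeasurable] at h1
    exact h1
  have hmean : ∀ i, ∫ ω : ι → ℝ, ω i ∂P = 0 := by
    intro i
    have := integral_id_gaussianReal (μ := 0) (v := 1)
    rwa [← hmap i, integral_map (hm i).aemeasurable (by fun_prop)] at this
  have hvar : ∀ i, ∫ ω : ι → ℝ, ω i * ω i ∂P = 1 := by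
    intro i
    have := variance_id_gaussianReal (μ := 0) (v := 1)
    rw [variance_of_integral_eq_zero (by fun_prop) (by simp), ← hmap i,
      integral_map (hm i).aemeasurable (by fun_prop)] at this
    simpa [sq] using this
  have hXm : ∀ i, MemLp (fun ω : ι → ℝ => ω i • v i) 2 P := fun i => by
    have := (ContinuousLinearMap.toSpanSingleton ℝ (v i)).comp_memLp' (hL2 i)
    exact this
  set X : ι → Lp H 2 P := fun i => (hXm i).toLp _ with hX
  have hinner : ∀ i j, ⟪X i, X j⟫ = (∫ ω : ι → ℝ, ω i * ω j ∂P) * ⟪v i, v j⟫ := by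
    intro i j
    rw [L2.inner_def, ← integral_mul_const]
    refine integral_congr_ae ?_
    filter_upwards [(hXm i).coeFn_toLp, (hXm j).coeFn_toLp] with ω hi hj
    rw [hX]
    simp only
    rw [hi, hj, real_inner_smul_left, real_inner_smul_right]
    ring
  have horth : ∀ i j, i ≠ j → ⟪X i, X j⟫ = 0 := by
    intro i j hij
    rw [hinner, (hind.indepFun hij).integral_fun_mul_eq_mul_integral
      (hm i).aestronglyMeasurable (hm j).aestronglyMeasurable,
      hmean i, zero_mul, zero_mul]
  have hnorm : ∀ i, ‖X i‖ ^ 2 = ‖v i‖ ^ 2 := by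
    intro i
    rw [← real_inner_self_eq_norm_sq, hinner, hvar, one_mul, real_inner_self_eq_norm_sq]
  -- The terms are orthogonal in L² with ‖X i‖ = ‖v i‖, so square summability of the norms makes the
  -- series converge.
  have hfam : OrthogonalFamily ℝ (fun i => (Submodule.span ℝ {X i} : Submodule ℝ (Lp H 2 P)))
      fun i => (Submodule.span ℝ {X i}).subtypeₗᵢ := by
    refine OrthogonalFamily.of_pairwise fun i j hij => ?_
    simp only [Function.onFun]
    rw [Submodule.isOrtho_span]
    rintro _ rfl _ rfl
    exact horth i j hij
  have hsum : Summable X := by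
    have h1 := (hfam.summable_iff_norm_sq_summable
      fun i => ⟨X i, Submodule.mem_span_singleton_self _⟩).2 (by
        simpa only [Submodule.coe_norm, hnorm] using hv)
    exact h1
  obtain ⟨Z, hZ⟩ := hsum
  have hZm : AEMeasurable Z P := (Lp.aestronglyMeasurable Z).aemeasurable
  refine ⟨P.map Z, Measure.isProbabilityMeasure_map hZm, fun t q hq => ?_⟩
  have hchar : charFun (P.map Z) t = ∫ ω, Complex.exp (⟪Z ω, t⟫ * Complex.I) ∂P := by
    rw [charFun_apply, integral_map hZm (by fun_prop)]
  have hpartial : ∀ F : Finset ι,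
      ∫ ω, Complex.exp (⟪(∑ i ∈ F, X i : Lp H 2 P) ω, t⟫ * Complex.I) ∂P
        = Complex.exp (-((∑ i ∈ F, ⟪v i, t⟫ ^ 2) / 2 : ℝ)) := by
    intro F
    have hco : (∑ i ∈ F, X i : Lp H 2 P) =ᵐ[P] fun ω => ∑ i ∈ F, ω i • v i := by
      induction F using Finset.induction_on with
      | empty =>
        simp only [Finset.sum_empty]
        exact Lp.coeFn_zero H 2 P
      | insert i F hi ih =>
        rw [Finset.sum_insert hi]
        filter_upwards [ih, Lp.coeFn_add (X i) (∑ i ∈ F, X i), (hXm i).coeFn_toLp]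
          with ω h1 h2 h3
        rw [h2, Pi.add_apply, h1, Finset.sum_insert hi, hX]
        simp only
        rw [h3]
    have e1 : ∫ ω, Complex.exp (⟪(∑ i ∈ F, X i : Lp H 2 P) ω, t⟫ * Complex.I) ∂P
        = ∫ ω : ι → ℝ, ∏ i : F, Complex.exp ((⟪v i, t⟫ * ω i : ℝ) * Complex.I) ∂P := by
      refine integral_congr_ae ?_
      filter_upwards [hco] with ω hω
      rw [hω, ← Complex.exp_sum, sum_inner, ← Finset.sum_mul, Complex.ofReal_sum]
      congr 2
      rw [← Finset.sum_coe_sort F]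
      simp only [real_inner_smul_left, mul_comm]
    have hindF : iIndepFun (fun (i : F) (ω : ι → ℝ) => ω i) P :=
      hind.precomp Subtype.val_injective
    rw [e1, hindF.integral_fun_prod_comp (X := fun (i : F) (ω : ι → ℝ) => ω i)
      (f := fun i x => Complex.exp ((⟪v i, t⟫ * x : ℝ) * Complex.I)) (fun i => (hm i).aemeasurable)
      (fun i => by fun_prop)]
    have e2 : ∀ i : F, ∫ ω : ι → ℝ, Complex.exp ((⟪v i, t⟫ * ω i : ℝ) * Complex.I) ∂P
        = Complex.exp (-(⟪v i, t⟫ ^ 2 / 2 : ℝ)) := by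
      intro i
      have h1 := charFun_gaussianReal (μ := 0) (v := 1) ⟪v i, t⟫
      rw [charFun_apply_real, ← hmap i, integral_map (hm i).aemeasurable (by fun_prop)] at h1
      simp only [Complex.ofReal_mul]
      rw [h1]
      congr 1
      simp
    rw [Finset.prod_congr rfl fun i _ => e2 i, ← Complex.exp_sum, ← Finset.sum_coe_sort F]
    congr 1
    rw [Finset.sum_div]
    push_cast
    rw [Finset.sum_neg_distrib]
  rw [hchar]
  have hlim1 : Tendsto (fun F : Finset ι =>
      ∫ ω, Complex.exp (⟪(∑ i ∈ F, X i : Lp H 2 P) ω, t⟫ * Complex.I) ∂P) atTop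
      (𝓝 (∫ ω, Complex.exp (⟪Z ω, t⟫ * Complex.I) ∂P)) := by
    rw [tendsto_iff_norm_sub_tendsto_zero]
    have h0 : Tendsto (fun F : Finset ι => ‖t‖ * ‖(∑ i ∈ F, X i) - Z‖) atTop (𝓝 0) := by
      simpa using (tendsto_iff_norm_sub_tendsto_zero.1 hZ).const_mul ‖t‖
    exact squeeze_zero (fun _ => norm_nonneg _)
      (fun F => norm_integral_exp_inner_sub_le _ _ t) h0
  have hlim2 : Tendsto (fun F : Finset ι => Complex.exp (-((∑ i ∈ F, ⟪v i, t⟫ ^ 2) / 2 : ℝ)))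
      atTop (𝓝 (Complex.exp (-(q / 2 : ℝ)))) := by
    have hc : Continuous fun x : ℝ => Complex.exp (-(x / 2 : ℝ)) := by fun_prop
    exact (hc.tendsto q).comp hq
  exact tendsto_nhds_unique (hlim1.congr hpartial) hlim2

/-- Existence of the Gaussian measure with a given nonnegative trace class covariance operator. -/
theorem exists_isCenteredGaussian [CompleteSpace H] {C : H →L[ℝ] H} (hC : C.IsPositive)
    {ι : Type*} [Countable ι] (b : HilbertBasis ι ℝ H)
    (hsum : Summable fun i => ⟪C (b i), b i⟫) : ∃ μ : Measure H, IsCenteredGaussian μ C := by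
  obtain ⟨R, hR, hRR⟩ := hC.exists_sqrt
  have hCR : ∀ x y, ⟪C x, y⟫ = ⟪R x, R y⟫ := fun x y => by
    rw [← hRR, ContinuousLinearMap.comp_apply, hR.inner_left_eq_inner_right]
  -- With v i = R (b i), the sum of ‖v i‖² is the trace of C, and Parseval turns the sum of ⟪v i,
  -- t⟫² into ‖R t‖² = ⟪C t, t⟫.
  obtain ⟨μ, hμ, hchar⟩ := exists_gaussian_series (fun i => R (b i)) (by
    simpa only [hCR, real_inner_self_eq_norm_sq] using hsum)
  have hq : ∀ t, charFun μ t = Complex.exp (-(⟪C t, t⟫ / 2 : ℝ)) := by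
    intro t
    refine hchar t _ ?_
    have := b.hasSum_inner_mul_inner (R t) (R t)
    rw [← hCR] at this
    refine this.congr_fun fun i => ?_
    rw [hR.inner_left_eq_inner_right, real_inner_comm, sq]
  set f : H →L[ℝ] H →L[ℝ] ℝ := (innerSL ℝ).comp C with hf
  have hfa : ∀ x y, f x y = ⟪C x, y⟫ := fun x y => rfl
  have hpos : f.toBilinForm.IsPosSemidef := by
    refine ⟨⟨fun x y => ?_⟩, ⟨fun x => ?_⟩⟩
    · change f x y = f y x
      rw [hfa, hfa, hC.inner_left_eq_inner_right, real_inner_comm]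
    · exact hC.inner_nonneg_left x
  have hq' : ∀ t, charFun μ t = Complex.exp (⟪t, (0 : H)⟫ * Complex.I - f t t / 2) := by
    intro t
    rw [hq, hfa]
    congr 1
    simp
  obtain ⟨h1, h2⟩ := gaussian_charFun_congr 0 f hpos hq'
  exact ⟨μ, isGaussian_iff_gaussian_charFun.2 ⟨0, f, hpos, hq'⟩, h1.symm, fun x y => by
    rw [← h2, hfa]⟩

end GaussianExistence

namespace IsCenteredGaussian

variable {H : Type*} [NormedAddCommGroup H] [InnerProductSpace ℝ H] [CompleteSpace H]
  [MeasurableSpace H] [BorelSpace H] [SecondCountableTopology H] {μ : Measure H} {C : H → H}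

theorem charFun_eq (h : IsCenteredGaussian μ C) (t : H) :
    charFun μ t = Complex.exp (-(⟪C t, t⟫ / 2 : ℝ)) := by
  have := h.isGaussian
  have hm : μ[id] = 0 := h.mean
  rw [IsGaussian.charFun_eq', hm, h.cov, inner_zero_right]
  simp

theorem integral_cos (h : IsCenteredGaussian μ C) (a : H) (θ : ℝ) :
    ∫ y, Real.cos (⟪a, y⟫ + θ) ∂μ = Real.exp (-(⟪C a, a⟫ / 2)) * Real.cos θ := by
  have := h.isGaussian
  have e : ∀ y, Real.cos (⟪a, y⟫ + θ)
      = (Complex.exp (θ * Complex.I) * Complex.exp (⟪y, a⟫ * Complex.I)).re := by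
    intro y
    rw [← Complex.exp_add, ← add_mul, ← Complex.ofReal_add, Complex.exp_ofReal_mul_I_re, add_comm,
      real_inner_comm]
  have hint : Integrable (fun y => Complex.exp (θ * Complex.I) * Complex.exp (⟪y, a⟫ * Complex.I))
      μ := by
    refine Integrable.of_bound (C := 1) (by fun_prop) (Eventually.of_forall fun ω => ?_)
    rw [norm_mul, Complex.norm_exp_ofReal_mul_I, Complex.norm_exp_ofReal_mul_I, one_mul]
  simp_rw [e]
  have h1 := integral_re hint
  simp only [RCLike.re_to_complex] at h1
  rw [h1, integral_const_mul, ← charFun_apply, h.charFun_eq, ← Complex.ofReal_neg,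
    ← Complex.ofReal_exp, mul_comm, Complex.re_ofReal_mul, Complex.exp_ofReal_mul_I_re]

end IsCenteredGaussian

theorem gaussianN_isCenteredGaussian {H : Type*} [NormedAddCommGroup H] [InnerProductSpace ℝ H]
    [CompleteSpace H] [MeasurableSpace H] [BorelSpace H] {C : H → H}
    (h : ∃ μ : Measure H, IsCenteredGaussian μ C) : IsCenteredGaussian (gaussianN C) C := by
  rw [gaussianN, dif_pos h]
  exact h.choose_spec


/-! ### The covariance operators -/

section Covariance

theorem Orthonormal.countable_index {H ι : Type*} [NormedAddCommGroup H] [InnerProductSpace ℝ H]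
    [TopologicalSpace.SeparableSpace H] {v : ι → H} (hv : Orthonormal ℝ v) : Countable ι := by
  refine Pairwise.countable_of_isOpen_disjoint (s := fun i => Metric.ball (v i) (1 / 2))
    (fun i j hij => ?_) (fun i => Metric.isOpen_ball)
    (fun i => ⟨v i, Metric.mem_ball_self (by norm_num)⟩)
  refine Metric.ball_disjoint_ball ?_
  have h1 := norm_sub_sq_real (v i) (v j)
  rw [hv.1, hv.1, hv.2 hij] at h1
  rw [dist_eq_norm]
  nlinarith [norm_nonneg (v i - v j)]

theorem IsC0Semigroup.continuousOn_apply {E : Type*} [NormedAddCommGroup E] [NormedSpace ℝ E]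
    [CompleteSpace E] {T : ℝ → E →L[ℝ] E} (hT : IsC0Semigroup T) {g : ℝ → E}
    (hg : ContinuousOn g (Ici 0)) : ContinuousOn (fun t => T t (g t)) (Ici 0) := by
  intro t ht
  obtain ⟨M, hM1, hM⟩ := hT.exists_bound (t + 1)
  have h1 : Tendsto (fun s => T s (g t)) (𝓝[Ici 0] t) (𝓝 (T t (g t))) := hT.continuousOn _ t ht
  have h2 : Tendsto (fun s => T s (g s - g t)) (𝓝[Ici 0] t) (𝓝 0) := by
    have h3 : Tendsto (fun s => M * ‖g s - g t‖) (𝓝[Ici 0] t) (𝓝 0) := by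
      simpa using (tendsto_iff_norm_sub_tendsto_zero.1 (hg t ht)).const_mul M
    refine squeeze_zero_norm' ?_ h3
    have h4 : Iio (t + 1) ∈ 𝓝[Ici 0] t := mem_nhdsWithin_of_mem_nhds (Iio_mem_nhds (by linarith))
    filter_upwards [h4, self_mem_nhdsWithin] with s hs hs0
    exact (T s).le_of_opNorm_le (hM s ⟨hs0, le_of_lt hs⟩) _
  have := h2.add h1
  rw [zero_add] at this
  refine this.congr fun s => ?_
  rw [map_sub, sub_add_cancel]

variable {H : Type*} [NormedAddCommGroup H] [InnerProductSpace ℝ H] [CompleteSpace H]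

/-- For R = √C, Parseval gives ⟪C x, x⟫ = ∑ ⟪R x, b i⟫² ≤ ‖x‖² ∑ ‖R (b i)‖². The trace hypothesis
thereby dominates the integrals defining the covariances. -/
theorem enorm_apply_le_posTrace {C : H →L[ℝ] H} (hC : C.IsPositive) (x : H) :
    ‖C x‖ₑ ≤ posTrace C * ‖x‖ₑ := by
  rcases eq_or_ne (posTrace C) ∞ with htop | htop
  · rcases eq_or_ne x 0 with rfl | hx
    · simp
    · rw [htop, ENNReal.top_mul (by simpa using hx)]
      exact le_top
  obtain ⟨R, hR, hRR⟩ := hC.exists_sqrt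
  have hCR : ∀ x y, ⟪C x, y⟫ = ⟪R x, R y⟫ := fun x y => by
    rw [← hRR, ContinuousLinearMap.comp_apply, hR.inner_left_eq_inner_right]
  obtain ⟨b, hb⟩ := (exists_hilbertBasis ℝ H).choose_spec
  have htr : posTrace C = ∑' i, ENNReal.ofReal (‖R (b i)‖ ^ 2) := by
    rw [posTrace]
    refine tsum_congr fun i => ?_
    rw [hb, hCR, real_inner_self_eq_norm_sq]
  have hform : ∀ x, ⟪C x, x⟫ ≤ (posTrace C).toReal * ‖x‖ ^ 2 := by
    intro x
    have h1 := b.hasSum_inner_mul_inner (R x) (R x)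
    have h2 : ENNReal.ofReal ⟪C x, x⟫ ≤ posTrace C * ENNReal.ofReal (‖x‖ ^ 2) := by
      rw [hCR, ← h1.tsum_eq, ENNReal.ofReal_tsum_of_nonneg _ h1.summable, htr,
        ← ENNReal.tsum_mul_right]
      · refine ENNReal.tsum_le_tsum fun i => ?_
        rw [← ENNReal.ofReal_mul (sq_nonneg _)]
        refine ENNReal.ofReal_le_ofReal ?_
        rw [real_inner_comm, ← sq, ← hR.inner_left_eq_inner_right, ← mul_pow, ← sq_abs]
        gcongr
        exact abs_real_inner_le_norm _ _
      · intro i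
        rw [real_inner_comm]
        exact mul_self_nonneg _
    have h3 := ENNReal.toReal_mono (ENNReal.mul_ne_top htop ENNReal.ofReal_ne_top) h2
    rwa [ENNReal.toReal_ofReal (hC.inner_nonneg_left x), ENNReal.toReal_mul,
      ENNReal.toReal_ofReal (sq_nonneg _)] at h3
  have hτ : 0 ≤ (posTrace C).toReal := ENNReal.toReal_nonneg
  have h1 : ‖C x‖ ≤ (posTrace C).toReal * ‖x‖ := by
    refine le_of_sq_le_sq ?_ (by positivity)
    have := (hC.norm_sq_le_of_form_le hform x).trans (mul_le_mul_of_nonneg_left (hform x) hτ)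
    nlinarith
  rw [← ofReal_norm, ← ofReal_norm]
  refine (ENNReal.ofReal_le_ofReal h1).trans ?_
  rw [ENNReal.ofReal_mul hτ, ENNReal.ofReal_toReal htop]

variable {S : ℝ → H →L[ℝ] H} {Q : H →L[ℝ] H}

theorem covIntegrand_apply (s : ℝ) (x : H) :
    covIntegrand S Q s x = S s (Q (ContinuousLinearMap.adjoint (S s) x)) := rfl

theorem inner_covIntegrand (s : ℝ) (x y : H) :
    ⟪covIntegrand S Q s x, y⟫
      = ⟪Q (ContinuousLinearMap.adjoint (S s) x), ContinuousLinearMap.adjoint (S s) y⟫ := by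
  rw [covIntegrand_apply, ContinuousLinearMap.adjoint_inner_right]

theorem isPositive_covIntegrand (hQ : Q.IsPositive) (s : ℝ) : (covIntegrand S Q s).IsPositive := by
  rw [ContinuousLinearMap.isPositive_iff]
  refine ⟨fun x y => ?_, fun x => ?_⟩
  · simp only [ContinuousLinearMap.coe_coe]
    rw [real_inner_comm (covIntegrand S Q s y) x, inner_covIntegrand, inner_covIntegrand,
      hQ.inner_left_eq_inner_right, real_inner_comm]
  · rw [inner_covIntegrand]
    exact hQ.inner_nonneg_left _

theorem continuousOn_covIntegrand (hS : IsC0Semigroup S) (x : H) :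
    ContinuousOn (fun s => covIntegrand S Q s x) (Ici 0) :=
  hS.continuousOn_apply (Q.continuous.comp_continuousOn (hS.adjoint.continuousOn x))

variable (hS : IsC0Semigroup S) (hQ : Q.IsPositive)
  (htr : ∫⁻ s in Ioi (0 : ℝ), posTrace (covIntegrand S Q s) < ⊤)

include hS hQ htr

theorem integrableOn_covIntegrand (x : H) :
    IntegrableOn (fun s => covIntegrand S Q s x) (Ioi 0) := by
  refine ⟨((continuousOn_covIntegrand hS x).mono Ioi_subset_Ici_self).aestronglyMeasurable
    measurableSet_Ioi, ?_⟩
  refine (lintegral_mono fun s => enorm_apply_le_posTrace (isPositive_covIntegrand hQ s) x).trans_lt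
    ?_
  rw [lintegral_mul_const' _ _ (by simp)]
  exact ENNReal.mul_lt_top htr (by simp)

/-- The integral of the operators `S(s) Q S*(s)` over a set of times is a nonnegative operator. -/
theorem exists_setIntegral_covIntegrand {I : Set ℝ} (hI : I ⊆ Ioi 0) :
    ∃ C : H →L[ℝ] H, C.IsPositive ∧ ∀ x, C x = ∫ s in I, covIntegrand S Q s x := by
  have hint : ∀ x, IntegrableOn (fun s => covIntegrand S Q s x) I := fun x =>
    (integrableOn_covIntegrand hS hQ htr x).mono_set hI
  have htrI : ∫⁻ s in I, posTrace (covIntegrand S Q s) ≠ ∞ :=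
    ((lintegral_mono_set hI).trans_lt htr).ne
  obtain ⟨C, hC⟩ : ∃ C : H →L[ℝ] H, ∀ x, C x = ∫ s in I, covIntegrand S Q s x := by
    refine ⟨LinearMap.mkContinuous
      { toFun := fun x => ∫ s in I, covIntegrand S Q s x
        map_add' := fun x y => by
          simp only [map_add]
          exact integral_add (hint x) (hint y)
        map_smul' := fun c x => by
          simp only [map_smul, RingHom.id_apply]
          exact integral_smul _ _ } (∫⁻ s in I, posTrace (covIntegrand S Q s)).toReal
      fun x => ?_, fun x => rfl⟩
    change ‖∫ s in I, covIntegrand S Q s x‖ ≤ _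
    rw [← toReal_enorm, ← toReal_enorm x, ← ENNReal.toReal_mul]
    refine ENNReal.toReal_mono (ENNReal.mul_ne_top htrI (by simp)) ?_
    refine (enorm_integral_le_lintegral_enorm _).trans ?_
    rw [← lintegral_mul_const' _ _ (by simp)]
    exact lintegral_mono fun s => enorm_apply_le_posTrace (isPositive_covIntegrand hQ s) x
  have hCi : ∀ x y, ⟪C x, y⟫ = ∫ s in I, ⟪covIntegrand S Q s x, y⟫ := fun x y => by
    rw [hC, real_inner_comm, ← integral_inner (hint x) y]
    simp only [real_inner_comm]
  have hpos : C.IsPositive := by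
    rw [ContinuousLinearMap.isPositive_iff]
    refine ⟨fun x y => ?_, fun x => ?_⟩
    · simp only [ContinuousLinearMap.coe_coe]
      rw [real_inner_comm (C y) x, hCi, hCi]
      refine integral_congr_ae (Eventually.of_forall fun s => ?_)
      simp only
      rw [(isPositive_covIntegrand hQ s).inner_left_eq_inner_right, real_inner_comm]
    · rw [hCi]
      exact integral_nonneg fun s => (isPositive_covIntegrand hQ s).inner_nonneg_left x
  exact ⟨C, hpos, hC⟩

theorem exists_covOpInf_eq : ∃ C : H →L[ℝ] H, C.IsPositive ∧ ∀ x, covOpInf S Q x = C x := by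
  obtain ⟨C, h1, h2⟩ := exists_setIntegral_covIntegrand hS hQ htr (I := Ioi 0) subset_rfl
  exact ⟨C, h1, fun x => (h2 x).symm⟩

theorem exists_covOp_eq (t : ℝ) : ∃ C : H →L[ℝ] H, C.IsPositive ∧ ∀ x, covOp S Q t x = C x := by
  obtain ⟨C, h1, h2⟩ := exists_setIntegral_covIntegrand hS hQ htr (I := Ioc 0 t)
    Ioc_subset_Ioi_self
  exact ⟨C, h1, fun x => (h2 x).symm⟩

variable [MeasurableSpace H] [BorelSpace H] [SecondCountableTopology H]

/-- The integral of the operators `S(s) Q S*(s)` over a set of times is the covariance operator of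
a centered Gaussian measure. -/
theorem exists_isCenteredGaussian_setIntegral {I : Set ℝ} (hI : I ⊆ Ioi 0) :
    ∃ μ : Measure H, IsCenteredGaussian μ fun x => ∫ s in I, covIntegrand S Q s x := by
  have hint : ∀ x, IntegrableOn (fun s => covIntegrand S Q s x) I := fun x =>
    (integrableOn_covIntegrand hS hQ htr x).mono_set hI
  have htrI : ∫⁻ s in I, posTrace (covIntegrand S Q s) ≠ ∞ :=
    ((lintegral_mono_set hI).trans_lt htr).ne
  obtain ⟨C, hpos, hC⟩ := exists_setIntegral_covIntegrand hS hQ htr hI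
  have hCi : ∀ x y, ⟪C x, y⟫ = ∫ s in I, ⟪covIntegrand S Q s x, y⟫ := fun x y => by
    rw [hC, real_inner_comm, ← integral_inner (hint x) y]
    simp only [real_inner_comm]
  simp only [← hC]
  obtain ⟨b, hb⟩ := (exists_hilbertBasis ℝ H).choose_spec
  have := b.orthonormal.countable_index
  refine exists_isCenteredGaussian hpos b ?_
  -- Tonelli: the trace of the integral is at most the integral of the traces.
  have hle : ∑' i, ENNReal.ofReal ⟪C (b i), b i⟫ ≤ ∫⁻ s in I, posTrace (covIntegrand S Q s) := by
    simp only [posTrace]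
    rw [lintegral_tsum]
    · refine ENNReal.tsum_le_tsum fun i => ?_
      rw [hCi, ofReal_integral_eq_lintegral_ofReal, hb]
      · exact (hint _).inner_const _
      · exact Eventually.of_forall fun s => (isPositive_covIntegrand hQ s).inner_nonneg_left _
    · intro i
      exact ((hint i).aestronglyMeasurable.inner (𝕜 := ℝ)
        aestronglyMeasurable_const).aemeasurable.ennreal_ofReal
  have hsum := ENNReal.summable_toReal (hle.trans_lt htrI.lt_top).ne
  exact hsum.congr fun i => ENNReal.toReal_ofReal (hpos.inner_nonneg_left _)

theorem isCenteredGaussian_invMeasure : IsCenteredGaussian (invMeasure S Q) (covOpInf S Q) :=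
  gaussianN_isCenteredGaussian (exists_isCenteredGaussian_setIntegral hS hQ htr subset_rfl)

theorem isCenteredGaussian_covOp (t : ℝ) :
    IsCenteredGaussian (gaussianN (covOp S Q t)) (covOp S Q t) :=
  gaussianN_isCenteredGaussian
    (exists_isCenteredGaussian_setIntegral hS hQ htr Ioc_subset_Ioi_self)

omit [MeasurableSpace H] [BorelSpace H] [SecondCountableTopology H]

theorem inner_covOpInf (x y : H) :
    ⟪covOpInf S Q x, y⟫ = ∫ s in Ioi (0 : ℝ), ⟪covIntegrand S Q s x, y⟫ := by
  rw [covOpInf, real_inner_comm, ← integral_inner (integrableOn_covIntegrand hS hQ htr x) y]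
  simp only [real_inner_comm]

theorem inner_covOp (t : ℝ) (x y : H) :
    ⟪covOp S Q t x, y⟫ = ∫ s in Ioc 0 t, ⟪covIntegrand S Q s x, y⟫ := by
  rw [covOp, real_inner_comm, ← integral_inner
    ((integrableOn_covIntegrand hS hQ htr x).mono_set Ioc_subset_Ioi_self) y]
  simp only [real_inner_comm]

theorem integrableOn_inner_covIntegrand (x y : H) :
    IntegrableOn (fun s => ⟪covIntegrand S Q s x, y⟫) (Ioi 0) :=
  (integrableOn_covIntegrand hS hQ htr x).inner_const y

/-- `⟪Q_∞ S*(t) x, S*(t) y⟫ = ∫_t^∞ ⟪S(s) Q S*(s) x, y⟫ ds`. -/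
theorem inner_covOpInf_adjoint {t : ℝ} (ht : 0 ≤ t) (x y : H) :
    ⟪covOpInf S Q (ContinuousLinearMap.adjoint (S t) x), ContinuousLinearMap.adjoint (S t) y⟫
      = ∫ s in Ioi t, ⟪covIntegrand S Q s x, y⟫ := by
  rw [inner_covOpInf hS hQ htr]
  have := setIntegral_Ioi_comp_add_right (fun s => ⟪covIntegrand S Q s x, y⟫) 0 t
  rw [zero_add] at this
  rw [← this]
  refine setIntegral_congr_fun measurableSet_Ioi fun s hs => ?_
  have hs0 : (0 : ℝ) ≤ s := le_of_lt hs
  simp only [inner_covIntegrand]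
  rw [hS.adjoint.map_add_apply hs0 ht, hS.adjoint.map_add_apply hs0 ht]

/-- The identity S(t) Q_∞ S*(t) + Q_t = Q_∞ in weak form, from splitting the integral at t. It
carries the invariance of μ, the semigroup law of R_t and the commutation relations. -/
theorem inner_covOpInf_adjoint_add {t : ℝ} (ht : 0 ≤ t) (x y : H) :
    ⟪covOpInf S Q (ContinuousLinearMap.adjoint (S t) x), ContinuousLinearMap.adjoint (S t) y⟫
      + ⟪covOp S Q t x, y⟫ = ⟪covOpInf S Q x, y⟫ := by
  rw [inner_covOpInf_adjoint hS hQ htr ht, inner_covOp hS hQ htr, inner_covOpInf hS hQ htr,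
    add_comm, ← setIntegral_union (by
      rw [Set.disjoint_left]
      exact fun s h1 h2 => absurd h1.2 (not_le.2 h2)) measurableSet_Ioi
    ((integrableOn_inner_covIntegrand hS hQ htr x y).mono_set Ioc_subset_Ioi_self)
    ((integrableOn_inner_covIntegrand hS hQ htr x y).mono_set (Ioi_subset_Ioi ht)),
    Ioc_union_Ioi_eq_Ioi ht]

end Covariance


/-! ### Trigonometric functions in `L²` of a Gaussian measure -/

section Trigonometric

variable {H : Type*} [NormedAddCommGroup H] [InnerProductSpace ℝ H]
  [MeasurableSpace H] [BorelSpace H]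

theorem measurable_cosInner (a : H) (θ : ℝ) : Measurable fun x : H => Real.cos (⟪a, x⟫ + θ) :=
  Continuous.measurable (by fun_prop)

theorem memLp_cosInner (μ : Measure H) [IsFiniteMeasure μ] (a : H) (θ : ℝ) :
    MemLp (fun x : H => Real.cos (⟪a, x⟫ + θ)) 2 μ :=
  MemLp.of_bound (measurable_cosInner a θ).aestronglyMeasurable 1
    (Eventually.of_forall fun x => by simpa using Real.abs_cos_le_one _)

/-- The function `x ↦ cos (⟪a, x⟫ + θ)` as an element of `L²(μ)`. -/
noncomputable def cosLp (μ : Measure H) [IsFiniteMeasure μ] (a : H) (θ : ℝ) : Lp ℝ 2 μ :=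
  (memLp_cosInner μ a θ).toLp _

theorem coeFn_cosLp (μ : Measure H) [IsFiniteMeasure μ] (a : H) (θ : ℝ) :
    cosLp μ a θ =ᵐ[μ] fun x => Real.cos (⟪a, x⟫ + θ) :=
  (memLp_cosInner μ a θ).coeFn_toLp

theorem cosLp_zero (μ : Measure H) [IsFiniteMeasure μ] : cosLp μ 0 0 = Lp.const 2 μ (1 : ℝ) := by
  refine Lp.ext ?_
  filter_upwards [coeFn_cosLp μ 0 0, Lp.coeFn_const (p := 2) (μ := μ) (1 : ℝ)] with x h1 h2
  rw [h1, h2]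
  simp

variable [CompleteSpace H] [SecondCountableTopology H]

/-- The trigonometric functions form a total set. -/
theorem dense_span_cosLp (μ : Measure H) [IsFiniteMeasure μ] :
    Dense (Submodule.span ℝ (range fun p : H × ℝ => cosLp μ p.1 p.2) : Set (Lp ℝ 2 μ)) := by
  rw [Submodule.dense_iff_topologicalClosure_eq_top, Submodule.topologicalClosure_eq_top_iff,
    Submodule.eq_bot_iff]
  intro f hf
  have hf1 : Integrable f μ := (Lp.memLp f).integrable one_le_two
  have hcos : ∀ a θ, ∫ x, f x * Real.cos (⟪a, x⟫ + θ) ∂μ = 0 := by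
    intro a θ
    have h1 : ⟪cosLp μ a θ, f⟫ = 0 :=
      (Submodule.mem_orthogonal _ _).1 hf _ (Submodule.subset_span ⟨(a, θ), rfl⟩)
    rw [L2.inner_def] at h1
    rw [← h1]
    refine integral_congr_ae ?_
    filter_upwards [coeFn_cosLp μ a θ] with x hx
    rw [hx]
    simp
  have hfm : AEMeasurable f μ := (Lp.aestronglyMeasurable f).aemeasurable
  set g₁ : H → ℝ≥0∞ := fun x => ENNReal.ofReal (f x) with hg₁
  set g₂ : H → ℝ≥0∞ := fun x => ENNReal.ofReal (-f x) with hg₂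
  have hm₁ : AEMeasurable g₁ μ := hfm.ennreal_ofReal
  have hm₂ : AEMeasurable g₂ μ := hfm.neg.ennreal_ofReal
  have hi₁ : ∫⁻ x, g₁ x ∂μ ≠ ∞ := hf1.lintegral_lt_top.ne
  have hi₂ : ∫⁻ x, g₂ x ∂μ ≠ ∞ := hf1.neg.lintegral_lt_top.ne
  have := isFiniteMeasure_withDensity hi₁
  have := isFiniteMeasure_withDensity hi₂
  -- The positive and negative parts of f are densities of finite measures with the same
  -- characteristic function. The phases θ = 0 and θ = π/2 supply the real and imaginary parts.
  have heq : μ.withDensity g₁ = μ.withDensity g₂ := by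
    refine Measure.ext_of_charFun (funext fun a => ?_)
    rw [charFun_apply, charFun_apply,
      integral_withDensity_eq_integral_toReal_smul₀ hm₁ (by simp [hg₁]),
      integral_withDensity_eq_integral_toReal_smul₀ hm₂ (by simp [hg₂]), ← sub_eq_zero]
    have hb : ∀ g : H → ℝ≥0∞, AEMeasurable g μ → ∫⁻ x, g x ∂μ ≠ ∞ →
        Integrable (fun x => (g x).toReal • Complex.exp (⟪x, a⟫ * Complex.I)) μ := by
      intro g hg hgi
      refine (integrable_toReal_of_lintegral_ne_top hg hgi).smul_bdd (C := 1) ?_ ?_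
      · fun_prop
      · exact Eventually.of_forall fun x => (Complex.norm_exp_ofReal_mul_I _).le
    rw [← integral_sub (hb g₁ hm₁ hi₁) (hb g₂ hm₂ hi₂)]
    have e : ∀ x, (g₁ x).toReal • Complex.exp (⟪x, a⟫ * Complex.I)
        - (g₂ x).toReal • Complex.exp (⟪x, a⟫ * Complex.I)
        = ((f x * Real.cos (⟪a, x⟫ + 0) : ℝ) : ℂ)
          - ((f x * Real.cos (⟪a, x⟫ + Real.pi / 2) : ℝ) : ℂ) * Complex.I := by
      intro x
      have h1 : (g₁ x).toReal - (g₂ x).toReal = f x := by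
        rw [hg₁, hg₂]
        simp only [ENNReal.toReal_ofReal']
        rcases le_total (f x) 0 with h | h
        · rw [max_eq_right h, max_eq_left (neg_nonneg.2 h)]; ring
        · rw [max_eq_left h, max_eq_right (neg_nonpos.2 h)]; ring
      rw [← sub_smul, h1, Complex.exp_mul_I, Real.cos_add_pi_div_two, add_zero, real_inner_comm]
      simp only [Complex.real_smul]
      push_cast
      ring
    simp_rw [e]
    have hfc : ∀ θ, Integrable (fun x => f x * Real.cos (⟪a, x⟫ + θ)) μ := fun θ =>
      hf1.mul_bdd (c := 1) (measurable_cosInner a θ).aestronglyMeasurable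
        (Eventually.of_forall fun x => by simpa using Real.abs_cos_le_one _)
    rw [integral_sub (hfc _).ofReal ((hfc _).ofReal.mul_const _), integral_mul_const,
      integral_complex_ofReal, integral_complex_ofReal, hcos, hcos]
    simp
  rw [withDensity_eq_iff hm₁ hm₂ hi₁] at heq
  refine Lp.ext ?_
  filter_upwards [heq, Lp.coeFn_zero ℝ 2 μ] with x hx h0
  rw [h0, Pi.zero_apply]
  have h1 := congrArg ENNReal.toReal hx
  simp only [hg₁, hg₂, ENNReal.toReal_ofReal'] at h1
  rcases le_total (f x) 0 with h | h
  · rw [max_eq_right h, max_eq_left (neg_nonneg.2 h)] at h1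
    linarith
  · rw [max_eq_left h, max_eq_right (neg_nonpos.2 h)] at h1
    linarith

/-- The product-to-sum formula reduces the inner product to two Gaussian integrals of cosines. -/
theorem IsCenteredGaussian.inner_cosLp {μ : Measure H} [IsFiniteMeasure μ] {C : H → H}
    (h : IsCenteredGaussian μ C) (a b : H) (θ η : ℝ) :
    ⟪cosLp μ a θ, cosLp μ b η⟫ = (Real.exp (-(⟪C (a + b), a + b⟫ / 2)) * Real.cos (θ + η)
      + Real.exp (-(⟪C (a - b), a - b⟫ / 2)) * Real.cos (θ - η)) / 2 := by
  rw [L2.inner_def, ← h.integral_cos, ← h.integral_cos, ← integral_add, ← integral_div]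
  · refine integral_congr_ae ?_
    filter_upwards [coeFn_cosLp μ a θ, coeFn_cosLp μ b η] with x h1 h2
    rw [h1, h2]
    have e1 : ⟪a + b, x⟫ + (θ + η) = (⟪a, x⟫ + θ) + (⟪b, x⟫ + η) := by
      rw [inner_add_left]; ring
    have e2 : ⟪a - b, x⟫ + (θ - η) = (⟪a, x⟫ + θ) - (⟪b, x⟫ + η) := by
      rw [inner_sub_left]; ring
    rw [e1, e2, Real.cos_add (⟪a, x⟫ + θ), Real.cos_sub (⟪a, x⟫ + θ)]
    simp only [RCLike.inner_apply, conj_trivial]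
    ring
  · exact (memLp_cosInner μ _ _).integrable one_le_two
  · exact (memLp_cosInner μ _ _).integrable one_le_two

end Trigonometric

/-! ### The Ornstein–Uhlenbeck semigroup in `L²` -/

section OrnsteinUhlenbeck

variable {H : Type*} [NormedAddCommGroup H] [InnerProductSpace ℝ H] [CompleteSpace H]
  [MeasurableSpace H] [BorelSpace H] [SecondCountableTopology H]
  {S : ℝ → H →L[ℝ] H} {Q : H →L[ℝ] H}

/-- The measure `N(0, Q_∞)` is invariant. -/
theorem measurePreserving_ou (hS : IsC0Semigroup S) (hQ : Q.IsPositive)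
    (htr : ∫⁻ s in Ioi (0 : ℝ), posTrace (covIntegrand S Q s) < ⊤) {t : ℝ} (ht : 0 ≤ t) :
    MeasurePreserving (fun p : H × H => S t p.1 + p.2)
      ((invMeasure S Q).prod (gaussianN (covOp S Q t))) (invMeasure S Q) := by
  have hm : Measurable fun p : H × H => S t p.1 + p.2 := by fun_prop
  refine ⟨hm, ?_⟩
  have := Measure.isProbabilityMeasure_map (μ := (invMeasure S Q).prod (gaussianN (covOp S Q t)))
    hm.aemeasurable
  refine Measure.ext_of_charFun (funext fun a => ?_)
  rw [charFun_apply, integral_map hm.aemeasurable (by fun_prop)]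
  have e : ∀ p : H × H, Complex.exp (⟪S t p.1 + p.2, a⟫ * Complex.I)
      = Complex.exp (⟪p.1, ContinuousLinearMap.adjoint (S t) a⟫ * Complex.I)
        * Complex.exp (⟪p.2, a⟫ * Complex.I) := by
    intro p
    rw [← Complex.exp_add, inner_add_left, ContinuousLinearMap.adjoint_inner_right]
    push_cast
    ring_nf
  simp_rw [e]
  rw [integral_prod_mul (fun x : H => Complex.exp (⟪x, ContinuousLinearMap.adjoint (S t) a⟫
      * Complex.I)) (fun y : H => Complex.exp (⟪y, a⟫ * Complex.I)), ← charFun_apply,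
    ← charFun_apply, (isCenteredGaussian_invMeasure hS hQ htr).charFun_eq,
    (isCenteredGaussian_covOp hS hQ htr t).charFun_eq,
    (isCenteredGaussian_invMeasure hS hQ htr).charFun_eq, ← Complex.exp_add,
    ← inner_covOpInf_adjoint_add hS hQ htr ht a a]
  push_cast
  ring_nf

/-- J composes with (x, y) ↦ S(t)x + y and F with the projection to x. Invariance of μ makes J an
isometry, and the adjoint of F integrates out y, so F* J is a contraction that extends R_t. -/
theorem exists_ouL2_extension (hS : IsC0Semigroup S) (hQ : Q.IsPositive)
    (htr : ∫⁻ s in Ioi (0 : ℝ), posTrace (covIntegrand S Q s) < ⊤) {t : ℝ} (ht : 0 ≤ t) :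
    ∃ T : Lp ℝ 2 (invMeasure S Q) →L[ℝ] Lp ℝ 2 (invMeasure S Q), ‖T‖ ≤ 1 ∧
      ∀ φ : H → ℝ, Measurable φ → (∃ c : ℝ, ∀ x, |φ x| ≤ c) →
        ∀ f : Lp ℝ 2 (invMeasure S Q), f =ᵐ[invMeasure S Q] φ →
          T f =ᵐ[invMeasure S Q] ouSemigroup S Q t φ := by
  set μ := invMeasure S Q with hμ
  set ν := gaussianN (covOp S Q t) with hν
  have hmp : MeasurePreserving (fun p : H × H => S t p.1 + p.2) (μ.prod ν) μ :=
    measurePreserving_ou hS hQ htr ht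
  have hfst : MeasurePreserving (Prod.fst : H × H → H) (μ.prod ν) μ := measurePreserving_fst
  set J : Lp ℝ 2 μ →L[ℝ] Lp ℝ 2 (μ.prod ν) :=
    (Lp.compMeasurePreservingₗᵢ ℝ _ hmp).toContinuousLinearMap with hJ
  set F : Lp ℝ 2 μ →L[ℝ] Lp ℝ 2 (μ.prod ν) :=
    (Lp.compMeasurePreservingₗᵢ ℝ _ hfst).toContinuousLinearMap with hF
  refine ⟨ContinuousLinearMap.adjoint F ∘L J, ?_, fun φ hφ hbd f hf => ?_⟩
  · refine (ContinuousLinearMap.opNorm_comp_le _ _).trans ?_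
    rw [LinearIsometryEquiv.norm_map]
    exact mul_le_one₀ (LinearIsometry.norm_toContinuousLinearMap_le _) (norm_nonneg _)
      (LinearIsometry.norm_toContinuousLinearMap_le _)
  obtain ⟨c, hc⟩ := hbd
  have hc0 : 0 ≤ c := (abs_nonneg _).trans (hc 0)
  have hRm : StronglyMeasurable (ouSemigroup S Q t φ) := by
    have h1 : StronglyMeasurable fun p : H × H => φ (S t p.1 + p.2) :=
      (hφ.comp hmp.measurable).stronglyMeasurable
    exact h1.integral_prod_right' (ν := ν)
  have hRb : ∀ x, ‖ouSemigroup S Q t φ x‖ ≤ c := by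
    intro x
    refine (norm_integral_le_of_norm_le_const (Eventually.of_forall fun y => hc _)).trans ?_
    simp
  have hRL : MemLp (ouSemigroup S Q t φ) 2 μ :=
    MemLp.of_bound hRm.aestronglyMeasurable c (Eventually.of_forall hRb)
  have key : (ContinuousLinearMap.adjoint F ∘L J) f = hRL.toLp _ := by
    refine ext_inner_right ℝ fun g => ?_
    rw [ContinuousLinearMap.comp_apply, ContinuousLinearMap.adjoint_inner_left, L2.inner_def,
      L2.inner_def]
    have hJf : J f =ᵐ[μ.prod ν] fun p => φ (S t p.1 + p.2) := by
      have h1 := Lp.coeFn_compMeasurePreserving f hmp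
      have h2 := hmp.quasiMeasurePreserving.ae_eq_comp hf
      exact h1.trans h2
    have hFg : F g =ᵐ[μ.prod ν] fun p => g p.1 := Lp.coeFn_compMeasurePreserving g hfst
    have e1 : ∫ p, ⟪J f p, F g p⟫ ∂(μ.prod ν)
        = ∫ p, φ (S t p.1 + p.2) * g p.1 ∂(μ.prod ν) := by
      refine integral_congr_ae ?_
      filter_upwards [hJf, hFg] with p h1 h2
      rw [h1, h2]
      simp [mul_comm]
    have hg1 : Integrable (fun p : H × H => g p.1) (μ.prod ν) :=
      hfst.integrable_comp_of_integrable ((Lp.memLp g).integrable one_le_two)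
    have hint : Integrable (fun p : H × H => φ (S t p.1 + p.2) * g p.1) (μ.prod ν) :=
      hg1.bdd_mul (c := c) (hφ.comp hmp.measurable).aestronglyMeasurable
        (Eventually.of_forall fun p => hc _)
    rw [e1, integral_prod _ hint]
    refine integral_congr_ae ?_
    filter_upwards [hRL.coeFn_toLp] with x hx
    rw [hx, integral_mul_const]
    simp only [RCLike.inner_apply, conj_trivial, ouSemigroup]
    rw [mul_comm]
  rw [key]
  exact hRL.coeFn_toLp

theorem ouSemigroup_cos (hS : IsC0Semigroup S) (hQ : Q.IsPositive)
    (htr : ∫⁻ s in Ioi (0 : ℝ), posTrace (covIntegrand S Q s) < ⊤) (t : ℝ) (a : H) (θ : ℝ)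
    (x : H) : ouSemigroup S Q t (fun x => Real.cos (⟪a, x⟫ + θ)) x
      = Real.exp (-(⟪covOp S Q t a, a⟫ / 2))
        * Real.cos (⟪ContinuousLinearMap.adjoint (S t) a, x⟫ + θ) := by
  rw [← (isCenteredGaussian_covOp hS hQ htr t).integral_cos, ouSemigroup]
  refine integral_congr_ae (Eventually.of_forall fun y => ?_)
  simp only
  rw [inner_add_right, ContinuousLinearMap.adjoint_inner_left]
  congr 1
  ring

section

variable (hS : IsC0Semigroup S) (hQ : Q.IsPositive)
  (htr : ∫⁻ s in Ioi (0 : ℝ), posTrace (covIntegrand S Q s) < ⊤)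

include hS hQ htr

theorem ouL2_spec {t : ℝ} (ht : 0 ≤ t) {φ : H → ℝ} (hφ : Measurable φ)
    (hb : ∃ c : ℝ, ∀ x, |φ x| ≤ c) {f : Lp ℝ 2 (invMeasure S Q)} (hf : f =ᵐ[invMeasure S Q] φ) :
    ouL2 S Q t f =ᵐ[invMeasure S Q] ouSemigroup S Q t φ := by
  obtain ⟨T, -, hT⟩ := exists_ouL2_extension hS hQ htr ht
  have hex : ∃ T : Lp ℝ 2 (invMeasure S Q) →L[ℝ] Lp ℝ 2 (invMeasure S Q),
      ∀ φ : H → ℝ, Measurable φ → (∃ c : ℝ, ∀ x, |φ x| ≤ c) →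
        ∀ f : Lp ℝ 2 (invMeasure S Q), f =ᵐ[invMeasure S Q] φ →
          T f =ᵐ[invMeasure S Q] ouSemigroup S Q t φ := ⟨T, hT⟩
  rw [ouL2, dif_pos hex]
  exact hex.choose_spec φ hφ hb f hf

/-- `ouL2` is chosen by its values on bounded functions alone. It agrees with the contraction just
built because the two coincide on cosines. -/
theorem norm_ouL2_le {t : ℝ} (ht : 0 ≤ t) : ‖ouL2 S Q t‖ ≤ 1 := by
  obtain ⟨T, hT1, hT⟩ := exists_ouL2_extension hS hQ htr ht
  have : ouL2 S Q t = T := by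
    refine ContinuousLinearMap.ext_on (dense_span_cosLp (invMeasure S Q)) ?_
    rintro _ ⟨p, rfl⟩
    have hb : ∃ c : ℝ, ∀ x : H, |Real.cos (⟪p.1, x⟫ + p.2)| ≤ c :=
      ⟨1, fun x => Real.abs_cos_le_one _⟩
    exact Lp.ext ((ouL2_spec hS hQ htr ht (measurable_cosInner _ _) hb (coeFn_cosLp _ _ _)).trans
      (hT _ (measurable_cosInner _ _) hb _ (coeFn_cosLp _ _ _)).symm)
  rw [this]
  exact hT1

theorem ouL2_cosLp {t : ℝ} (ht : 0 ≤ t) (a : H) (θ : ℝ) :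
    ouL2 S Q t (cosLp _ a θ) = Real.exp (-(⟪covOp S Q t a, a⟫ / 2))
      • cosLp _ (ContinuousLinearMap.adjoint (S t) a) θ := by
  refine Lp.ext ?_
  have hb : ∃ c : ℝ, ∀ x : H, |Real.cos (⟪a, x⟫ + θ)| ≤ c := ⟨1, fun x => Real.abs_cos_le_one _⟩
  filter_upwards [ouL2_spec hS hQ htr ht (measurable_cosInner a θ) hb (coeFn_cosLp _ _ _),
    Lp.coeFn_smul (Real.exp (-(⟪covOp S Q t a, a⟫ / 2)))
      (cosLp (invMeasure S Q) (ContinuousLinearMap.adjoint (S t) a) θ),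
    coeFn_cosLp (invMeasure S Q) (ContinuousLinearMap.adjoint (S t) a) θ] with x h1 h2 h3
  rw [h1, h2, Pi.smul_apply, h3, ouSemigroup_cos hS hQ htr, smul_eq_mul]

theorem isC0Semigroup_ouL2 : IsC0Semigroup (ouL2 S Q) where
  map_zero := by
    refine ContinuousLinearMap.ext_on (dense_span_cosLp (invMeasure S Q)) ?_
    rintro _ ⟨p, rfl⟩
    simp only
    rw [ouL2_cosLp hS hQ htr le_rfl, hS.adjoint.map_zero_apply]
    simp [covOp]
  map_add s t hs ht := by
    refine ContinuousLinearMap.ext_on (dense_span_cosLp (invMeasure S Q)) ?_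
    rintro _ ⟨⟨a, θ⟩, rfl⟩
    simp only [ContinuousLinearMap.comp_apply]
    rw [ouL2_cosLp hS hQ htr (add_nonneg hs ht), ouL2_cosLp hS hQ htr ht, map_smul,
      ouL2_cosLp hS hQ htr hs, smul_smul, ← Real.exp_add,
      hS.adjoint.map_add_apply hs ht]
    -- The three identities combine to Q_{s+t} = Q_t + S(t) Q_s S*(t) as forms, so the exponents add
    -- up.
    have h1 := inner_covOpInf_adjoint_add hS hQ htr (add_nonneg hs ht) a a
    have h2 := inner_covOpInf_adjoint_add hS hQ htr ht a a
    have h3 := inner_covOpInf_adjoint_add hS hQ htr hs (ContinuousLinearMap.adjoint (S t) a)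
      (ContinuousLinearMap.adjoint (S t) a)
    rw [hS.adjoint.map_add_apply hs ht] at h1
    congr 2
    linarith
  tendsto_zero := by
    have hsmall : Ioi (0 : ℝ) ∈ 𝓝[>] (0 : ℝ) := self_mem_nhdsWithin
    refine tendsto_apply_of_dense_span (L := ContinuousLinearMap.id ℝ _) (M := 1) ?_
      (dense_span_cosLp (invMeasure S Q)) ?_
    · filter_upwards [hsmall] with t ht
      exact norm_ouL2_le hS hQ htr (le_of_lt ht)
    rintro _ ⟨⟨a, θ⟩, rfl⟩
    simp only [ContinuousLinearMap.id_apply]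
    set e := cosLp (invMeasure S Q) a θ with he
    obtain ⟨C, hC, hCe⟩ := exists_covOpInf_eq hS hQ htr
    have hadj := hS.adjoint.tendsto_zero a
    -- For contractions, ‖R_t e - e‖² ≤ 2(⟪e, e⟫ - ⟪R_t e, e⟫), so this weak limit is enough for
    -- strong continuity.
    have hinner : Tendsto (fun t => ⟪ouL2 S Q t e, e⟫) (𝓝[>] 0) (𝓝 ⟪e, e⟫) := by
      have hq : Tendsto (fun t => ⟪covOp S Q t a, a⟫) (𝓝[>] 0) (𝓝 0) := by
        have h1 : Tendsto (fun t => ⟪C a, a⟫ - ⟪C (ContinuousLinearMap.adjoint (S t) a),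
            ContinuousLinearMap.adjoint (S t) a⟫) (𝓝[>] 0) (𝓝 (⟪C a, a⟫ - ⟪C a, a⟫)) :=
          tendsto_const_nhds.sub (((C.continuous.tendsto a).comp hadj).inner hadj)
        rw [sub_self] at h1
        refine h1.congr' ?_
        filter_upwards [hsmall] with t ht
        have := inner_covOpInf_adjoint_add hS hQ htr (le_of_lt ht) a a
        rw [hCe, hCe] at this
        linarith
      have hcont : Continuous fun p : ℝ × H => Real.exp (-(p.1 / 2))
          * ((Real.exp (-(⟪C (p.2 + a), p.2 + a⟫ / 2)) * Real.cos (θ + θ)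
            + Real.exp (-(⟪C (p.2 - a), p.2 - a⟫ / 2)) * Real.cos (θ - θ)) / 2) := by
        fun_prop
      have h2 := (hcont.tendsto (0, a)).comp (hq.prodMk_nhds hadj)
      have hμ := isCenteredGaussian_invMeasure hS hQ htr
      refine (h2.congr' ?_).trans_eq ?_
      · filter_upwards [hsmall] with t ht
        rw [he, ouL2_cosLp hS hQ htr (le_of_lt ht), real_inner_smul_left, hμ.inner_cosLp]
        simp only [Function.comp, hCe]
      · rw [he, hμ.inner_cosLp]
        simp only [hCe]
        simp
    rw [tendsto_iff_norm_sub_tendsto_zero]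
    have hb : Tendsto (fun t => √(2 * (⟪e, e⟫ - ⟪ouL2 S Q t e, e⟫))) (𝓝[>] 0) (𝓝 0) := by
      have := ((tendsto_const_nhds.sub hinner).const_mul 2).sqrt (x := 2 * (⟪e, e⟫ - ⟪e, e⟫))
      simpa using this
    refine squeeze_zero' (Eventually.of_forall fun _ => norm_nonneg _) ?_ hb
    filter_upwards [hsmall] with t ht
    refine Real.le_sqrt_of_sq_le ?_
    rw [norm_sub_sq_real, real_inner_self_eq_norm_sq]
    have h1 : ‖ouL2 S Q t e‖ ≤ ‖e‖ := by
      simpa using (ouL2 S Q t).le_of_opNorm_le (norm_ouL2_le hS hQ htr (le_of_lt ht)) e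
    have h2 := pow_le_pow_left₀ (norm_nonneg _) h1 2
    linarith

end

end OrnsteinUhlenbeck


/-! ### Consequences of symmetry -/

section Symmetry

open ContinuousLinearMap (adjoint)

variable {H : Type*} [NormedAddCommGroup H] [InnerProductSpace ℝ H] [CompleteSpace H]
  {S : ℝ → H →L[ℝ] H} {Q : H →L[ℝ] H}
  (hS : IsC0Semigroup S) (hQ : Q.IsPositive)
  (htr : ∫⁻ s in Ioi (0 : ℝ), posTrace (covIntegrand S Q s) < ⊤)

include hS hQ htr

section Measure

variable [MeasurableSpace H] [BorelSpace H] [SecondCountableTopology H]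

theorem inner_cosLp_ouL2 (hsymm : IsSymmetricOU S Q) {t : ℝ} (ht : 0 ≤ t) (a b : H) (θ η : ℝ) :
    ⟪ouL2 S Q t (cosLp _ a θ), cosLp _ b η⟫ = ⟪cosLp _ a θ, ouL2 S Q t (cosLp _ b η)⟫ := by
  have hb : ∀ (a : H) (θ : ℝ), ∃ c : ℝ, ∀ x : H, |Real.cos (⟪a, x⟫ + θ)| ≤ c :=
    fun a θ => ⟨1, fun x => Real.abs_cos_le_one _⟩
  have h := hsymm t ht _ _ (measurable_cosInner a θ) (measurable_cosInner b η) (hb a θ) (hb b η)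
  rw [L2.inner_def, L2.inner_def]
  refine Eq.trans (integral_congr_ae ?_) (h.trans (integral_congr_ae ?_))
  · filter_upwards [ouL2_spec hS hQ htr ht (measurable_cosInner a θ) (hb a θ) (coeFn_cosLp _ _ _),
      coeFn_cosLp (invMeasure S Q) b η] with x h1 h2
    rw [h1, h2]
    simp
  · filter_upwards [ouL2_spec hS hQ htr ht (measurable_cosInner b η) (hb b η) (coeFn_cosLp _ _ _),
      coeFn_cosLp (invMeasure S Q) a θ] with x h1 h2
    rw [h1, h2]
    simp [mul_comm]

theorem inner_ouL2_comm (hsymm : IsSymmetricOU S Q) {t : ℝ} (ht : 0 ≤ t)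
    (f g : Lp ℝ 2 (invMeasure S Q)) : ⟪ouL2 S Q t f, g⟫ = ⟪f, ouL2 S Q t g⟫ := by
  have hd := dense_span_cosLp (invMeasure S Q)
  have h1 : ∀ p : H × ℝ, ∀ g, ⟪ouL2 S Q t (cosLp _ p.1 p.2), g⟫
      = ⟪cosLp _ p.1 p.2, ouL2 S Q t g⟫ := by
    intro p g
    have : innerSL ℝ (ouL2 S Q t (cosLp _ p.1 p.2))
        = innerSL ℝ (cosLp _ p.1 p.2) ∘L ouL2 S Q t := by
      refine ContinuousLinearMap.ext_on hd ?_
      rintro _ ⟨p', rfl⟩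
      exact inner_cosLp_ouL2 hS hQ htr hsymm ht _ _ _ _
    exact congrArg (fun L => L g) this
  have : innerSL ℝ g ∘L ouL2 S Q t = innerSL ℝ (ouL2 S Q t g) := by
    refine ContinuousLinearMap.ext_on hd ?_
    rintro _ ⟨p, rfl⟩
    have := h1 p g
    rw [real_inner_comm, real_inner_comm (ouL2 S Q t g)] at this
    exact this
  have h2 := congrArg (fun L => L f) this
  rw [real_inner_comm, real_inner_comm (ouL2 S Q t g)]
  exact h2

/-- Symmetry of the transition semigroup means `Q_∞ S*(t) = S(t) Q_∞`. -/
theorem covOpInf_adjoint_comm (hsymm : IsSymmetricOU S Q) {t : ℝ} (ht : 0 ≤ t) (a : H) :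
    covOpInf S Q (adjoint (S t) a) = S t (covOpInf S Q a) := by
  obtain ⟨C, hC, hCe⟩ := exists_covOpInf_eq hS hQ htr
  have hμ := isCenteredGaussian_invMeasure hS hQ htr
  -- The phase π/2 turns cosines into sines. The prefactor is symmetric in a and b, so symmetry of
  -- R_t equates two values of sinh, which is injective.
  have hsinh : ∀ a b : H, ⟪ouL2 S Q t (cosLp _ a (Real.pi / 2)), cosLp _ b (Real.pi / 2)⟫
      = Real.exp (-((⟪C a, a⟫ + ⟪C b, b⟫) / 2)) * Real.sinh ⟪C (adjoint (S t) a), b⟫ := by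
    intro a b
    have h1 := inner_covOpInf_adjoint_add hS hQ htr ht a a
    rw [hCe, hCe] at h1
    have h2 : ⟪C b, adjoint (S t) a⟫ = ⟪C (adjoint (S t) a), b⟫ := by
      rw [hC.inner_left_eq_inner_right, real_inner_comm]
    rw [ouL2_cosLp hS hQ htr ht, real_inner_smul_left, hμ.inner_cosLp, hCe, hCe, add_halves,
      sub_self, Real.cos_pi, Real.cos_zero, Real.sinh_eq]
    simp only [map_add, map_sub, inner_add_left, inner_add_right, inner_sub_left, inner_sub_right,
      h2]
    have e : ∀ x y z : ℝ, Real.exp x * ((Real.exp y * (-1) + Real.exp z * 1) / 2)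
        = (Real.exp (x + z) - Real.exp (x + y)) / 2 := fun x y z => by
      rw [Real.exp_add, Real.exp_add]; ring
    have e' : ∀ x y z : ℝ, Real.exp x * ((Real.exp y - Real.exp z) / 2)
        = (Real.exp (x + y) - Real.exp (x + z)) / 2 := fun x y z => by
      rw [Real.exp_add, Real.exp_add]; ring
    rw [e, e']
    congr 3 <;> linarith
  refine ext_inner_right ℝ fun b => ?_
  have h3 := inner_cosLp_ouL2 hS hQ htr hsymm ht a b (Real.pi / 2) (Real.pi / 2)
  rw [real_inner_comm _ (cosLp _ a _), hsinh, hsinh, add_comm ⟪C b, b⟫] at h3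
  have h4 := Real.sinh_injective (mul_left_cancel₀ (Real.exp_ne_zero _) h3)
  rw [hCe, hCe, h4, hC.inner_left_eq_inner_right, ContinuousLinearMap.adjoint_inner_left,
    real_inner_comm]

end Measure

/-- The covariance form decreases along the adjoint semigroup. -/
theorem inner_covOpInf_adjoint_le {t : ℝ} (ht : 0 ≤ t) (x : H) :
    ⟪covOpInf S Q (adjoint (S t) x), adjoint (S t) x⟫ ≤ ⟪covOpInf S Q x, x⟫ := by
  have h := inner_covOpInf_adjoint_add hS hQ htr ht x x
  have : 0 ≤ ⟪covOp S Q t x, x⟫ := by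
    rw [inner_covOp hS hQ htr]
    exact integral_nonneg fun s => (isPositive_covIntegrand hQ s).inner_nonneg_left x
  linarith

theorem inner_covOpInf_nonneg (x : H) : 0 ≤ ⟪covOpInf S Q x, x⟫ := by
  rw [inner_covOpInf hS hQ htr]
  exact integral_nonneg fun s => (isPositive_covIntegrand hQ s).inner_nonneg_left x

theorem tendsto_inner_covOpInf_adjoint (x : H) :
    Tendsto (fun t => ⟪covOpInf S Q (adjoint (S t) x), adjoint (S t) x⟫) atTop (𝓝 0) := by
  have hint := integrableOn_inner_covIntegrand hS hQ htr x x
  have h1 := intervalIntegral_tendsto_integral_Ioi (0 : ℝ) hint tendsto_id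
  have h2 := (tendsto_const_nhds (x := ∫ s in Ioi (0 : ℝ), ⟪covIntegrand S Q s x, x⟫)).sub h1
  rw [sub_self] at h2
  refine h2.congr' ?_
  filter_upwards [eventually_ge_atTop 0] with t ht
  rw [inner_covOpInf_adjoint hS hQ htr ht]
  have := intervalIntegral.integral_interval_add_Ioi hint (hint.mono_set (Ioi_subset_Ioi ht))
  simp only [id]
  linarith

variable (hcomm : ∀ t : ℝ, 0 ≤ t → ∀ a, covOpInf S Q (adjoint (S t) a) = S t (covOpInf S Q a))

include hcomm

/-- Q_s is the difference of Q_∞ and S(s) Q_∞ S*(s), and both satisfy the same commutation relation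
with S*(t). -/
theorem inner_covOp_adjoint_comm {s t : ℝ} (hs : 0 ≤ s) (ht : 0 ≤ t) (x y : H) :
    ⟪covOp S Q s (adjoint (S t) x), y⟫ = ⟪covOp S Q s x, adjoint (S t) y⟫ := by
  have h1 := inner_covOpInf_adjoint_add hS hQ htr hs (adjoint (S t) x) y
  have h2 := inner_covOpInf_adjoint_add hS hQ htr hs x (adjoint (S t) y)
  have h3 : ∀ x y, ⟪covOpInf S Q (adjoint (S t) x), y⟫ = ⟪covOpInf S Q x, adjoint (S t) y⟫ :=
    fun x y => by rw [hcomm t ht, ContinuousLinearMap.adjoint_inner_right]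
  rw [hS.adjoint.comm_apply hs ht, h3, h3] at h1
  rw [hS.adjoint.comm_apply hs ht] at h2
  linarith

-- Q is the derivative of Q_s at s = 0. Relations and inequalities for the forms of Q_s descend to Q
-- through this limit.
omit hcomm in
theorem tendsto_inner_covOp_div (x y : H) :
    Tendsto (fun s : ℝ => s⁻¹ * ⟪covOp S Q s x, y⟫) (𝓝[>] 0) (𝓝 ⟪Q x, y⟫) := by
  have h1 := tendsto_average_of_continuousOn
    (((continuousOn_covIntegrand (Q := Q) hS x).inner continuousOn_const :
      ContinuousOn (fun s => ⟪covIntegrand S Q s x, y⟫) (Ici 0)))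
  have h2 : covIntegrand S Q 0 x = Q x := by
    rw [covIntegrand_apply, hS.map_zero_apply, hS.adjoint.map_zero_apply]
  simp only [h2] at h1
  refine h1.congr' ?_
  filter_upwards [self_mem_nhdsWithin] with s hs
  rw [inner_covOp hS hQ htr, intervalIntegral.integral_of_le (le_of_lt hs), smul_eq_mul]

/-- If the transition semigroup is symmetric then `Q S*(t) = S(t) Q`. -/
theorem apply_adjoint_comm {t : ℝ} (ht : 0 ≤ t) (x : H) : Q (adjoint (S t) x) = S t (Q x) := by
  refine ext_inner_right ℝ fun y => ?_
  rw [← ContinuousLinearMap.adjoint_inner_right (S t) (Q x) y]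
  refine tendsto_nhds_unique (tendsto_inner_covOp_div hS hQ htr (adjoint (S t) x) y)
    ((tendsto_inner_covOp_div hS hQ htr x (adjoint (S t) y)).congr' ?_)
  filter_upwards [self_mem_nhdsWithin] with s hs
  rw [inner_covOp_adjoint_comm hS hQ htr hcomm (le_of_lt hs) ht]

/-- A contraction rate for `S*(t)` in the norm of `Q_∞` is one in the norm of `Q`. -/
theorem inner_apply_adjoint_le_of_covOpInf {t : ℝ} (ht : 0 ≤ t) {c : ℝ} (hc : 0 < c)
    (h : ∀ x, ⟪covOpInf S Q (adjoint (S t) x), adjoint (S t) x⟫ ≤ c * ⟪covOpInf S Q x, x⟫)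
    (x : H) : ⟪Q (adjoint (S t) x), adjoint (S t) x⟫ ≤ c * ⟪Q x, x⟫ := by
  have hs : ∀ s : ℝ, 0 ≤ s →
      ⟪covOp S Q s (adjoint (S t) x), adjoint (S t) x⟫ ≤ c * ⟪covOp S Q s x, x⟫ := by
    intro s hs
    obtain ⟨D, hD, hDe⟩ := exists_covOp_eq hS hQ htr s
    set w : ℕ → H := fun n => ((adjoint (S t)) ^ n) x with hw
    have hw1 : ∀ n, w (n + 1) = adjoint (S t) (w n) := fun n => by
      simp only [hw]
      rw [pow_succ']
      rfl
    have hle : ∀ n, ⟪covOpInf S Q (w n), w n⟫ ≤ ⟪covOpInf S Q x, x⟫ * c ^ n := by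
      intro n
      induction n with
      | zero => simp [hw]
      | succ n ih =>
        rw [hw1]
        refine (h _).trans ?_
        rw [pow_succ]
        nlinarith
    -- S*(t) is symmetric for the nonnegative form of Q_s, so its values along the orbit are
    -- log-convex. They are dominated through Q_s ≤ Q_∞ by a multiple of cⁿ.
    have key := le_mul_of_sq_le_of_le_geometric (u := fun n => ⟪covOp S Q s (w n), w n⟫) (c := c)
      (C := ⟪covOpInf S Q x, x⟫) (fun n => by
        simp only [hDe]
        exact hD.inner_nonneg_left _) (fun n => ?_) hc (fun n => ?_)
    · simpa [hw] using key
    · have e : ⟪D (w (n + 1)), w (n + 1)⟫ = ⟪D (w n), w (n + 2)⟫ := by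
        rw [hw1 (n + 1), ← hDe, ← hDe, ← inner_covOp_adjoint_comm hS hQ htr hcomm hs ht, ← hw1]
      simp only [hDe]
      rw [e]
      exact hD.inner_sq_le _ _
    · refine le_trans ?_ (hle n)
      have h1 := inner_covOpInf_adjoint_add hS hQ htr hs (w n) (w n)
      have h2 := inner_covOpInf_nonneg hS hQ htr (adjoint (S s) (w n))
      linarith
  refine le_of_tendsto_of_tendsto (tendsto_inner_covOp_div hS hQ htr _ _)
    ((tendsto_inner_covOp_div hS hQ htr x x).const_mul c) ?_
  filter_upwards [self_mem_nhdsWithin] with s hs0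
  have h1 := mul_le_mul_of_nonneg_left (hs s (le_of_lt hs0)) (inv_nonneg.2 (le_of_lt hs0))
  linarith

omit hcomm in
/-- A contraction rate for `S*(t)` in the norm of `Q` is one in the norm of `Q_∞`. -/
theorem inner_covOpInf_adjoint_le_of_apply {t : ℝ} (ht : 0 ≤ t) {c : ℝ}
    (h : ∀ x, ⟪Q (adjoint (S t) x), adjoint (S t) x⟫ ≤ c * ⟪Q x, x⟫) (x : H) :
    ⟪covOpInf S Q (adjoint (S t) x), adjoint (S t) x⟫ ≤ c * ⟪covOpInf S Q x, x⟫ := by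
  rw [inner_covOpInf hS hQ htr, inner_covOpInf hS hQ htr, ← integral_const_mul]
  refine setIntegral_mono_on (integrableOn_inner_covIntegrand hS hQ htr _ _)
    ((integrableOn_inner_covIntegrand hS hQ htr x x).const_mul c) measurableSet_Ioi fun s hs => ?_
  -- After S*(s) and S*(t) are exchanged, the hypothesis applies at S*(s) x for each s under the
  -- integral.
  rw [inner_covIntegrand, inner_covIntegrand, hS.adjoint.comm_apply (le_of_lt hs) ht]
  exact h _

theorem inner_apply_adjoint_le {t : ℝ} (ht : 0 ≤ t) (x : H) :
    ⟪Q (adjoint (S t) x), adjoint (S t) x⟫ ≤ ⟪Q x, x⟫ := by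
  have := inner_apply_adjoint_le_of_covOpInf hS hQ htr hcomm ht one_pos
    (fun x => by rw [one_mul]; exact inner_covOpInf_adjoint_le hS hQ htr ht x) x
  rwa [one_mul] at this

/-- `Q` is injective. -/
theorem apply_eq_zero_of_injective_covOpInf (hinj : Function.Injective (covOpInf S Q)) {x : H}
    (hx : Q x = 0) : x = 0 := by
  obtain ⟨C, hC, hCe⟩ := exists_covOpInf_eq hS hQ htr
  have h1 : ⟪C x, x⟫ = 0 := by
    rw [← hCe, inner_covOpInf hS hQ htr]
    refine setIntegral_eq_zero_of_forall_eq_zero fun s hs => ?_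
    -- Q x = 0 forces Q S*(s) x = S(s) Q x = 0 for all s ≥ 0, so the whole covariance form vanishes
    -- at x.
    rw [inner_covIntegrand, apply_adjoint_comm hS hQ htr hcomm (le_of_lt hs), hx, map_zero,
      inner_zero_left]
  have h2 := hC.inner_sq_le x (C x)
  rw [h1, zero_mul, real_inner_self_eq_norm_sq] at h2
  have h3 : C x = 0 := by
    rw [← norm_eq_zero]
    have : ‖C x‖ ^ 2 = 0 := by nlinarith [sq_nonneg (‖C x‖ ^ 2)]
    exact pow_eq_zero_iff two_ne_zero |>.1 this
  refine hinj ?_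
  rw [hCe, hCe, h3, map_zero]

/-! ### The semigroup `Q^{-1/2} S(t) Q^{1/2}` -/

omit hS htr hcomm in
theorem posSqrt_spec : (posSqrt Q).IsPositive ∧ posSqrt Q ∘L posSqrt Q = Q := by
  have h := hQ.exists_sqrt
  rw [posSqrt, dif_pos h]
  exact h.choose_spec

omit hS htr hcomm in
theorem posSqrt_apply_posSqrt (x : H) : posSqrt Q (posSqrt Q x) = Q x :=
  congrArg (fun L : H →L[ℝ] H => L x) (posSqrt_spec hQ).2

omit hS htr hcomm in
theorem norm_posSqrt_sq (x : H) : ‖posSqrt Q x‖ ^ 2 = ⟪Q x, x⟫ := by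
  rw [← real_inner_self_eq_norm_sq, ← (posSqrt_spec hQ).1.inner_left_eq_inner_right,
    posSqrt_apply_posSqrt hQ]

variable (hinj : Function.Injective (covOpInf S Q))

include hinj

theorem posSqrt_injective : Function.Injective (posSqrt Q) := by
  rw [injective_iff_map_eq_zero]
  intro x hx
  refine apply_eq_zero_of_injective_covOpInf hS hQ htr hcomm hinj ?_
  rw [← posSqrt_apply_posSqrt hQ, hx, map_zero]

theorem denseRange_posSqrt : DenseRange (posSqrt Q) := by
  have h1 : (posSqrt Q).range.topologicalClosure = ⊤ := by
    rw [Submodule.topologicalClosure_eq_top_iff, Submodule.eq_bot_iff]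
    intro v hv
    refine posSqrt_injective hS hQ htr hcomm hinj ?_
    rw [map_zero]
    refine ext_inner_left ℝ fun w => ?_
    rw [inner_zero_right, ← (posSqrt_spec hQ).1.inner_left_eq_inner_right]
    exact (Submodule.mem_orthogonal _ _).1 hv _ ⟨w, rfl⟩
  have h2 := (Submodule.dense_iff_topologicalClosure_eq_top).2 h1
  exact h2

/-- Q^{1/2} x ↦ Q^{1/2} S*(t) x is a contraction on a dense range, and its extension satisfies the
defining relation of `semigroupQ` because Q S*(t) = S(t) Q. Injectivity of Q^{1/2} then determines
the chosen operator. -/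
theorem semigroupQ_posSqrt {t : ℝ} (ht : 0 ≤ t) (x : H) :
    semigroupQ S Q t (posSqrt Q x) = posSqrt Q (adjoint (S t) x) := by
  have hdense := denseRange_posSqrt hS hQ htr hcomm hinj
  have hBinj := posSqrt_injective hS hQ htr hcomm hinj
  have hQB := posSqrt_apply_posSqrt hQ
  have hex : ∃ T : H →L[ℝ] H, posSqrt Q ∘L T = S t ∘L posSqrt Q := by
    set f : H →ₗ[ℝ] H := (posSqrt Q ∘L adjoint (S t)).toLinearMap with hf
    have hnorm : ∃ C : ℝ, ∀ x, ‖f x‖ ≤ C * ‖(posSqrt Q).toLinearMap x‖ := by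
      refine ⟨1, fun x => ?_⟩
      rw [one_mul]
      refine le_of_sq_le_sq ?_ (norm_nonneg _)
      have h1 : ‖f x‖ ^ 2 = _ := norm_posSqrt_sq hQ (adjoint (S t) x)
      have h2 : ‖(posSqrt Q).toLinearMap x‖ ^ 2 = _ := norm_posSqrt_sq hQ x
      rw [h1, h2]
      exact inner_apply_adjoint_le hS hQ htr hcomm ht x
    refine ⟨f.extendOfNorm (posSqrt Q).toLinearMap, ?_⟩
    refine ContinuousLinearMap.ext_on (s := range (posSqrt Q))
      (hdense.mono Submodule.subset_span) ?_
    rintro _ ⟨x, rfl⟩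
    have h3 : f.extendOfNorm (posSqrt Q).toLinearMap (posSqrt Q x) = f x :=
      LinearMap.extendOfNorm_eq hdense hnorm x
    rw [ContinuousLinearMap.comp_apply, ContinuousLinearMap.comp_apply, h3, hQB]
    change posSqrt Q (posSqrt Q (adjoint (S t) x)) = _
    rw [hQB, apply_adjoint_comm hS hQ htr hcomm ht]
  have hT : posSqrt Q ∘L semigroupQ S Q t = S t ∘L posSqrt Q := by
    rw [semigroupQ, dif_pos hex]
    exact hex.choose_spec
  refine hBinj ?_
  have h1 := congrArg (fun L : H →L[ℝ] H => L (posSqrt Q x)) hT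
  simp only [ContinuousLinearMap.comp_apply] at h1
  rw [h1, hQB, hQB, apply_adjoint_comm hS hQ htr hcomm ht]

/-- On the dense range of Q^{1/2} the norm bound is the form inequality for Q, since ‖Q^{1/2} x‖² =
⟪Q x, x⟫. The two transfer lemmas exchange Q and Q_∞. -/
theorem norm_semigroupQ_le_iff {t : ℝ} (ht : 0 ≤ t) {c : ℝ} (hc : 0 < c) :
    (∀ h : H, ‖semigroupQ S Q t h‖ ≤ c * ‖h‖) ↔
      ∀ x, ⟪covOpInf S Q (adjoint (S t) x), adjoint (S t) x⟫ ≤ c ^ 2 * ⟪covOpInf S Q x, x⟫ := by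
  have hdense := denseRange_posSqrt hS hQ htr hcomm hinj
  have hQn := norm_posSqrt_sq hQ
  constructor
  · intro h
    refine inner_covOpInf_adjoint_le_of_apply hS hQ htr ht fun x => ?_
    rw [← hQn, ← hQn, ← mul_pow, ← semigroupQ_posSqrt hS hQ htr hcomm hinj ht]
    exact pow_le_pow_left₀ (norm_nonneg _) (h _) 2
  · intro h
    have hcl : IsClosed {y : H | ‖semigroupQ S Q t y‖ ≤ c * ‖y‖} :=
      isClosed_le (by fun_prop) (by fun_prop)
    intro y
    refine hcl.closure_subset_iff.2 ?_ (hdense y)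
    rintro _ ⟨x, rfl⟩
    change ‖semigroupQ S Q t (posSqrt Q x)‖ ≤ c * ‖posSqrt Q x‖
    refine le_of_sq_le_sq ?_ (by positivity)
    rw [semigroupQ_posSqrt hS hQ htr hcomm hinj ht, mul_pow, hQn, hQn]
    exact inner_apply_adjoint_le_of_covOpInf hS hQ htr hcomm ht (by positivity) h x

/-- The operators `Q^{-1/2} S(t) Q^{1/2}` form a strongly continuous semigroup of symmetric
contractions, which tends strongly to `0`. -/
theorem isSymmetricContractionSemigroup_semigroupQ :
    IsSymmetricContractionSemigroup (semigroupQ S Q) 0 := by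
  have hdense := denseRange_posSqrt hS hQ htr hcomm hinj
  have hd : Dense (Submodule.span ℝ (range (posSqrt Q)) : Set H) :=
    hdense.mono Submodule.subset_span
  have hQn := norm_posSqrt_sq hQ
  have hT : ∀ {t : ℝ}, 0 ≤ t → ∀ x, semigroupQ S Q t (posSqrt Q x) = posSqrt Q (adjoint (S t) x) :=
    fun ht x => semigroupQ_posSqrt hS hQ htr hcomm hinj ht x
  have hBs := (posSqrt_spec hQ).1.inner_left_eq_inner_right
  have hle : ∀ t : ℝ, 0 ≤ t → ∀ x, ‖semigroupQ S Q t x‖ ≤ ‖x‖ := by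
    intro t ht x
    have h1 := (norm_semigroupQ_le_iff hS hQ htr hcomm hinj ht one_pos).2 (fun x => by
      rw [one_pow, one_mul]
      exact inner_covOpInf_adjoint_le hS hQ htr ht x) x
    rwa [one_mul] at h1
  have hop : ∀ t : ℝ, 0 ≤ t → ‖semigroupQ S Q t‖ ≤ 1 := fun t ht =>
    ContinuousLinearMap.opNorm_le_bound _ zero_le_one fun x => by
      rw [one_mul]
      exact hle t ht x
  refine ⟨⟨?_, fun s t hs ht => ?_, ?_⟩, fun t ht => ?_, hle, ?_⟩
  · refine ContinuousLinearMap.ext_on hd ?_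
    rintro _ ⟨x, rfl⟩
    rw [hT le_rfl, hS.adjoint.map_zero_apply]
    rfl
  · refine ContinuousLinearMap.ext_on hd ?_
    rintro _ ⟨x, rfl⟩
    rw [ContinuousLinearMap.comp_apply, hT (add_nonneg hs ht), hT ht, hT hs,
      hS.adjoint.map_add_apply hs ht]
  · refine tendsto_apply_of_dense_span (L := ContinuousLinearMap.id ℝ H) (M := 1) ?_ hd ?_
    · filter_upwards [self_mem_nhdsWithin] with t ht
      exact hop t (le_of_lt ht)
    rintro _ ⟨x, rfl⟩
    refine (((posSqrt Q).continuous.tendsto x).comp (hS.adjoint.tendsto_zero x)).congr' ?_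
    filter_upwards [self_mem_nhdsWithin] with t ht
    exact (hT (le_of_lt ht) x).symm
  · have h1 : ∀ x y, ⟪semigroupQ S Q t (posSqrt Q x), posSqrt Q y⟫
        = ⟪posSqrt Q x, semigroupQ S Q t (posSqrt Q y)⟫ := by
      intro x y
      rw [hT ht, hT ht, ← hBs, posSqrt_apply_posSqrt hQ, ← hBs, posSqrt_apply_posSqrt hQ,
        apply_adjoint_comm hS hQ htr hcomm ht, ContinuousLinearMap.adjoint_inner_right]
    intro x y
    have h2 : IsClosed {p : H × H | ⟪semigroupQ S Q t p.1, p.2⟫ = ⟪p.1, semigroupQ S Q t p.2⟫} :=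
      isClosed_eq (by fun_prop) (by fun_prop)
    refine h2.closure_subset_iff.2 ?_ ((hdense.prodMap hdense) (x, y))
    rintro _ ⟨⟨x, y⟩, rfl⟩
    exact h1 x y
  · refine tendsto_apply_of_dense_span (L := (0 : H →L[ℝ] H)) (M := 1) ?_ hd ?_
    · filter_upwards [eventually_ge_atTop 0] with t ht
      exact hop t ht
    rintro _ ⟨x, rfl⟩
    change Tendsto (fun t => semigroupQ S Q t (posSqrt Q x)) atTop (𝓝 0)
    rw [tendsto_zero_iff_norm_tendsto_zero]
    -- The function s ↦ ⟪Q S*(s)x, S*(s)x⟫ is nonincreasing and its integral is at most ⟪Q_∞ x, x⟫,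
    -- so its value at t is at most ⟪Q_∞ x, x⟫ / t.
    have hb : Tendsto (fun t : ℝ => √(t⁻¹ * ⟪covOpInf S Q x, x⟫)) atTop (𝓝 0) := by
      have := (tendsto_inv_atTop_zero.mul_const ⟪covOpInf S Q x, x⟫).sqrt
      simpa using this
    refine squeeze_zero' (Eventually.of_forall fun _ => norm_nonneg _) ?_ hb
    filter_upwards [eventually_gt_atTop 0] with t ht
    refine Real.le_sqrt_of_sq_le ?_
    rw [hT ht.le, hQn, le_inv_mul_iff₀ ht]
    have h1 : ∫ _ in Ioc 0 t, ⟪Q (adjoint (S t) x), adjoint (S t) x⟫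
        ≤ ∫ s in Ioc 0 t, ⟪covIntegrand S Q s x, x⟫ := by
      refine setIntegral_mono_on (by simp) ((integrableOn_inner_covIntegrand hS hQ htr x x).mono_set
        Ioc_subset_Ioi_self) measurableSet_Ioc fun s hs => ?_
      have e : adjoint (S t) x = adjoint (S (t - s)) (adjoint (S s) x) := by
        rw [← hS.adjoint.map_add_apply (sub_nonneg.2 hs.2) hs.1.le, sub_add_cancel]
      rw [inner_covIntegrand, e]
      exact inner_apply_adjoint_le hS hQ htr hcomm (sub_nonneg.2 hs.2) _
    rw [← inner_covOp hS hQ htr] at h1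
    simp only [integral_const, MeasurableSet.univ, measureReal_restrict_apply, univ_inter,
      Real.volume_real_Ioc, sub_zero, smul_eq_mul, max_eq_left ht.le] at h1
    have h2 := inner_covOpInf_adjoint_add hS hQ htr ht.le x x
    have h3 := inner_covOpInf_nonneg hS hQ htr (adjoint (S t) x)
    linarith

end Symmetry


/-! ### The rate of convergence to equilibrium -/

section Mean

variable {Ω : Type*} [MeasurableSpace Ω] (μ : Measure Ω) [IsFiniteMeasure μ]

/-- The operator on `L²(μ)` mapping `f` to the constant function `∫ f dμ`. -/
noncomputable def meanLp : Lp ℝ 2 μ →L[ℝ] Lp ℝ 2 μ :=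
  (innerSL ℝ (Lp.const 2 μ (1 : ℝ))).smulRight (Lp.const 2 μ 1)

theorem meanLp_eq (f : Lp ℝ 2 μ) : meanLp μ f = ⟪Lp.const 2 μ (1 : ℝ), f⟫ • Lp.const 2 μ (1 : ℝ) :=
  rfl

theorem meanLp_apply (f : Lp ℝ 2 μ) : meanLp μ f = Lp.const 2 μ (∫ x, f x ∂μ) := by
  have h1 : ⟪Lp.const 2 μ (1 : ℝ), f⟫ = ∫ x, f x ∂μ := by
    rw [L2.inner_def]
    refine integral_congr_ae ?_
    filter_upwards [Lp.coeFn_const (p := 2) (μ := μ) (1 : ℝ)] with x hx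
    rw [hx]
    simp
  rw [meanLp_eq, h1]
  have h2 := (Lp.constₗ 2 μ ℝ : ℝ →ₗ[ℝ] Lp ℝ 2 μ).map_smul (∫ x, f x ∂μ) 1
  rw [smul_eq_mul, mul_one] at h2
  exact h2.symm

end Mean

theorem le_mul_of_sinh_le {p q c : ℝ}
    (h : ∀ x : ℝ, 0 < x → Real.sinh (x * p) ≤ c * Real.sinh (x * q)) : p ≤ c * q := by
  have hd : ∀ p : ℝ, Tendsto (fun x : ℝ => x⁻¹ * Real.sinh (x * p)) (𝓝[>] 0) (𝓝 p) := by
    intro p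
    have h1 : HasDerivAt (fun x : ℝ => Real.sinh (x * p)) p 0 := by
      simpa using ((hasDerivAt_id (0 : ℝ)).mul_const p).sinh
    have h2 := h1.tendsto_slope_zero_right
    simpa using h2
  refine le_of_tendsto_of_tendsto (hd p) ((hd q).const_mul c) ?_
  filter_upwards [self_mem_nhdsWithin] with x hx
  have h1 := mul_le_mul_of_nonneg_left (h x hx) (inv_nonneg.2 (le_of_lt hx))
  linarith

section Rate

open ContinuousLinearMap (adjoint)

variable {H : Type*} [NormedAddCommGroup H] [InnerProductSpace ℝ H] [CompleteSpace H]
  [MeasurableSpace H] [BorelSpace H] [SecondCountableTopology H]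

theorem IsCenteredGaussian.inner_cosLp_const {μ : Measure H} [IsFiniteMeasure μ] {C : H → H}
    (h : IsCenteredGaussian μ C) (a : H) (θ : ℝ) :
    ⟪cosLp μ a θ, Lp.const 2 μ (1 : ℝ)⟫ = Real.exp (-(⟪C a, a⟫ / 2)) * Real.cos θ := by
  rw [← cosLp_zero, h.inner_cosLp]
  simp

variable {S : ℝ → H →L[ℝ] H} {Q : H →L[ℝ] H}
  (hS : IsC0Semigroup S) (hQ : Q.IsPositive)
  (htr : ∫⁻ s in Ioi (0 : ℝ), posTrace (covIntegrand S Q s) < ⊤)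

include hS hQ htr

theorem norm_cosLp_sq (a : H) (θ : ℝ) : ‖cosLp (invMeasure S Q) a θ‖ ^ 2
    = (Real.exp (-2 * ⟪covOpInf S Q a, a⟫) * Real.cos (2 * θ) + 1) / 2 := by
  obtain ⟨C, hC, hCe⟩ := exists_covOpInf_eq hS hQ htr
  have hμ := isCenteredGaussian_invMeasure hS hQ htr
  rw [← real_inner_self_eq_norm_sq, hμ.inner_cosLp]
  simp only [hCe, sub_self, map_zero, inner_zero_right, zero_div, neg_zero, Real.exp_zero,
    Real.cos_zero, mul_one, map_add, inner_add_left, inner_add_right]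
  ring_nf

/-- The distance to equilibrium of the trigonometric functions. -/
theorem norm_ouL2_cosLp_sub_sq {t : ℝ} (ht : 0 ≤ t) (a : H) (θ : ℝ) :
    ‖ouL2 S Q t (cosLp _ a θ) - meanLp _ (cosLp _ a θ)‖ ^ 2
      = Real.exp (-⟪covOpInf S Q a, a⟫) / 2
        * ((Real.exp ⟪covOpInf S Q (adjoint (S t) a), adjoint (S t) a⟫ - 1)
          + (Real.exp (-⟪covOpInf S Q (adjoint (S t) a), adjoint (S t) a⟫) - 1)
            * Real.cos (2 * θ)) := by
  have hμ := isCenteredGaussian_invMeasure hS hQ htr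
  have h1 := inner_covOpInf_adjoint_add hS hQ htr ht a a
  have hone : ‖Lp.const 2 (invMeasure S Q) (1 : ℝ)‖ ^ 2 = 1 := by
    have := norm_cosLp_sq hS hQ htr (0 : H) 0
    rw [cosLp_zero] at this
    rw [this]
    simp
  rw [meanLp_eq, real_inner_comm, hμ.inner_cosLp_const, ouL2_cosLp hS hQ htr ht, norm_sub_sq_real,
    real_inner_smul_left, real_inner_smul_right, hμ.inner_cosLp_const, norm_smul, norm_smul,
    mul_pow, mul_pow, hone, norm_cosLp_sq hS hQ htr, Real.norm_eq_abs, Real.norm_eq_abs, sq_abs,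
    sq_abs]
  have h2 : ⟪covOp S Q t a, a⟫ = ⟪covOpInf S Q a, a⟫
    - ⟪covOpInf S Q (adjoint (S t) a), adjoint (S t) a⟫ := by linarith
  rw [h2]
  generalize ⟪covOpInf S Q a, a⟫ = q
  generalize ⟪covOpInf S Q (adjoint (S t) a), adjoint (S t) a⟫ = p
  have e1 : Real.exp (-((q - p) / 2)) = Real.exp (-(q / 2)) * Real.exp (p / 2) := by
    rw [← Real.exp_add]; ring_nf
  have e2 : Real.exp (-q) = Real.exp (-(q / 2)) ^ 2 := by
    rw [← Real.exp_nat_mul]; ring_nf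
  have e3 : Real.exp p = Real.exp (p / 2) ^ 2 := by
    rw [← Real.exp_nat_mul]; ring_nf
  have e4 : Real.exp (-p) = Real.exp (-(p / 2)) ^ 2 := by
    rw [← Real.exp_nat_mul]; ring_nf
  have e5 : Real.exp (-2 * p) = Real.exp (-(p / 2)) ^ 4 := by
    rw [← Real.exp_nat_mul]; ring_nf
  have e6 : Real.exp (p / 2) * Real.exp (-(p / 2)) = 1 := by
    rw [← Real.exp_add, add_neg_cancel, Real.exp_zero]
  rw [e1, e2, e3, e4, e5, Real.cos_two_mul]
  generalize Real.exp (-(q / 2)) = x at *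
  generalize Real.exp (p / 2) = y at *
  generalize Real.exp (-(p / 2)) = z at *
  generalize Real.cos θ = w
  have e7 : y ^ 2 * z ^ 4 = z ^ 2 := by
    have : y ^ 2 * z ^ 4 = (y * z) ^ 2 * z ^ 2 := by ring
    rw [this, e6, one_pow, one_mul]
  linear_combination (x ^ 2 * (2 * w ^ 2 - 1) / 2) * e7 - 2 * x ^ 2 * w ^ 2 * e6

/-- The worst phase has cos 2θ = -1. Since p ≤ q, the explicit value is then at most (1 - e^{-2p})/2
≤ p. -/
theorem norm_ouL2_cosLp_sub_sq_le {t : ℝ} (ht : 0 ≤ t) (a : H) (θ : ℝ) :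
    ‖ouL2 S Q t (cosLp _ a θ) - meanLp _ (cosLp _ a θ)‖ ^ 2
      ≤ ⟪covOpInf S Q (adjoint (S t) a), adjoint (S t) a⟫ := by
  rw [norm_ouL2_cosLp_sub_sq hS hQ htr ht]
  have h1 := inner_covOpInf_adjoint_le hS hQ htr ht a
  have h2 := inner_covOpInf_nonneg hS hQ htr (adjoint (S t) a)
  revert h1 h2
  generalize ⟪covOpInf S Q a, a⟫ = q
  generalize ⟪covOpInf S Q (adjoint (S t) a), adjoint (S t) a⟫ = p
  intro h1 h2
  have h3 : Real.exp (-p) ≤ 1 := Real.exp_le_one_iff.2 (by linarith)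
  have h4 := Real.neg_one_le_cos (2 * θ)
  have h5 : Real.exp (-q) ≤ Real.exp (-p) := Real.exp_le_exp.2 (by linarith)
  have h6 : Real.exp (-p) * Real.exp p = 1 := by
    rw [← Real.exp_add, neg_add_cancel, Real.exp_zero]
  have h7 : 1 - 2 * p ≤ Real.exp (-p) ^ 2 := by
    have := Real.add_one_le_exp (-(2 * p))
    have e : Real.exp (-p) ^ 2 = Real.exp (-(2 * p)) := by
      rw [← Real.exp_nat_mul]; ring_nf
    linarith
  have h8 : (Real.exp p - 1) + (Real.exp (-p) - 1) * Real.cos (2 * θ)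
      ≤ Real.exp p - Real.exp (-p) := by nlinarith
  have h9 : 0 ≤ Real.exp p - Real.exp (-p) :=
    sub_nonneg.2 (Real.exp_le_exp.2 (by linarith))
  have h10 := Real.exp_pos (-q)
  nlinarith [mul_le_mul_of_nonneg_left h8 h10.le, mul_le_mul_of_nonneg_right h5 h9]

/-- The transition semigroup converges to the mean. -/
theorem isSymmetricContractionSemigroup_ouL2 (hsymm : IsSymmetricOU S Q) :
    IsSymmetricContractionSemigroup (ouL2 S Q) (meanLp (invMeasure S Q)) where
  isC0 := isC0Semigroup_ouL2 hS hQ htr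
  symm t ht := inner_ouL2_comm hS hQ htr hsymm ht
  norm_le t ht x := by simpa using (ouL2 S Q t).le_of_opNorm_le (norm_ouL2_le hS hQ htr ht) x
  tendsto := by
    refine tendsto_apply_of_dense_span (M := 1) ?_ (dense_span_cosLp _) ?_
    · filter_upwards [eventually_ge_atTop 0] with t ht
      exact norm_ouL2_le hS hQ htr ht
    rintro _ ⟨p, rfl⟩
    rw [tendsto_iff_norm_sub_tendsto_zero]
    have h1 : Tendsto (fun t => √⟪covOpInf S Q (adjoint (S t) p.1), adjoint (S t) p.1⟫) atTop
        (𝓝 0) := by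
      simpa using (tendsto_inner_covOpInf_adjoint hS hQ htr p.1).sqrt
    refine squeeze_zero' (Eventually.of_forall fun _ => norm_nonneg _) ?_ h1
    filter_upwards [eventually_ge_atTop 0] with t ht
    exact Real.le_sqrt_of_sq_le (norm_ouL2_cosLp_sub_sq_le hS hQ htr ht _ _)

/-- One direction tests on sines of vanishing frequency. The other propagates geometric decay from
the total set of cosines to the norm of the symmetric operator R_t - mean. -/
theorem norm_ouL2_sub_le_iff (hsymm : IsSymmetricOU S Q) {t : ℝ} (ht : 0 ≤ t) {c : ℝ}
    (hc : 0 < c) :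
    (∀ φ, ‖ouL2 S Q t φ - meanLp _ φ‖ ≤ c * ‖φ‖) ↔
      ∀ x, ⟪covOpInf S Q (adjoint (S t) x), adjoint (S t) x⟫ ≤ c ^ 2 * ⟪covOpInf S Q x, x⟫ := by
  have hR := isSymmetricContractionSemigroup_ouL2 hS hQ htr hsymm
  constructor
  · intro h x
    refine le_mul_of_sinh_le fun r hr => ?_
    obtain ⟨C, hC, hCe⟩ := exists_covOpInf_eq hS hQ htr
    -- At frequency √r x and phase π/2 the two squared norms are e^{-rq} sinh(rp) and e^{-rq}
    -- sinh(rq), so the bound reads sinh(rp) ≤ c² sinh(rq).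
    have h1 := pow_le_pow_left₀ (norm_nonneg _) (h (cosLp _ (√r • x) (Real.pi / 2))) 2
    rw [mul_pow, norm_ouL2_cosLp_sub_sq hS hQ htr ht, norm_cosLp_sq hS hQ htr,
      mul_div_cancel₀ _ two_ne_zero, Real.cos_pi] at h1
    simp only [hCe, map_smul, real_inner_smul_left, real_inner_smul_right] at h1 ⊢
    simp only [← mul_assoc, Real.mul_self_sqrt hr.le] at h1
    generalize ⟪C (adjoint (S t) x), adjoint (S t) x⟫ = p at h1 ⊢
    generalize ⟪C x, x⟫ = q at h1 ⊢
    have e1 : Real.exp (-2 * r * q) = Real.exp (-(r * q)) * Real.exp (-(r * q)) := by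
      rw [← Real.exp_add]; ring_nf
    have e2 : Real.exp (-(r * q)) * Real.exp (r * q) = 1 := by
      rw [← Real.exp_add, neg_add_cancel, Real.exp_zero]
    rw [e1] at h1
    rw [Real.sinh_eq, Real.sinh_eq]
    refine le_of_mul_le_mul_left ?_ (Real.exp_pos (-(r * q)))
    linear_combination h1 - c ^ 2 / 2 * e2
  · intro h
    set T := ouL2 S Q t - meanLp (invMeasure S Q) with hT
    have hTx : ∀ x, T x = ouL2 S Q t x - meanLp _ x := fun x => rfl
    have hpow : ∀ (n : ℕ) x, (T ^ (n + 1)) x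
        = ouL2 S Q ((n + 1 : ℕ) * t) x - meanLp _ x := by
      intro n x
      induction n with
      | zero => simp [hTx]
      | succ n ih =>
        have h0 : 0 ≤ ((n + 1 : ℕ) : ℝ) * t := by positivity
        have e : ((n + 1 + 1 : ℕ) : ℝ) * t = t + (n + 1 : ℕ) * t := by push_cast; ring
        rw [pow_succ']
        change T ((T ^ (n + 1)) x) = _
        rw [ih, hTx, e, hR.isC0.map_add_apply ht h0, map_sub, map_sub,
          hR.proj_apply h0, hR.proj_proj, hR.apply_proj ht, sub_self, sub_zero]
    refine norm_apply_le_of_pow_le_geometric (T := T) (fun x y => ?_) (dense_span_cosLp _) hc ?_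
    · rw [hTx, hTx, inner_sub_left, inner_sub_right, hR.symm t ht, hR.proj_symm]
    rintro _ ⟨⟨a, θ⟩, rfl⟩
    have hq := inner_covOpInf_nonneg hS hQ htr a
    have hgeo : ∀ n : ℕ, ⟪covOpInf S Q (adjoint (S (n * t)) a), adjoint (S (n * t)) a⟫
        ≤ ⟪covOpInf S Q a, a⟫ * (c ^ n) ^ 2 := by
      intro n
      induction n with
      | zero => simp [hS.adjoint.map_zero_apply]
      | succ n ih =>
        have h0 : 0 ≤ (n : ℝ) * t := by positivity
        have e : ((n + 1 : ℕ) : ℝ) * t = t + n * t := by push_cast; ring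
        rw [e, hS.adjoint.map_add_apply ht h0]
        refine (h _).trans ?_
        calc _ ≤ c ^ 2 * (⟪covOpInf S Q a, a⟫ * (c ^ n) ^ 2) :=
              mul_le_mul_of_nonneg_left ih (sq_nonneg c)
          _ = _ := by ring
    -- The norm of the cosine covers only the zeroth power, which is the identity and not R_0 -
    -- mean.
    refine ⟨‖cosLp (invMeasure S Q) a θ‖ + √⟪covOpInf S Q a, a⟫, fun n => ?_⟩
    rcases n with _ | n
    · simp
    have h0 : 0 ≤ ((n + 1 : ℕ) : ℝ) * t := by positivity
    have h1 : ‖(T ^ (n + 1)) (cosLp _ a θ)‖ ≤ √⟪covOpInf S Q a, a⟫ * c ^ (n + 1) := by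
      refine le_of_sq_le_sq ?_ (by positivity)
      rw [mul_pow, Real.sq_sqrt hq, hpow]
      exact (norm_ouL2_cosLp_sub_sq_le hS hQ htr h0 a θ).trans (hgeo (n + 1))
    refine h1.trans (mul_le_mul_of_nonneg_right ?_ (by positivity))
    linarith [norm_nonneg (cosLp (invMeasure S Q) a θ)]

end Rate

/-! ### Conclusion: both estimates meet in the form inequality -/

theorem theorem4p1 {H : Type*} [NormedAddCommGroup H] [InnerProductSpace ℝ H] [CompleteSpace H]
    [TopologicalSpace.SeparableSpace H] [MeasurableSpace H] [BorelSpace H]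
    (S : ℝ → H →L[ℝ] H) (hS : IsC0Semigroup S)
    (Q : H →L[ℝ] H) (hQ : Q.IsPositive)
    (htr : ∫⁻ s in Set.Ioi (0 : ℝ), posTrace (covIntegrand S Q s) < ⊤)
    (hinj : Function.Injective (covOpInf S Q))
    (hsymm : IsSymmetricOU S Q) :
    (∀ β t : ℝ, 0 ≤ t →
      ((∀ h : H, ‖semigroupQ S Q t h‖ ≤ Real.exp (-β * t) * ‖h‖) ↔
        ∀ φ : Lp ℝ 2 (invMeasure S Q),
          ‖ouL2 S Q t φ - Lp.const 2 (invMeasure S Q) (∫ x, φ x ∂(invMeasure S Q))‖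
            ≤ Real.exp (-β * t) * ‖φ‖)) ∧
    spectralGap (generator (ouL2 S Q)) = spectralGap (generator (semigroupQ S Q)) := by
  have : SecondCountableTopology H := UniformSpace.secondCountable_of_separable H
  have hcomm : ∀ t : ℝ, 0 ≤ t → ∀ a,
      covOpInf S Q (ContinuousLinearMap.adjoint (S t) a) = S t (covOpInf S Q a) :=
    fun t ht => covOpInf_adjoint_comm hS hQ htr hsymm ht
  have hR := isSymmetricContractionSemigroup_ouL2 hS hQ htr hsymm
  have hSQ := isSymmetricContractionSemigroup_semigroupQ hS hQ htr hcomm hinj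
  have hiff : ∀ β t : ℝ, 0 ≤ t → ((∀ h : H, ‖semigroupQ S Q t h‖ ≤ Real.exp (-β * t) * ‖h‖) ↔
      ∀ φ, ‖ouL2 S Q t φ - meanLp _ φ‖ ≤ Real.exp (-β * t) * ‖φ‖) := fun β t ht =>
    (norm_semigroupQ_le_iff hS hQ htr hcomm hinj ht (Real.exp_pos _)).trans
      (norm_ouL2_sub_le_iff hS hQ htr hsymm ht (Real.exp_pos _)).symm
  refine ⟨fun β t ht => ?_, ?_⟩
  · simp only [← meanLp_apply]
    exact hiff β t ht
  -- For β ≥ 0 both bounds on the gap are decay statements, with limits the mean and 0. For β ≤ 0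
  -- both hold because the gaps are nonnegative. Having the same real lower bounds, the gaps
  -- coincide in `EReal`.
  have hle : ∀ β : ℝ, (β : EReal) ≤ spectralGap (generator (ouL2 S Q)) ↔
      (β : EReal) ≤ spectralGap (generator (semigroupQ S Q)) := by
    intro β
    rcases le_total 0 β with hβ | hβ
    · rw [hR.le_spectralGap_iff_decay hβ, hSQ.le_spectralGap_iff_decay hβ]
      simp only [zero_apply, sub_zero]
      exact forall₂_congr fun t ht => (hiff β t ht).symm
    · have hβ' : (β : EReal) ≤ 0 := by exact_mod_cast hβ
      exact iff_of_true (hβ'.trans hR.spectralGap_nonneg) (hβ'.trans hSQ.spectralGap_nonneg)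
  refine le_antisymm ?_ ?_
  · exact EReal.ge_of_forall_gt_iff_ge.1 fun z hz => (hle z).1 hz.le
  · exact EReal.ge_of_forall_gt_iff_ge.1 fun z hz => (hle z).2 hz.le
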